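/- Let $n\ge 2$ and write $\widehat f(\xi)=\int_{\mathbb R^n} f(x)e^{-ix\cdot\xi}\,dx$. For a symbol $a$ let $a(D)$ be the Fourier multiplier $a(D)f(x)=(2\pi)^{-n}\int e^{ix\cdot\xi}a(\xi)\widehat f(\xi)\,d\xi$, acting on tempered distributions. Fix the following data. * A function $\psi_0\in C_c^\infty(\mathbb R^n)$ with $\psi_0=1$ on $B(0,1)$ and $\psi_0=0$ outside $B(0,2)$; $\mathrm{bmo}$ is the space of locally integrable functions $f$ with $\|f\|_{\mathrm{bmo}}:=\|f\|_{\mathrm{BMO}}+\|\psi_0(D)f\|_{L^\infty}<\infty$. * A non-negative, radial, radially decreasing, smooth function $\vartheta$ on $\mathbb R^n$ with $\vartheta(\xi)=1$ for $|\xi|\le1$ and $\vartheta(\xi)=0$ for $|\xi|\ge2$, such that $\sqrt{1-\vartheta^2}$ is smooth; an integer $k_1\ge0$; and, for $K\in\mathbb Z$, the non-negative functions $\psi_K^\ast,\zeta_K$ given by $$\psi^\ast_K(\xi)^2=\vartheta(2^{-1-K}\xi)^2-\vartheta(2^{2-K}\xi)^2,\qquad \zeta_K(\xi)^2=\vartheta(2^{-K-k_1-2}\xi)^2-\vartheta(2^{3+k_1-K}\xi)^2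 .$$ * An integer $k_0$ and a smooth $\chi_0:\mathbb R^n\to\mathbb R$ with $\chi_0(\xi)=1$ for $|\xi|\ge2^{k_0-4}$ and $\chi_0(\xi)=0$ for $|\xi|\le2^{k_0-5}$; put $d(\xi)=|\xi|^{-(n-1)/2}\chi_0(\xi)$. * A phase $\varphi:\mathbb R^n\to\mathbb R$, that is, a function that is smooth on $\mathbb R^n\setminus\{0\}$ and satisfies $\varphi(t\xi)=t\varphi(\xi)$ for all $t>0$; put $T^\varphi_d f(x)=(2\pi)^{-n}\int e^{ix\cdot\xi+i\varphi(\xi)}d(\xi)\widehat f(\xi)\,d\xi$. * A real number $s$. For $u\in\mathbb R^n$ and $K\in\mathbb Z$ let $Q^{u,1}_K$ and $Q^{u,2}_K$ be the Fourier multipliers with symbols $|2^{-K}\xi|^{s}\psi^\ast_K(\xi)e^{i2^{-K}\xi\cdot u}$ and $\zeta_K(\xi)e^{i2^{-K}\xi\cdot u}$, respectively. For a Borel measure $\mu$ on $\mathbb R^n\times(0,\infty)$ let $\|\mu\|_{\mathcal C}=\sup_Q |Q|^{-1}\mu\big(Q\times(0,\ell(Q)]\big)$, where the supremum is over all cubes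 $Q\subset\mathbb R^n$ and $\ell(Q)$ is the diameter of $Q$; $\mu$ is a Carleson measure if $\|\mu\|_{\mathcal C}<\infty$. Then for each $j\in\{1,2\}$ there is a constant $C>0$, depending only on $j$ and the data fixed above, such that for all $u\in\mathbb R^n$, all integers $k\ge0$ and all $f\in\mathrm{bmo}$ the following holds. The function $f$ defines a tempered distribution, each $(Q^{u,j}_{k+k'}\circ T^\varphi_d)(f)$, $k'\ge0$, is a continuous function, and $$d\mu_k(x,t)=\sum_{k'=0}^\infty\big|(Q^{u,j}_{k+k'}\circ T^\varphi_d)(f)(x)\big|^2\,\delta_{2^{-k'}}(t)\,dx$$ is a Carleson measure with $\|\mu_k\|_{\mathcal C}\le C\,2^{-k/2}\,\|f\|_{\mathrm{bmo}}^2$. -/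

import Mathlib

open MeasureTheory Set
open scoped ENNReal ContDiff SchwartzMap InnerProductSpace

noncomputable section

/-- The Euclidean space `ℝⁿ`. -/
abbrev Rn (n : ℕ) : Type := EuclideanSpace ℝ (Fin n)

/-! ## Phases and cut-off functions -/

/-- A phase function: real-valued, smooth away from the origin and positively homogeneous of
degree one. -/
structure IsPhase {n : ℕ} (φ : Rn n → ℝ) : Prop where
  smooth : ContDiffOn ℝ ∞ φ {0}ᶜ
  homogeneous : ∀ (ξ : Rn n) (t : ℝ), 0 < t → φ (t • ξ) = t * φ ξ

/-- The low frequency cut-off `ψ₀` of a Littlewood-Paley partition of unity (it enters the norm of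
`bmo`): smooth, equal to `1` on `B(0,1)` and vanishing outside `B(0,2)`. -/
structure IsLowFrequencyCutoff {n : ℕ} (ψ₀ : Rn n → ℂ) : Prop where
  smooth : ContDiff ℝ ∞ ψ₀
  eq_one : ∀ ξ, ‖ξ‖ < 1 → ψ₀ ξ = 1
  eq_zero : ∀ ξ, 2 ≤ ‖ξ‖ → ψ₀ ξ = 0

/-- A non-negative, radial, radially decreasing, smooth cut-off function `ϑ`, equal to `1` for
`|ξ| ≤ 1` and to `0` for `|ξ| ≥ 2`. (Radial and radially decreasing together say that
`ϑ η ≤ ϑ ξ` whenever `‖ξ‖ ≤ ‖η‖`.) The last field says exactly that the annular cut-off functions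
`psi` and `zeta` below, which are square roots of differences of squares of dilates of `ϑ`,
are smooth. -/
structure IsRadialCutoff {n : ℕ} (ϑ : Rn n → ℝ) : Prop where
  nonneg : ∀ ξ, 0 ≤ ϑ ξ
  smooth : ContDiff ℝ ∞ ϑ
  radially_decreasing : ∀ ξ η, ‖ξ‖ ≤ ‖η‖ → ϑ η ≤ ϑ ξ
  eq_one : ∀ ξ, ‖ξ‖ ≤ 1 → ϑ ξ = 1
  eq_zero : ∀ ξ, 2 ≤ ‖ξ‖ → ϑ ξ = 0
  smooth_sqrt : ContDiff ℝ ∞ fun ξ => √(1 - ϑ ξ ^ 2)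

/-- A high frequency cut-off `χ₀`: smooth, equal to `1` for `|ξ| ≥ 2^(k₀-4)` and to `0` for
`|ξ| ≤ 2^(k₀-5)`. -/
structure IsHighFrequencyCutoff {n : ℕ} (k₀ : ℤ) (χ₀ : Rn n → ℝ) : Prop where
  smooth : ContDiff ℝ ∞ χ₀
  eq_one : ∀ ξ, (2 : ℝ) ^ (k₀ - 4) ≤ ‖ξ‖ → χ₀ ξ = 1
  eq_zero : ∀ ξ, ‖ξ‖ ≤ (2 : ℝ) ^ (k₀ - 5) → χ₀ ξ = 0

/-- The non-negative function `ψ_K` with `ψ_K(ξ)² = ϑ(2^(-1-K) ξ)² - ϑ(2^(2-K) ξ)²`. -/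
def psi {n : ℕ} (ϑ : Rn n → ℝ) (K : ℤ) (ξ : Rn n) : ℝ :=
  √(ϑ ((2 : ℝ) ^ (-1 - K) • ξ) ^ 2 - ϑ ((2 : ℝ) ^ (2 - K) • ξ) ^ 2)

/-- The non-negative function `ζ_K` with
`ζ_K(ξ)² = ϑ(2^(-K-k₁-2) ξ)² - ϑ(2^(3+k₁-K) ξ)²`. -/
def zeta {n : ℕ} (ϑ : Rn n → ℝ) (k₁ : ℕ) (K : ℤ) (ξ : Rn n) : ℝ :=
  √(ϑ ((2 : ℝ) ^ (-K - k₁ - 2) • ξ) ^ 2 - ϑ ((2 : ℝ) ^ (3 + k₁ - K) • ξ) ^ 2)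

/-! ## The operators -/

/-- The Fourier multiplier `a(D)`, `(a(D) f)(x) = (2π)⁻ⁿ ∫ exp(i x·ξ) a(ξ) f̂(ξ) dξ` with
`f̂(ξ) = ∫ exp(-i x·ξ) f(x) dx`, acting on tempered distributions (`a` smooth with all derivatives
of at most polynomial growth). Mathlib's Fourier transform is `f̂(2π ξ)`, whence the dilation. -/
def multiplier {n : ℕ} (a : Rn n → ℂ) : 𝓢'(Rn n, ℂ) →L[ℂ] 𝓢'(Rn n, ℂ) :=
  TemperedDistribution.fourierMultiplierCLM ℂ fun ξ => a ((2 * Real.pi) • ξ)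

/-- The amplitude `d(ξ) = |ξ|^μ χ₀(ξ)`. -/
def amplitude {n : ℕ} (χ₀ : Rn n → ℝ) (μ : ℝ) (ξ : Rn n) : ℂ :=
  (‖ξ‖ ^ μ * χ₀ ξ : ℝ)

/-- The linear Fourier integral operator
`(T_d^φ f)(x) = (2π)⁻ⁿ ∫ exp(i x·ξ + i φ(ξ)) d(ξ) f̂(ξ) dξ` with `x`-independent amplitude `d`. -/
def fio {n : ℕ} (φ : Rn n → ℝ) (d : Rn n → ℂ) : 𝓢'(Rn n, ℂ) →L[ℂ] 𝓢'(Rn n, ℂ) :=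
  multiplier fun ξ => Complex.exp (Complex.I * (φ ξ : ℂ)) * d ξ

/-- The modulation `exp(i 2^(-K) ξ·u)`. -/
def modulation {n : ℕ} (u : Rn n) (K : ℤ) (ξ : Rn n) : ℂ :=
  Complex.exp (Complex.I * (((2 : ℝ) ^ (-K) * ⟪ξ, u⟫_ℝ : ℝ) : ℂ))

/-- The frequency localisation operators `Q_K^{u_j}`, `j = 1, 2`:
the multiplier is `|2^(-K) ξ|^s ψ_K(ξ) exp(i 2^(-K) ξ·u)` for `j = 1` and
`ζ_K(ξ) exp(i 2^(-K) ξ·u)` for `j = 2`. -/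
def opQ {n : ℕ} (ϑ : Rn n → ℝ) (s : ℝ) (k₁ : ℕ) (j : ℕ) (u : Rn n) (K : ℤ) :
    𝓢'(Rn n, ℂ) →L[ℂ] 𝓢'(Rn n, ℂ) :=
  if j = 1 then
    multiplier fun ξ =>
      ((‖(2 : ℝ) ^ (-K) • ξ‖ ^ s * psi ϑ K ξ : ℝ) : ℂ) * modulation u K ξ
  else
    multiplier fun ξ => (zeta ϑ k₁ K ξ : ℂ) * modulation u K ξ

/-- The tempered distribution `U` is (given by integration against) the function `f`. -/
def Represents {n : ℕ} (U : 𝓢'(Rn n, ℂ)) (f : Rn n → ℂ) : Prop :=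
  ∀ g : 𝓢(Rn n, ℂ), Integrable (fun x => g x * f x) ∧ U g = ∫ x, g x * f x

/-! ## The space `bmo` -/

/-- The John-Nirenberg seminorm of `BMO`: the supremum over all balls `B` of the mean over `B` of
`|f - f_B|`, with `f_B` the mean of `f` over `B`. -/
def bmoSeminorm {n : ℕ} (f : Rn n → ℂ) : ℝ≥0∞ :=
  ⨆ (x : Rn n) (r : ℝ) (_ : 0 < r),
    ⨍⁻ y in Metric.ball x r, ‖f y - ⨍ z in Metric.ball x r, f z ∂volume‖ₑ ∂volume

/-- `ψ₀(D) f` for `ψ₀` smooth with compact support: the convolution of `f` with the Schwartz function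
`z ↦ (2π)⁻ⁿ ∫ exp(i z·ξ) ψ₀(ξ) dξ`. The integral converges absolutely when `f` is in `BMO`. -/
def lowFrequencyPart {n : ℕ} (ψ₀ : Rn n → ℂ) (f : Rn n → ℂ) (x : Rn n) : ℂ :=
  ∫ y, (((2 * Real.pi) ^ n : ℝ) : ℂ)⁻¹ *
    (∫ ξ, Complex.exp (Complex.I * (⟪x - y, ξ⟫_ℝ : ℂ)) * ψ₀ ξ) * f y

/-- The norm of `bmo`: `‖f‖_BMO + ‖ψ₀(D) f‖_∞`. -/
def bmoNorm {n : ℕ} (ψ₀ : Rn n → ℂ) (f : Rn n → ℂ) : ℝ≥0∞ :=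
  bmoSeminorm f + eLpNorm (lowFrequencyPart ψ₀ f) ⊤ volume

/-- `f` belongs to `bmo`. -/
def MemBmo {n : ℕ} (ψ₀ : Rn n → ℂ) (f : Rn n → ℂ) : Prop :=
  LocallyIntegrable f ∧ bmoNorm ψ₀ f < ⊤

/-! ## Carleson measures -/

/-- The closed cube with centre `c`, half side length `h` and sides parallel to the axes. -/
def cube {n : ℕ} (c : Rn n) (h : ℝ) : Set (Rn n) :=
  {x | ∀ i, |x i - c i| ≤ h}

/-- The Carleson norm `sup_Q μ(Q × (0, ℓ(Q)]) / |Q|` over all cubes `Q`, where `ℓ(Q)` is the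
diameter of `Q`. -/
def carlesonNorm {n : ℕ} (μ : Measure (Rn n × ℝ)) : ℝ≥0∞ :=
  ⨆ (c : Rn n) (h : ℝ) (_ : 0 < h),
    μ (cube c h ×ˢ Ioc 0 (Metric.diam (cube c h))) / volume (cube c h)

/-- A Carleson measure is a Borel measure with finite Carleson norm. -/
def IsCarlesonMeasure {n : ℕ} (μ : Measure (Rn n × ℝ)) : Prop :=
  carlesonNorm μ < ⊤

/-- The measure `∑_{k' ≥ 0} |F_{k'}(x)|² δ_{2^(-k')}(t) dx`. -/
def squareMeasure {n : ℕ} (F : ℕ → Rn n → ℂ) : Measure (Rn n × ℝ) :=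
  Measure.sum fun k' : ℕ =>
    (volume.withDensity fun x => ‖F k' x‖ₑ ^ 2).prod (Measure.dirac ((2 : ℝ) ^ (-(k' : ℤ))))

end

/-! Fix the block at frequency `2^K`, `K = k + k'`, and put `lam = 4 * 2^K`, `μ = -(n-1)/2`, `Φ =
2πφ`. In Mathlib's normalisation its symbol is `lam^μ exp(i(Φ(ξ) + w·ξ)) a(ξ/lam)` with `a`
supported in a fixed annulus. The modulation by `u` enters only through the linear phase `w`, that
is, through a translation of the kernel; estimates uniform in `w` are therefore uniform in `u`.

The heart is an `L¹` estimate, `exists_integral_fourier_oscSymbol_le`: if `G` is supported in a ball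
of radius `ε² ≥ 1/lam`, the transposed multiplier (without `lam^μ`) maps `G` to a function of `L¹`
norm `O(ε ‖G‖₂)`. Heuristically the image of `G` lives within `O(ε²)` of a translate of the image of
the unit sphere under `∇Φ`, a set of measure `O(ε²)`, and Cauchy-Schwarz gives the factor `ε`. For
the proof, frequency space is cut into sectors of aperture `ε` around directions `ν`. Once the
linear part `DΦ(ν)ξ` of the phase is removed, every derivative of the sector symbol gains `ε`, and
the derivative along `ν` gains `ε²` by Euler's identity (`exists_sectorSymbol_bounds`). The support
of `G` gives bounds at least as good for the derivatives of `𝓕⁻ G` in `L²`. Each piece is thus, up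
to translation, concentrated on a plank of thickness `ε²` and width `ε`, of volume `ε^(n+1)`, and a
weighted Cauchy-Schwarz inequality with Plancherel bounds its `L¹` norm by `κ ε^(n+1) + κ⁻¹ E(ν)`,
where `E(ν)` is the energy in the sector. Averaging over `ν` with the factor `ε^(-n)`, where only a
shell of volume `O(ε)` contributes, gives `κ ε² + κ⁻¹ ‖G‖₂²`; the choice `κ = ‖G‖₂/ε` finishes.

Duality turns this into a local `L²` bound on `bmo`. The image of `G` has frequencies of size `lam`,
so an annular cut-off can be inserted and moved onto `f`; the localised `f` is bounded by the `BMO`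
seminorm because the cut-off kernel has mean zero. With `l = ε²`, the square integral of the block
over a ball of radius `l/2` is `O(lam^(-(n-1)) l ‖f‖²)` for `1/lam ≤ l ≤ 1/4`
(`exists_block_bound`).

For a cube `Q` of diameter `D ≥ 1/lam`, since `n ≥ 2`, this becomes `O(lam⁻¹ (min D 1)⁻¹ |Q| ‖f‖²)`:
directly if `D` is small, by averaging over small balls if it is large (`setLIntegral_cube_le`). As
`lam⁻¹ = 2^(-k) 2^(-k') / 4`, the sum over `2^(-k') ≤ min D 1` is geometric and leaves `2^(-k)`,
which is better than the required `2^(-k/2)`. -/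

noncomputable section

/-! ### Integrable weights adapted to planks -/

section

open FourierTransform LineDeriv

/-- The one-dimensional weight `(1 + |t|)^(-3/2)`. -/
def lineDecay (t : ℝ) : ℝ := (1 + ‖t‖) ^ (-(3 / 2) : ℝ)

lemma integrable_lineDecay : Integrable lineDecay :=
  integrable_one_add_norm (by norm_num)

lemma lineDecay_pos (t : ℝ) : 0 < lineDecay t := by
  unfold lineDecay; positivity

lemma lineDecay_pow_four (t : ℝ) : lineDecay t ^ 4 * (1 + |t|) ^ 6 = 1 := by
  unfold lineDecay
  have h : (0 : ℝ) < 1 + |t| := by positivity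
  rw [Real.norm_eq_abs, ← Real.rpow_natCast, ← Real.rpow_mul h.le, ← Real.rpow_natCast (1 + |t|) 6,
    ← Real.rpow_add h]
  norm_num

lemma integral_lineDecay_nonneg : 0 ≤ ∫ t, lineDecay t :=
  integral_nonneg fun t => (lineDecay_pos t).le

lemma one_add_pow_le_two_pow_mul (t : ℝ) (ht : 0 ≤ t) (m : ℕ) :
    (1 + t) ^ m ≤ 2 ^ m * (1 + t ^ m) := by
  rcases le_total t 1 with h | h
  · calc (1 + t) ^ m ≤ 2 ^ m * 1 := by
          rw [mul_one]; gcongr; linarith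
      _ ≤ _ := by gcongr; simp; positivity
  · calc (1 + t) ^ m ≤ (2 * t) ^ m := by gcongr; linarith
      _ = 2 ^ m * t ^ m := mul_pow _ _ _
      _ ≤ _ := by gcongr; linarith

/-- The anisotropic weight adapted to a plank of thickness `l` in the direction `e` and of
width `ε` in the other directions. -/
def plankWeight {n : ℕ} (e : Rn n) (l ε : ℝ) (y : Rn n) : ℝ :=
  1 + (⟪y, e⟫_ℝ / l) ^ 2 + (‖y‖ / ε) ^ (6 * n)

lemma one_le_plankWeight {n : ℕ} (e : Rn n) {l ε : ℝ} (y : Rn n) : 1 ≤ plankWeight e l ε y := by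
  have h : 0 ≤ (‖y‖ / ε) ^ (6 * n) := Even.pow_nonneg (by simp [Nat.even_mul]; left; decide) _
  unfold plankWeight
  nlinarith [sq_nonneg (⟪y, e⟫_ℝ / l)]

/-- The weight grows quadratically along `b i₀` and with power `6n` in all directions, so the sixth
powers of the coordinate factors cost only `M ^ 4` in total: `M ^ 3` for the direction `b i₀` and a
single `M` for the other `n - 1` together. Fourth roots leave the exponent `3/2 > 1`, integrable on
the line. -/
lemma inv_plankWeight_le {n : ℕ} (b : OrthonormalBasis (Fin n) ℝ (Rn n)) (i₀ : Fin n)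
    {l ε : ℝ} (hε : 0 < ε) (y : Rn n) :
    (plankWeight (b i₀) l ε y)⁻¹ ≤
      2 ^ (2 * n + 1) * ∏ i, lineDecay (b.repr y i / if i = i₀ then l else ε) := by
  set M := plankWeight (b i₀) l ε y
  have hM1 : 1 ≤ M := one_le_plankWeight _ _
  have hM : 0 < M := by linarith
  set A := |b.repr y i₀ / l|
  set B := ‖y‖ / ε
  have hB : 0 ≤ B := by positivity
  set P := ∏ i, lineDecay (b.repr y i / if i = i₀ then l else ε)
  have hP : 0 < P := Finset.prod_pos fun i _ => lineDecay_pos _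
  have hMeq : M = 1 + A ^ 2 + B ^ (6 * n) := by
    simp only [M, A, B, plankWeight, sq_abs, OrthonormalBasis.repr_apply_apply]
    rw [real_inner_comm]
  have hcoord : ∀ i, |b.repr y i| ≤ ‖y‖ := fun i => by
    rw [← Real.norm_eq_abs, ← b.repr.norm_map y]
    exact PiLp.norm_apply_le _ i
  have hA6 : (1 + A) ^ 6 ≤ 8 * M ^ 3 := by
    have h1 : (1 + A) ^ 2 ≤ 2 * M := by
      have : 0 ≤ B ^ (6 * n) := by positivity
      nlinarith [sq_nonneg (1 - A)]
    calc (1 + A) ^ 6 = ((1 + A) ^ 2) ^ 3 := by ring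
      _ ≤ (2 * M) ^ 3 := by gcongr
      _ = _ := by ring
  have hB6 : (1 + B) ^ (6 * n) ≤ 2 ^ (6 * n) * M := by
    refine (one_add_pow_le_two_pow_mul B hB (6 * n)).trans ?_
    gcongr
    nlinarith [sq_nonneg A]
  have hprod : ∏ i, (1 + |b.repr y i / if i = i₀ then l else ε|) ^ 6 ≤ 2 ^ (6 * n + 3) * M ^ 4 := by
    rw [← Finset.mul_prod_erase _ _ (Finset.mem_univ i₀)]
    have h2 : ∏ i ∈ Finset.univ.erase i₀, (1 + |b.repr y i / if i = i₀ then l else ε|) ^ 6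
        ≤ (1 + B) ^ (6 * n) := by
      calc _ ≤ ∏ i ∈ Finset.univ.erase i₀, (1 + B) ^ 6 := by
            refine Finset.prod_le_prod (fun i _ => by positivity) fun i hi => ?_
            rw [if_neg (Finset.ne_of_mem_erase hi), abs_div, abs_of_pos hε]
            have := div_le_div_of_nonneg_right (hcoord i) hε.le
            gcongr
        _ = ((1 + B) ^ 6) ^ (n - 1) := by simp
        _ ≤ ((1 + B) ^ 6) ^ n := by
            apply pow_le_pow_right₀ (one_le_pow₀ (by linarith)) (by omega)
        _ = _ := by rw [← pow_mul]
    calc _ ≤ (8 * M ^ 3) * (2 ^ (6 * n) * M) := by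
          rw [if_pos rfl]
          exact mul_le_mul hA6 (h2.trans hB6) (Finset.prod_nonneg fun i _ => by positivity)
            (by positivity)
      _ = _ := by rw [pow_add]; ring
  have hP4 : P ^ 4 * ∏ i, (1 + |b.repr y i / if i = i₀ then l else ε|) ^ 6 = 1 := by
    simp only [P]
    rw [← Finset.prod_pow, ← Finset.prod_mul_distrib]
    exact Finset.prod_eq_one fun i _ => lineDecay_pow_four _
  have h4 : (1 : ℝ) ^ 4 ≤ (2 ^ (2 * n + 1) * P * M) ^ 4 := by
    calc (1 : ℝ) ^ 4 = P ^ 4 * ∏ i, (1 + |b.repr y i / if i = i₀ then l else ε|) ^ 6 := by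
          rw [hP4]; norm_num
      _ ≤ P ^ 4 * (2 ^ (6 * n + 3) * M ^ 4) := by gcongr
      _ ≤ P ^ 4 * (2 ^ ((2 * n + 1) * 4) * M ^ 4) := by
          gcongr
          · norm_num
          · omega
      _ = _ := by rw [mul_pow, mul_pow, pow_mul]; ring
  have h5 := le_of_pow_le_pow_left₀ (by norm_num) (by positivity) h4
  rw [inv_le_iff_one_le_mul₀ hM]
  exact h5

/-- Rotating `e` into a coordinate axis turns the majorant into a product of one-dimensional
integrals, one at scale `l` and `n - 1` at scale `ε`. -/
lemma exists_integral_inv_plankWeight_le (n : ℕ) : ∃ C : ℝ, 0 < C ∧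
    ∀ (e : Rn n) (l ε : ℝ), ‖e‖ = 1 → 0 < l → 0 < ε →
      Integrable (fun y => (plankWeight e l ε y)⁻¹) ∧
        ∫ y, (plankWeight e l ε y)⁻¹ ≤ C * (l * ε ^ (n - 1)) := by
  refine ⟨2 ^ (2 * n + 1) * (∫ t, lineDecay t) ^ n + 1, by
    have := integral_lineDecay_nonneg; positivity, fun e l ε he hl hε => ?_⟩
  have hn : 0 < n := by
    rcases Nat.eq_zero_or_pos n with rfl | h
    · rw [Subsingleton.elim e 0, norm_zero] at he; norm_num at he
    · exact h
  let i₀ : Fin n := ⟨0, hn⟩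
  obtain ⟨b, hb⟩ := Orthonormal.exists_orthonormalBasis_extension_of_card_eq (𝕜 := ℝ)
    (E := Rn n) (ι := Fin n) (by simp) (v := fun _ => e) (s := {i₀}) (by
      refine ⟨fun i => he, fun i j hij => (hij (Subsingleton.elim _ _)).elim⟩)
  have hb0 : b i₀ = e := hb i₀ rfl
  subst hb0
  set s : Fin n → ℝ := fun i => if i = i₀ then l else ε
  have hs : ∀ i, 0 < s i := fun i => by simp only [s]; split_ifs <;> assumption
  have hmp : MeasurePreserving (fun y => WithLp.ofLp (b.repr y)) :=
    (PiLp.volume_preserving_ofLp (Fin n)).comp b.measurePreserving_repr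
  have hq : ∀ i, Integrable fun t => lineDecay (t / s i) := fun i =>
    integrable_lineDecay.comp_div (hs i).ne'
  have hprodint : Integrable fun x : Fin n → ℝ => ∏ i, lineDecay (x i / s i) :=
    Integrable.fintype_prod (f := fun i t => lineDecay (t / s i)) hq
  have hI : Integrable fun y : Rn n => ∏ i, lineDecay (b.repr y i / s i) :=
    hmp.integrable_comp_of_integrable hprodint
  have hval : ∫ y : Rn n, ∏ i, lineDecay (b.repr y i / s i) =
      (∫ t, lineDecay t) ^ n * (l * ε ^ (n - 1)) := by
    have hme : MeasurableEmbedding (fun y => WithLp.ofLp (b.repr y)) :=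
      (b.repr.toHomeomorph.toMeasurableEquiv.trans
        (MeasurableEquiv.toLp 2 (Fin n → ℝ)).symm).measurableEmbedding
    have h1 := hmp.integral_comp hme (fun x : Fin n → ℝ => ∏ i, lineDecay (x i / s i))
    rw [h1, integral_fintype_prod_volume_eq_prod (f := fun i t => lineDecay (t / s i))]
    simp_rw [Measure.integral_comp_div, smul_eq_mul]
    rw [Finset.prod_mul_distrib, mul_comm]
    congr 1
    · simp
    · rw [← Finset.mul_prod_erase _ _ (Finset.mem_univ i₀)]
      simp only [s, if_true, abs_of_pos hl]
      congr 1
      rw [Finset.prod_congr rfl (g := fun _ => ε)]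
      · simp
      · intro i hi
        rw [if_neg (Finset.ne_of_mem_erase hi), abs_of_pos hε]
  have hbd : Integrable (fun y => (plankWeight (b i₀) l ε y)⁻¹) := by
    refine (hI.const_mul (2 ^ (2 * n + 1))).mono' ?_ (ae_of_all _ fun y => ?_)
    · apply Measurable.aestronglyMeasurable
      unfold plankWeight
      fun_prop
    · rw [Real.norm_of_nonneg (by have := one_le_plankWeight (b i₀) (l := l) (ε := ε) y; positivity)]
      exact inv_plankWeight_le b i₀ hε y
  refine ⟨hbd, ?_⟩
  calc ∫ y, (plankWeight (b i₀) l ε y)⁻¹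
      ≤ ∫ y, 2 ^ (2 * n + 1) * ∏ i, lineDecay (b.repr y i / s i) :=
        integral_mono hbd (hI.const_mul _) fun y => inv_plankWeight_le b i₀ hε y
    _ = 2 ^ (2 * n + 1) * (∫ t, lineDecay t) ^ n * (l * ε ^ (n - 1)) := by
        rw [integral_const_mul, hval]; ring
    _ ≤ _ := by gcongr; linarith

end

/-! ### Plancherel and the weighted `L¹` bound -/

section

open FourierTransform LineDeriv

lemma norm_fourier_iterate_lineDerivOp {n : ℕ} (H : 𝓢(Rn n, ℂ)) (m : Rn n) (N : ℕ) (y : Rn n) :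
    ‖𝓕 ((∂_{m})^[N] H) y‖ = (2 * Real.pi * |⟪y, m⟫_ℝ|) ^ N * ‖𝓕 H y‖ := by
  induction N with
  | zero => simp
  | succ N ih =>
    rw [Function.iterate_succ_apply', SchwartzMap.fourier_lineDerivOp_eq]
    have ht : (inner ℝ · m : Rn n → ℝ).HasTemperateGrowth := by fun_prop
    rw [smul_apply, SchwartzMap.smulLeftCLM_apply_apply ht, norm_smul, norm_smul, ih]
    simp [abs_of_pos Real.pi_pos]
    ring

lemma integral_norm_sq_iterate_lineDerivOp_fourierInv {n : ℕ} (m : Rn n) (N : ℕ) :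
    ∀ G : 𝓢(Rn n, ℂ), ∫ ξ, ‖(∂_{m})^[N] (𝓕⁻ G) ξ‖ ^ 2 =
      ∫ x, (2 * Real.pi * |⟪x, m⟫_ℝ|) ^ (2 * N) * ‖G x‖ ^ 2 := by
  induction N with
  | zero =>
    intro G
    have := SchwartzMap.integral_norm_sq_fourier (𝓕⁻ G)
    simp only [FourierInvPair.fourier_fourierInv_eq, FourierTransform.fourier_fourierInv_eq] at this
    simpa using this.symm
  | succ N ih =>
    intro G
    have ht : (inner ℝ · m : Rn n → ℝ).HasTemperateGrowth := by fun_prop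
    rw [Function.iterate_succ_apply, SchwartzMap.lineDerivOp_fourierInv_eq, ih]
    refine integral_congr_ae (ae_of_all _ fun x => ?_)
    simp only
    rw [smul_apply, SchwartzMap.smulLeftCLM_apply_apply ht, norm_smul, norm_smul]
    simp [abs_of_pos Real.pi_pos]
    ring

lemma SchwartzMap.integrable_norm_sq {n : ℕ} (f : 𝓢(Rn n, ℂ)) : Integrable fun x => ‖f x‖ ^ 2 :=
  (f.memLp 2).integrable_norm_pow (by norm_num)

lemma integral_norm_sq_iterate_lineDerivOp_fourierInv_le {n : ℕ} (G : 𝓢(Rn n, ℂ)) {l : ℝ}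
    (hG : ∀ x, l < ‖x‖ → G x = 0) (m : Rn n) (hm : ‖m‖ ≤ 1) (N : ℕ) :
    ∫ ξ, ‖(∂_{m})^[N] (𝓕⁻ G) ξ‖ ^ 2 ≤ (2 * Real.pi * l) ^ (2 * N) * ∫ x, ‖G x‖ ^ 2 := by
  rw [integral_norm_sq_iterate_lineDerivOp_fourierInv, ← integral_const_mul]
  have hb : ∀ x, (2 * Real.pi * |⟪x, m⟫_ℝ|) ^ (2 * N) * ‖G x‖ ^ 2 ≤
      (2 * Real.pi * l) ^ (2 * N) * ‖G x‖ ^ 2 := fun x => by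
    rcases le_or_gt ‖x‖ l with h | h
    · have : |⟪x, m⟫_ℝ| ≤ l := (abs_real_inner_le_norm x m).trans
        ((mul_le_of_le_one_right (norm_nonneg _) hm).trans h)
      gcongr
    · simp [hG x h]
  exact integral_mono_of_nonneg (ae_of_all _ fun x => by positivity)
    (G.integrable_norm_sq.const_mul _) (ae_of_all _ hb)

lemma norm_pow_le_sum_coord_pow {n : ℕ} (hn : 0 < n) (y : Rn n) (p : ℕ) :
    ‖y‖ ^ (2 * p) ≤ (n : ℝ) ^ p * ∑ i, |y i| ^ (2 * p) := by
  obtain ⟨i, -, hi⟩ := Finset.exists_max_image Finset.univ (fun i => |y i|) ⟨⟨0, hn⟩, Finset.mem_univ _⟩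
  have h1 : ‖y‖ ^ 2 ≤ n * |y i| ^ 2 := by
    rw [EuclideanSpace.norm_sq_eq]
    calc ∑ j, ‖y j‖ ^ 2 ≤ ∑ _j : Fin n, |y i| ^ 2 :=
          Finset.sum_le_sum fun j hj => by
            rw [Real.norm_eq_abs]; exact pow_le_pow_left₀ (abs_nonneg _) (hi j hj) 2
      _ = _ := by simp
  calc ‖y‖ ^ (2 * p) = (‖y‖ ^ 2) ^ p := pow_mul _ _ _
    _ ≤ (n * |y i| ^ 2) ^ p := by gcongr
    _ = n ^ p * |y i| ^ (2 * p) := by rw [mul_pow, pow_mul]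
    _ ≤ _ := by
      gcongr
      exact Finset.single_le_sum (f := fun i => |y i| ^ (2 * p)) (fun j _ => by positivity)
        (Finset.mem_univ i)

/-- The squared weighted norm of a sector symbol. -/
def sectorEnergy {n : ℕ} (e : Rn n) (l ε : ℝ) (H : 𝓢(Rn n, ℂ)) : ℝ :=
  (∫ ξ, ‖H ξ‖ ^ 2) + (l⁻¹) ^ 2 * (∫ ξ, ‖∂_{e} H ξ‖ ^ 2) +
    (ε⁻¹) ^ (6 * n) * ∑ i : Fin n, ∫ ξ, ‖(∂_{EuclideanSpace.single i (1 : ℝ)})^[3 * n] H ξ‖ ^ 2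

/-- Multiplying `𝓕 H` by a coordinate amounts to differentiating `H`, so the weight becomes one
derivative along `e` and `3n` along each axis. The factor `n^(3n)` comes from bounding `‖y‖` by its
largest coordinate. -/
lemma plankWeight_mul_norm_sq_le {n : ℕ} (hn : 0 < n) (e : Rn n) {l ε : ℝ} (hl : 0 < l)
    (hε : 0 < ε) (H : 𝓢(Rn n, ℂ)) (y : Rn n) :
    plankWeight e l ε y * ‖𝓕 H y‖ ^ 2 ≤ (n : ℝ) ^ (3 * n) *
      (‖𝓕 H y‖ ^ 2 + (l⁻¹) ^ 2 * ‖𝓕 (∂_{e} H) y‖ ^ 2 + (ε⁻¹) ^ (6 * n) *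
        ∑ i : Fin n, ‖𝓕 ((∂_{EuclideanSpace.single i (1 : ℝ)})^[3 * n] H) y‖ ^ 2) := by
  have h2π : 1 ≤ 2 * Real.pi := by linarith [Real.pi_gt_three]
  have h1 := norm_fourier_iterate_lineDerivOp H e 1 y
  have h2 : ∀ i : Fin n, ‖𝓕 ((∂_{EuclideanSpace.single i (1 : ℝ)})^[3 * n] H) y‖ =
      (2 * Real.pi * |y i|) ^ (3 * n) * ‖𝓕 H y‖ := fun i => by
    rw [norm_fourier_iterate_lineDerivOp]; simp [EuclideanSpace.inner_single_right]
  simp only [Function.iterate_one, pow_one] at h1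
  have hn1 : (1 : ℝ) ≤ (n : ℝ) ^ (3 * n) := one_le_pow₀ (by exact_mod_cast hn)
  have h3 : (⟪y, e⟫_ℝ / l) ^ 2 * ‖𝓕 H y‖ ^ 2 ≤ (l⁻¹) ^ 2 * ‖𝓕 (∂_{e} H) y‖ ^ 2 := by
    rw [h1, div_eq_mul_inv, mul_pow, ← sq_abs ⟪y, e⟫_ℝ, mul_pow]
    have : |⟪y, e⟫_ℝ| ≤ 2 * Real.pi * |⟪y, e⟫_ℝ| := le_mul_of_one_le_left (abs_nonneg _) h2π
    calc _ = (l⁻¹) ^ 2 * (|⟪y, e⟫_ℝ| ^ 2 * ‖𝓕 H y‖ ^ 2) := by ring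
      _ ≤ _ := by gcongr
  have h4 : (‖y‖ / ε) ^ (6 * n) * ‖𝓕 H y‖ ^ 2 ≤ (n : ℝ) ^ (3 * n) * ((ε⁻¹) ^ (6 * n) *
        ∑ i : Fin n, ‖𝓕 ((∂_{EuclideanSpace.single i (1 : ℝ)})^[3 * n] H) y‖ ^ 2) := by
    simp_rw [h2]
    have h5 := norm_pow_le_sum_coord_pow hn y (3 * n)
    rw [show 2 * (3 * n) = 6 * n by ring] at h5
    have h6 : ∑ i, |y i| ^ (6 * n) * ‖𝓕 H y‖ ^ 2 ≤
        ∑ i, ((2 * Real.pi * |y i|) ^ (3 * n) * ‖𝓕 H y‖) ^ 2 := by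
      refine Finset.sum_le_sum fun i _ => ?_
      rw [mul_pow, ← pow_mul, show 3 * n * 2 = 6 * n by ring]
      have : |y i| ≤ 2 * Real.pi * |y i| := le_mul_of_one_le_left (abs_nonneg _) h2π
      gcongr
    rw [div_eq_mul_inv, mul_pow]
    calc ‖y‖ ^ (6 * n) * ε⁻¹ ^ (6 * n) * ‖𝓕 H y‖ ^ 2
        ≤ ((n : ℝ) ^ (3 * n) * ∑ i, |y i| ^ (6 * n)) * ε⁻¹ ^ (6 * n) * ‖𝓕 H y‖ ^ 2 := by gcongr
      _ = (n : ℝ) ^ (3 * n) * (ε⁻¹ ^ (6 * n) * ∑ i, |y i| ^ (6 * n) * ‖𝓕 H y‖ ^ 2) := by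
        rw [← Finset.sum_mul]; ring
      _ ≤ _ := by gcongr
  have h7 : 0 ≤ ‖𝓕 H y‖ ^ 2 := by positivity
  have h8 : 0 ≤ (l⁻¹) ^ 2 * ‖𝓕 (∂_{e} H) y‖ ^ 2 := by positivity
  unfold plankWeight
  nlinarith

/-- A linearised weighted Cauchy-Schwarz inequality. Leaving `κ` free makes the bound linear in the
energy, so that it can be integrated over all sectors before `κ` is chosen. -/
lemma exists_integral_norm_fourier_le (n : ℕ) (hn : 0 < n) : ∃ C : ℝ, 0 < C ∧
    ∀ (e : Rn n) (l ε κ : ℝ) (H : 𝓢(Rn n, ℂ)), ‖e‖ = 1 → 0 < l → 0 < ε → 0 < κ →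
      ∫ y, ‖𝓕 H y‖ ≤ C * (κ * (l * ε ^ (n - 1)) + κ⁻¹ * sectorEnergy e l ε H) := by
  obtain ⟨C, hC, h⟩ := exists_integral_inv_plankWeight_le n
  refine ⟨C + (n : ℝ) ^ (3 * n), by positivity, fun e l ε κ H he hl hε hκ => ?_⟩
  obtain ⟨hi, hle⟩ := h e l ε he hl hε
  set R : Rn n → ℝ := fun y => (n : ℝ) ^ (3 * n) *
      (‖𝓕 H y‖ ^ 2 + (l⁻¹) ^ 2 * ‖𝓕 (∂_{e} H) y‖ ^ 2 + (ε⁻¹) ^ (6 * n) *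
        ∑ i : Fin n, ‖𝓕 ((∂_{EuclideanSpace.single i (1 : ℝ)})^[3 * n] H) y‖ ^ 2)
  have i1 : Integrable fun y => ‖𝓕 H y‖ ^ 2 := SchwartzMap.integrable_norm_sq _
  have i2 : Integrable fun y => (l⁻¹) ^ 2 * ‖𝓕 (∂_{e} H) y‖ ^ 2 :=
    (SchwartzMap.integrable_norm_sq _).const_mul _
  have i3 : ∀ i : Fin n, Integrable fun y => ‖𝓕 ((∂_{EuclideanSpace.single i (1 : ℝ)})^[3 * n] H) y‖ ^ 2 :=
    fun i => SchwartzMap.integrable_norm_sq _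
  have i4 : Integrable fun y => (ε⁻¹) ^ (6 * n) *
      ∑ i : Fin n, ‖𝓕 ((∂_{EuclideanSpace.single i (1 : ℝ)})^[3 * n] H) y‖ ^ 2 :=
    (integrable_finsetSum _ fun i _ => i3 i).const_mul _
  have i12 : Integrable fun y => ‖𝓕 H y‖ ^ 2 + (l⁻¹) ^ 2 * ‖𝓕 (∂_{e} H) y‖ ^ 2 := i1.add i2
  have hR : Integrable R := (i12.add i4).const_mul _
  have hRint : ∫ y, R y = (n : ℝ) ^ (3 * n) * sectorEnergy e l ε H := by
    simp only [R]
    rw [integral_const_mul, integral_add i12 i4, integral_add i1 i2, integral_const_mul,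
      integral_const_mul, integral_finsetSum _ fun i _ => i3 i]
    simp only [SchwartzMap.integral_norm_sq_fourier, sectorEnergy]
  have hpt : ∀ y, ‖𝓕 H y‖ ≤ κ * (plankWeight e l ε y)⁻¹ + κ⁻¹ * R y := fun y => by
    have hW := one_le_plankWeight e (l := l) (ε := ε) y
    have hW0 : 0 < plankWeight e l ε y := by linarith
    have h1 := plankWeight_mul_norm_sq_le hn e hl hε H y
    set W := plankWeight e l ε y
    set x := ‖𝓕 H y‖
    have hx : 0 ≤ x := norm_nonneg _
    have h2 : x ≤ κ * W⁻¹ + κ⁻¹ * (W * x ^ 2) := by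
      -- With `t = κ⁻¹ W x` the difference is `κ W⁻¹ (1 - t + t²)`, written as a sum of nonnegative
      -- terms.
      have : κ * W⁻¹ + κ⁻¹ * (W * x ^ 2) - x = κ * W⁻¹ * ((1 - κ⁻¹ * W * x) ^ 2 + κ⁻¹ * W * x) := by
        field_simp; ring
      have h3 : 0 ≤ κ * W⁻¹ * ((1 - κ⁻¹ * W * x) ^ 2 + κ⁻¹ * W * x) := by positivity
      linarith
    refine h2.trans ?_
    gcongr
  have hE : 0 ≤ sectorEnergy e l ε H := by
    unfold sectorEnergy
    have : ∀ i : Fin n, 0 ≤ ∫ ξ, ‖(∂_{EuclideanSpace.single i (1 : ℝ)})^[3 * n] H ξ‖ ^ 2 :=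
      fun i => integral_nonneg fun _ => by positivity
    have := Finset.sum_nonneg fun i (_ : i ∈ Finset.univ) => this i
    have : 0 ≤ ∫ ξ, ‖H ξ‖ ^ 2 := integral_nonneg fun _ => by positivity
    have : 0 ≤ ∫ ξ, ‖∂_{e} H ξ‖ ^ 2 := integral_nonneg fun _ => by positivity
    positivity
  calc ∫ y, ‖𝓕 H y‖ ≤ ∫ y, (κ * (plankWeight e l ε y)⁻¹ + κ⁻¹ * R y) :=
        integral_mono (𝓕 H).integrable.norm ((hi.const_mul _).add (hR.const_mul _)) hpt
    _ = κ * (∫ y, (plankWeight e l ε y)⁻¹) + κ⁻¹ * ((n : ℝ) ^ (3 * n) * sectorEnergy e l ε H) := by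
        rw [integral_add (hi.const_mul _) (hR.const_mul _), integral_const_mul, integral_const_mul,
          hRint]
    _ ≤ κ * (C * (l * ε ^ (n - 1))) + κ⁻¹ * ((n : ℝ) ^ (3 * n) * sectorEnergy e l ε H) := by gcongr
    _ ≤ _ := by
        have h1 : 0 ≤ κ * (l * ε ^ (n - 1)) := by positivity
        have h2 : 0 ≤ κ⁻¹ * sectorEnergy e l ε H := by positivity
        have h3 : (0 : ℝ) ≤ (n : ℝ) ^ (3 * n) := by positivity
        nlinarith [mul_nonneg h3 h1, mul_nonneg hC.le h2]

end

/-! ### Homogeneous functions and temperate growth -/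

section

/-- A function which is smooth away from the origin and positively homogeneous of degree `μ`. -/
structure IsSmoothHomogeneous {n : ℕ} {F : Type*} [NormedAddCommGroup F] [NormedSpace ℝ F]
    (μ : ℝ) (g : Rn n → F) : Prop where
  smooth : ContDiffOn ℝ ∞ g {0}ᶜ
  homogeneous : ∀ (ξ : Rn n) (t : ℝ), 0 < t → g (t • ξ) = t ^ μ • g ξ

namespace IsSmoothHomogeneous

variable {n : ℕ} {F : Type*} [NormedAddCommGroup F] [NormedSpace ℝ F] {μ : ℝ} {g : Rn n → F}

lemma contDiffAt (hg : IsSmoothHomogeneous μ g) {ξ : Rn n} (hξ : ξ ≠ 0) : ContDiffAt ℝ ∞ g ξ :=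
  hg.smooth.contDiffAt (isOpen_compl_singleton.mem_nhds hξ)

lemma norm_iteratedFDeriv_smul (hg : IsSmoothHomogeneous μ g) (i : ℕ) {ξ : Rn n} (hξ : ξ ≠ 0)
    {t : ℝ} (ht : 0 < t) :
    ‖iteratedFDeriv ℝ i g (t • ξ)‖ = t ^ (μ - i) * ‖iteratedFDeriv ℝ i g ξ‖ := by
  let e : Rn n ≃L[ℝ] Rn n := ContinuousLinearEquiv.smulLeft (Units.mk0 t ht.ne')
  have he : ∀ x, e x = t • x := fun x => rfl
  have h1 : g ∘ e = fun x => t ^ μ • g x := by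
    ext x; simp [he, hg.homogeneous x t ht]
  have h2 : iteratedFDeriv ℝ i (g ∘ e) ξ =
      (iteratedFDeriv ℝ i g (t • ξ)).compContinuousLinearMap fun _ => e := by
    have := e.iteratedFDerivWithin_comp_right g (s := univ) uniqueDiffOn_univ (x := ξ)
      (mem_univ _) i
    simpa [iteratedFDerivWithin_univ, he] using this
  have h3 : iteratedFDeriv ℝ i (g ∘ e) ξ = t ^ μ • iteratedFDeriv ℝ i g ξ := by
    rw [h1]
    exact iteratedFDeriv_const_smul_apply' ((hg.contDiffAt hξ).of_le (mod_cast le_top))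
  have h4 : (iteratedFDeriv ℝ i g (t • ξ)).compContinuousLinearMap (fun _ => (e : Rn n →L[ℝ] Rn n)) =
      t ^ i • iteratedFDeriv ℝ i g (t • ξ) := by
    ext m
    have := (iteratedFDeriv ℝ i g (t • ξ)).map_smul_univ (fun _ => t) m
    simpa [he] using this
  have h5 := congrArg norm (h3.symm.trans (h2.trans h4))
  rw [norm_smul, norm_smul, Real.norm_of_nonneg (by positivity),
    Real.norm_of_nonneg (by positivity)] at h5
  rw [Real.rpow_sub ht, Real.rpow_natCast, div_mul_eq_mul_div, h5]
  field_simp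

/-- Scaling reduces the bound to the unit sphere, where continuity and compactness supply the
constant. -/
lemma exists_norm_iteratedFDeriv_le (hg : IsSmoothHomogeneous μ g) (i : ℕ) :
    ∃ C : ℝ, 0 < C ∧ ∀ ξ : Rn n, ξ ≠ 0 → ‖iteratedFDeriv ℝ i g ξ‖ ≤ C * ‖ξ‖ ^ (μ - i) := by
  have hcont : ContinuousOn (fun ξ => ‖iteratedFDeriv ℝ i g ξ‖) (Metric.sphere (0 : Rn n) 1) := by
    intro ξ hξ
    have h0 : ξ ≠ 0 := by rintro rfl; simp at hξ
    exact (((hg.contDiffAt h0).continuousAt_iteratedFDeriv (mod_cast le_top)).norm).continuousWithinAt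
  obtain ⟨C, hC⟩ := (isCompact_sphere (0 : Rn n) 1).bddAbove_image hcont
  refine ⟨max C 1, by positivity, fun ξ hξ => ?_⟩
  have hpos : 0 < ‖ξ‖ := norm_pos_iff.2 hξ
  have hu : ‖‖ξ‖⁻¹ • ξ‖ = 1 := by
    rw [norm_smul, norm_inv, norm_norm, inv_mul_cancel₀ hpos.ne']
  have hu0 : ‖ξ‖⁻¹ • ξ ≠ 0 := by rw [← norm_pos_iff, hu]; norm_num
  have h1 := hg.norm_iteratedFDeriv_smul i hu0 hpos
  rw [smul_inv_smul₀ hpos.ne'] at h1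
  rw [h1, mul_comm]
  gcongr
  exact (hC ⟨_, by simpa using hu, rfl⟩).trans (le_max_left _ _)

lemma exists_norm_iteratedFDeriv_le_uniform (hg : IsSmoothHomogeneous μ g) (N : ℕ) :
    ∃ C : ℝ, 1 ≤ C ∧ ∀ i ≤ N, ∀ ξ : Rn n, ξ ≠ 0 →
      ‖iteratedFDeriv ℝ i g ξ‖ ≤ C * ‖ξ‖ ^ (μ - i) := by
  choose C hC h using hg.exists_norm_iteratedFDeriv_le
  refine ⟨1 + ∑ i ∈ Finset.range (N + 1), C i, ?_, fun i hi ξ hξ => (h i ξ hξ).trans ?_⟩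
  · have := Finset.sum_nonneg fun i (_ : i ∈ Finset.range (N + 1)) => (hC i).le
    linarith
  · gcongr
    have := Finset.single_le_sum (f := C) (fun j _ => (hC j).le)
      (Finset.mem_range.2 (Nat.lt_succ_of_le hi))
    linarith

/-- A homogeneous function multiplied by a cut-off vanishing near the origin has temperate growth. -/
lemma hasTemperateGrowth_smul (hg : IsSmoothHomogeneous μ g) {χ : Rn n → ℝ} (hχ : ContDiff ℝ ∞ χ)
    {r R : ℝ} (hr : 0 < r) (h0 : ∀ ξ, ‖ξ‖ ≤ r → χ ξ = 0) (h1 : ∀ ξ, R ≤ ‖ξ‖ → χ ξ = 1) :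
    (fun ξ => χ ξ • g ξ).HasTemperateGrowth := by
  have hsm : ContDiff ℝ ∞ fun ξ => χ ξ • g ξ := by
    rw [contDiff_iff_contDiffAt]
    intro ξ
    by_cases hξ : ξ = 0
    · have : (fun ξ => χ ξ • g ξ) =ᶠ[nhds ξ] fun _ => 0 := by
        filter_upwards [Metric.ball_mem_nhds ξ hr] with x hx
        rw [hξ, mem_ball_zero_iff] at hx
        rw [h0 x hx.le, zero_smul]
      exact contDiffAt_const.congr_of_eventuallyEq this
    · exact hχ.contDiffAt.smul (hg.contDiffAt hξ)
  refine ⟨hsm, fun i => ?_⟩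
  set R' := max R 1
  have hcont : Continuous fun ξ => ‖iteratedFDeriv ℝ i (fun ξ => χ ξ • g ξ) ξ‖ :=
    (hsm.continuous_iteratedFDeriv (mod_cast le_top)).norm
  obtain ⟨C₁, hC₁⟩ := (isCompact_closedBall (0 : Rn n) R').bddAbove_image hcont.continuousOn
  obtain ⟨C₂, hC₂, h⟩ := hg.exists_norm_iteratedFDeriv_le i
  refine ⟨⌈|μ|⌉₊, max C₁ C₂, fun ξ => ?_⟩
  have hone : 1 ≤ (1 + ‖ξ‖) ^ ⌈|μ|⌉₊ := one_le_pow₀ (by linarith [norm_nonneg ξ])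
  have hmax : 0 ≤ max C₁ C₂ := hC₂.le.trans (le_max_right _ _)
  rcases le_or_gt ‖ξ‖ R' with hξ | hξ
  · have := hC₁ ⟨ξ, by simpa using hξ, rfl⟩
    calc _ ≤ max C₁ C₂ * 1 := by rw [mul_one]; exact this.trans (le_max_left _ _)
      _ ≤ _ := by gcongr
  · have hξ1 : 1 ≤ ‖ξ‖ := (le_max_right R 1).trans hξ.le
    have hξ0 : ξ ≠ 0 := by rw [← norm_pos_iff]; linarith
    have heq : (fun ξ => χ ξ • g ξ) =ᶠ[nhds ξ] g := by
      filter_upwards [continuous_norm.continuousAt.eventually (lt_mem_nhds hξ)] with x hx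
      rw [h1 x ((le_max_left R 1).trans (le_of_lt hx)), one_smul]
    rw [(heq.iteratedFDeriv ℝ i).eq_of_nhds]
    refine (h ξ hξ0).trans ?_
    have h3 : ‖ξ‖ ^ (μ - i) ≤ (1 + ‖ξ‖) ^ ⌈|μ|⌉₊ := by
      calc ‖ξ‖ ^ (μ - i) ≤ ‖ξ‖ ^ (⌈|μ|⌉₊ : ℝ) := by
            apply Real.rpow_le_rpow_of_exponent_le hξ1
            have := le_abs_self μ
            have := Nat.le_ceil |μ|
            have : (0 : ℝ) ≤ i := by positivity
            linarith
        _ = ‖ξ‖ ^ ⌈|μ|⌉₊ := Real.rpow_natCast _ _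
        _ ≤ _ := by gcongr; linarith
    exact mul_le_mul (le_max_right _ _) h3 (by positivity) hmax

end IsSmoothHomogeneous

lemma IsPhase.isSmoothHomogeneous {n : ℕ} {φ : Rn n → ℝ} (hφ : IsPhase φ) :
    IsSmoothHomogeneous 1 φ :=
  ⟨hφ.smooth, fun ξ t ht => by simpa using hφ.homogeneous ξ t ht⟩

lemma isSmoothHomogeneous_norm_rpow (n : ℕ) (μ : ℝ) :
    IsSmoothHomogeneous μ fun ξ : Rn n => ‖ξ‖ ^ μ := by
  refine ⟨fun ξ hξ => ?_, fun ξ t ht => ?_⟩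
  · have h0 : ξ ≠ 0 := hξ
    exact ((contDiffAt_norm ℝ h0).rpow_const_of_ne (norm_ne_zero_iff.2 h0)).contDiffWithinAt
  · rw [norm_smul, Real.norm_of_nonneg ht.le, Real.mul_rpow ht.le (norm_nonneg _), smul_eq_mul]

lemma isSmoothHomogeneous_direction (n : ℕ) :
    IsSmoothHomogeneous 0 fun ξ : Rn n => ‖ξ‖⁻¹ • ξ := by
  refine ⟨fun ξ hξ => ?_, fun ξ t ht => ?_⟩
  · have h0 : ξ ≠ 0 := hξ
    exact (((contDiffAt_norm ℝ h0).inv (norm_ne_zero_iff.2 h0)).smul contDiffAt_id).contDiffWithinAt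
  · rw [norm_smul, Real.norm_of_nonneg ht.le, smul_smul, Real.rpow_zero, one_smul, mul_inv]
    congr 1
    field_simp

lemma iteratedDeriv_cexp_I_mul (i : ℕ) :
    iteratedDeriv i (fun t : ℝ => Complex.exp (Complex.I * t)) =
      fun t : ℝ => Complex.I ^ i * Complex.exp (Complex.I * t) := by
  induction i with
  | zero => simp
  | succ i ih =>
    rw [iteratedDeriv_succ, ih]
    ext t
    have h : HasDerivAt (fun t : ℝ => Complex.exp (Complex.I * t))
        (Complex.exp (Complex.I * t) * Complex.I) t := by
      simpa using ((Complex.ofRealCLM.hasDerivAt (x := t)).const_mul Complex.I).cexp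
    rw [(h.const_mul _).deriv]
    ring

lemma contDiff_cexp_I_mul : ContDiff ℝ ∞ fun t : ℝ => Complex.exp (Complex.I * t) :=
  (contDiff_const.mul Complex.ofRealCLM.contDiff).cexp

lemma norm_cexp_I_mul (t : ℝ) : ‖Complex.exp (Complex.I * t)‖ = 1 := by
  rw [mul_comm, Complex.norm_exp_ofReal_mul_I]

lemma norm_iteratedFDeriv_cexp_I_mul (i : ℕ) (t : ℝ) :
    ‖iteratedFDeriv ℝ i (fun t : ℝ => Complex.exp (Complex.I * t)) t‖ = 1 := by
  rw [norm_iteratedFDeriv_eq_norm_iteratedDeriv, iteratedDeriv_cexp_I_mul, norm_mul, norm_pow,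
    Complex.norm_I, one_pow, one_mul, norm_cexp_I_mul]

lemma hasTemperateGrowth_cexp_I_mul :
    (fun t : ℝ => Complex.exp (Complex.I * t)).HasTemperateGrowth :=
  ⟨contDiff_cexp_I_mul, fun i => ⟨0, 1, fun t => by simp [norm_iteratedFDeriv_cexp_I_mul]⟩⟩

/-- A smooth cut-off vanishing near the origin and equal to `1` outside the ball of radius `r`. -/
lemma exists_highPass (n : ℕ) {r : ℝ} (hr : 0 < r) : ∃ χ : Rn n → ℝ, ContDiff ℝ ∞ χ ∧
    (∀ ξ, ‖ξ‖ ≤ r / 2 → χ ξ = 0) ∧ (∀ ξ, r ≤ ‖ξ‖ → χ ξ = 1) := by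
  let b : ContDiffBump (0 : Rn n) := ⟨r / 2, r, by positivity, by linarith⟩
  refine ⟨fun ξ => 1 - b ξ, contDiff_const.sub b.contDiff, fun ξ h => ?_, fun ξ h => ?_⟩
  · simp [b.one_of_mem_closedBall (by simpa using h)]
  · simp [b.zero_of_le_dist (by simpa using h)]

/-- The phase may be singular at the origin, but `χ₀` vanishes on `‖ξ‖ ≤ 2^(k₀-5)`; `φ` can
therefore be replaced by `χ φ`, which is smooth everywhere and agrees with `φ` outside that ball. -/
lemma hasTemperateGrowth_fio_symbol {n : ℕ} {φ : Rn n → ℝ} (hφ : IsPhase φ) {k₀ : ℤ}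
    {χ₀ : Rn n → ℝ} (hχ₀ : IsHighFrequencyCutoff k₀ χ₀) (μ : ℝ) :
    (fun ξ => Complex.exp (Complex.I * (φ ξ : ℂ)) * amplitude χ₀ μ ξ).HasTemperateGrowth := by
  have hr : (0 : ℝ) < 2 ^ (k₀ - 5) := by positivity
  obtain ⟨χ, hχ, h0, h1⟩ := exists_highPass n hr
  have hA : (fun ξ => χ₀ ξ • ‖ξ‖ ^ μ).HasTemperateGrowth :=
    (isSmoothHomogeneous_norm_rpow n μ).hasTemperateGrowth_smul hχ₀.smooth hr hχ₀.eq_zero hχ₀.eq_one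
  have hB : (fun ξ => χ ξ • φ ξ).HasTemperateGrowth :=
    hφ.isSmoothHomogeneous.hasTemperateGrowth_smul hχ (half_pos hr) h0 h1
  have hC := (hasTemperateGrowth_cexp_I_mul.comp hB).mul (Complex.ofRealCLM.hasTemperateGrowth.comp hA)
  refine (congrArg Function.HasTemperateGrowth (funext fun ξ => ?_)).mpr hC
  simp only [amplitude, Pi.mul_apply, Function.comp_apply, smul_eq_mul, Complex.ofRealCLM_apply]
  rcases le_or_gt ‖ξ‖ (2 ^ (k₀ - 5)) with h | h
  · simp [hχ₀.eq_zero ξ h]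
  · rw [h1 ξ h.le, one_mul, mul_comm (χ₀ ξ)]

end

/-! ### Derivative bounds for products and compositions; Taylor estimates for the phase -/

section

section DerivativeBounds

variable {E F : Type*} [NormedAddCommGroup E] [NormedSpace ℝ E] [NormedAddCommGroup F]
  [NormedSpace ℝ F]

/-- Geometric bounds `A * D ^ i` are stable under the Leibniz rule, since the binomial coefficients
add up to `2 ^ i`. The factors of the sector symbol are combined in this form, with `D` a multiple
of `ε`. -/
lemma norm_iteratedFDeriv_mul_le_of_le {f g : E → ℂ} {s : Set E} (hs : IsOpen s)
    (hf : ContDiffOn ℝ ∞ f s) (hg : ContDiffOn ℝ ∞ g s) {x : E} (hx : x ∈ s) {N : ℕ} {A B D : ℝ}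
    (hA : 0 ≤ A) (hD : 0 ≤ D) (hfb : ∀ i ≤ N, ‖iteratedFDeriv ℝ i f x‖ ≤ A * D ^ i)
    (hgb : ∀ i ≤ N, ‖iteratedFDeriv ℝ i g x‖ ≤ B * D ^ i) :
    ∀ i ≤ N, ‖iteratedFDeriv ℝ i (fun y => f y * g y) x‖ ≤ 2 ^ N * (A * B) * D ^ i := by
  intro i hi
  have hB : 0 ≤ B := by simpa using (norm_nonneg _).trans (hgb 0 (Nat.zero_le _))
  have hw : ∀ (h : E → ℂ) k, iteratedFDerivWithin ℝ k h s x = iteratedFDeriv ℝ k h x :=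
    fun h k => iteratedFDerivWithin_of_isOpen k hs hx
  have h1 := norm_iteratedFDerivWithin_mul_le hf hg hs.uniqueDiffOn hx (n := i) (mod_cast le_top)
  simp only [hw] at h1
  calc _ ≤ _ := h1
    _ ≤ ∑ k ∈ Finset.range (i + 1), (i.choose k : ℝ) * (A * D ^ k) * (B * D ^ (i - k)) := by
        refine Finset.sum_le_sum fun k hk => ?_
        have hk' : k ≤ i := Nat.lt_succ_iff.1 (Finset.mem_range.1 hk)
        have := hfb k (hk'.trans hi)
        have := hgb (i - k) ((Nat.sub_le _ _).trans hi)
        gcongr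
    _ = ∑ k ∈ Finset.range (i + 1), (i.choose k : ℝ) * (A * B * D ^ i) := by
        refine Finset.sum_congr rfl fun k hk => ?_
        have hk' : k ≤ i := Nat.lt_succ_iff.1 (Finset.mem_range.1 hk)
        rw [← Nat.add_sub_cancel' hk', pow_add, Nat.add_sub_cancel' hk']
        ring
    _ = 2 ^ i * (A * B * D ^ i) := by
        rw [← Finset.sum_mul]
        congr 1
        exact_mod_cast Nat.sum_range_choose i
    _ ≤ 2 ^ N * (A * B * D ^ i) := by gcongr; norm_num
    _ = _ := by ring

lemma norm_iteratedFDeriv_comp_le_of_le {g : F → ℂ} {f : E → F} {s : Set E} (hs : IsOpen s)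
    (hg : ContDiff ℝ ∞ g) (hf : ContDiffOn ℝ ∞ f s) {x : E} (hx : x ∈ s) {N : ℕ} {A D : ℝ}
    (hD : 0 ≤ D) (hgb : ∀ i ≤ N, ‖iteratedFDeriv ℝ i g (f x)‖ ≤ A)
    (hfb : ∀ i, 1 ≤ i → i ≤ N → ‖iteratedFDeriv ℝ i f x‖ ≤ D ^ i) :
    ∀ i ≤ N, ‖iteratedFDeriv ℝ i (fun y => g (f y)) x‖ ≤ (N.factorial * A) * D ^ i := by
  intro i hi
  have hA : 0 ≤ A := (norm_nonneg _).trans (hgb 0 (Nat.zero_le _))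
  have h1 := norm_iteratedFDerivWithin_comp_le (n := i) (g := g) (f := f) (s := s) (t := univ)
    (x := x) (C := A) (D := D) hg.contDiffOn hf (mod_cast le_top) uniqueDiffOn_univ hs.uniqueDiffOn
    (mapsTo_univ _ _) hx (fun k hk => by
      rw [iteratedFDerivWithin_univ]; exact hgb k (hk.trans hi)) (fun k hk hk' => by
      rw [iteratedFDerivWithin_of_isOpen k hs hx]; exact hfb k hk (hk'.trans hi))
  rw [iteratedFDerivWithin_of_isOpen i hs hx] at h1
  refine h1.trans ?_
  gcongr

lemma exists_norm_iteratedFDeriv_le_of_hasCompactSupport {f : E → F} (hf : ContDiff ℝ ∞ f)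
    (hc : HasCompactSupport f) (N : ℕ) :
    ∃ A : ℝ, 1 ≤ A ∧ ∀ i ≤ N, ∀ x, ‖iteratedFDeriv ℝ i f x‖ ≤ A := by
  have h : ∀ i : ℕ, ∃ A : ℝ, 0 ≤ A ∧ ∀ x, ‖iteratedFDeriv ℝ i f x‖ ≤ A := fun i => by
    obtain ⟨A, hA⟩ := (hc.iteratedFDeriv (𝕜 := ℝ) i).exists_bound_of_continuous
      (hf.continuous_iteratedFDeriv (mod_cast le_top))
    exact ⟨A, (norm_nonneg _).trans (hA 0), hA⟩
  choose A hA h using h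
  refine ⟨1 + ∑ i ∈ Finset.range (N + 1), A i, ?_, fun i hi x => (h i x).trans ?_⟩
  · have := Finset.sum_nonneg fun i (_ : i ∈ Finset.range (N + 1)) => hA i
    linarith
  · have := Finset.single_le_sum (f := A) (fun j _ => hA j)
      (Finset.mem_range.2 (Nat.lt_succ_of_le hi))
    linarith

lemma iteratedFDeriv_clm_of_two_le (L : E →L[ℝ] F) {i : ℕ} (hi : 2 ≤ i) (x : E) :
    iteratedFDeriv ℝ i L x = 0 := by
  obtain ⟨k, rfl⟩ := Nat.exists_eq_add_of_le hi
  rw [← norm_eq_zero, show 2 + k = (k + 1) + 1 by ring, ← norm_iteratedFDeriv_fderiv]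
  have : fderiv ℝ (L : E → F) = fun _ => L := funext fun y => L.fderiv
  rw [this, iteratedFDeriv_succ_const]
  simp

end DerivativeBounds

namespace IsSmoothHomogeneous

variable {n : ℕ} {F : Type*} [NormedAddCommGroup F] [NormedSpace ℝ F] {μ : ℝ} {g : Rn n → F}

lemma differentiableAt (hg : IsSmoothHomogeneous μ g) {ξ : Rn n} (hξ : ξ ≠ 0) :
    DifferentiableAt ℝ g ξ := (hg.contDiffAt hξ).differentiableAt (by norm_num)

/-- Euler's identity. -/
lemma fderiv_apply_self (hg : IsSmoothHomogeneous μ g) {ξ : Rn n} (hξ : ξ ≠ 0) :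
    fderiv ℝ g ξ ξ = μ • g ξ := by
  have h1 : HasDerivAt (fun t : ℝ => g (t • ξ)) (fderiv ℝ g ξ ξ) 1 := by
    have h2 : HasDerivAt (fun t : ℝ => t • ξ) ξ 1 := by
      simpa using (hasDerivAt_id (1 : ℝ)).smul_const ξ
    have h3 : HasFDerivAt g (fderiv ℝ g ξ) ((1 : ℝ) • ξ) := by
      rw [one_smul]; exact (hg.differentiableAt hξ).hasFDerivAt
    exact h3.comp_hasDerivAt 1 h2
  have h4 : HasDerivAt (fun t : ℝ => t ^ μ • g ξ) (μ • g ξ) 1 := by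
    have := (Real.hasDerivAt_rpow_const (x := 1) (p := μ) (Or.inl one_ne_zero)).smul_const (g ξ)
    simpa using this
  have h5 : (fun t : ℝ => g (t • ξ)) =ᶠ[nhds 1] fun t => t ^ μ • g ξ := by
    filter_upwards [lt_mem_nhds (show (0 : ℝ) < 1 by norm_num)] with t ht
    exact hg.homogeneous ξ t ht
  exact h1.unique (h4.congr_of_eventuallyEq h5)

lemma fderiv_smul (hg : IsSmoothHomogeneous μ g) {ξ : Rn n} (hξ : ξ ≠ 0) {t : ℝ} (ht : 0 < t) :
    fderiv ℝ g (t • ξ) = t ^ (μ - 1) • fderiv ℝ g ξ := by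
  have h1 : HasFDerivAt (fun x => g (t • x)) (t • fderiv ℝ g (t • ξ)) ξ := by
    have h2 : HasFDerivAt (fun x : Rn n => t • x) (t • ContinuousLinearMap.id ℝ (Rn n)) ξ :=
      (hasFDerivAt_id ξ).const_smul t
    have h3 := (hg.differentiableAt (smul_ne_zero ht.ne' hξ)).hasFDerivAt.comp ξ h2
    rw [ContinuousLinearMap.comp_smul, ContinuousLinearMap.comp_id] at h3
    exact h3
  have h4 : HasFDerivAt (fun x => g (t • x)) (t ^ μ • fderiv ℝ g ξ) ξ := by
    have : (fun x => g (t • x)) = fun x => t ^ μ • g x := funext fun x => hg.homogeneous x t ht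
    rw [this]
    exact (hg.differentiableAt hξ).hasFDerivAt.const_smul _
  have h5 := h1.unique h4
  rw [Real.rpow_sub_one ht.ne', div_eq_inv_mul, mul_smul, ← h5, inv_smul_smul₀ ht.ne']

end IsSmoothHomogeneous

section PhaseEstimates

variable {n : ℕ} {Φ : Rn n → ℝ}

lemma half_le_norm_of_mem_closedBall {θ x : Rn n} (hθ : ‖θ‖ = 1) (hx : ‖x - θ‖ ≤ 1 / 2) :
    1 / 2 ≤ ‖x‖ := by
  have h1 : ‖θ‖ ≤ ‖x‖ + ‖x - θ‖ := by
    calc ‖θ‖ = ‖x - (x - θ)‖ := by congr 1; abel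
      _ ≤ _ := norm_sub_le _ _
  linarith

lemma ne_zero_of_mem_closedBall {θ x : Rn n} (hθ : ‖θ‖ = 1) (hx : ‖x - θ‖ ≤ 1 / 2) : x ≠ 0 := by
  have := half_le_norm_of_mem_closedBall hθ hx
  rw [← norm_pos_iff]; linarith

/-- The second derivative is homogeneous of degree `-1`, hence bounded at distance at least `1/2`
from the origin; the mean value inequality applies on the ball of radius `1/2` about `θ`. -/
lemma exists_norm_fderiv_sub_le (hΦ : IsSmoothHomogeneous 1 Φ) : ∃ L : ℝ, 0 ≤ L ∧
    ∀ θ ν : Rn n, ‖θ‖ = 1 → ‖ν - θ‖ ≤ 1 / 2 → ‖fderiv ℝ Φ ν - fderiv ℝ Φ θ‖ ≤ L * ‖ν - θ‖ := by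
  obtain ⟨C, hC, h⟩ := hΦ.exists_norm_iteratedFDeriv_le 2
  refine ⟨C * 2, by positivity, fun θ ν hθ hν => ?_⟩
  refine (convex_closedBall θ (1 / 2)).norm_image_sub_le_of_norm_fderiv_le (𝕜 := ℝ)
    (fun x hx => ?_) (fun x hx => ?_) (by simp) (by simpa [dist_eq_norm] using hν)
  · have hx' := ne_zero_of_mem_closedBall hθ (by simpa [dist_eq_norm] using hx)
    exact ((hΦ.contDiffAt hx').fderiv_right (m := ∞) le_rfl).differentiableAt (by norm_num)
  · have hx0 : ‖x - θ‖ ≤ 1 / 2 := by simpa [dist_eq_norm] using hx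
    have hx' := ne_zero_of_mem_closedBall hθ hx0
    have hx2 := half_le_norm_of_mem_closedBall hθ hx0
    rw [← norm_iteratedFDeriv_one, norm_iteratedFDeriv_fderiv]
    refine (h x hx').trans ?_
    gcongr
    rw [show (1 : ℝ) - ((1 + 1 : ℕ) : ℝ) = -1 by norm_num, Real.rpow_neg_one]
    rw [inv_le_comm₀ (by linarith) (by norm_num)]
    linarith

/-- By Euler's identity at `θ` and at `ν`, the quantity is the first-order Taylor remainder of `Φ`
at `θ`, evaluated at `ν`, hence quadratic. This is the source of the gain `ε²` along `ν`. -/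
lemma abs_fderiv_sub_apply_le (hΦ : IsSmoothHomogeneous 1 Φ) {L : ℝ} (hL0 : 0 ≤ L)
    (hL : ∀ θ ν : Rn n, ‖θ‖ = 1 → ‖ν - θ‖ ≤ 1 / 2 →
      ‖fderiv ℝ Φ ν - fderiv ℝ Φ θ‖ ≤ L * ‖ν - θ‖) {θ ν : Rn n} (hθ : ‖θ‖ = 1)
    (hν : ‖ν - θ‖ ≤ 1 / 2) : |fderiv ℝ Φ θ ν - fderiv ℝ Φ ν ν| ≤ L * ‖ν - θ‖ ^ 2 := by
  have hν0 := ne_zero_of_mem_closedBall hθ hν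
  have hθ0 : θ ≠ 0 := ne_zero_of_mem_closedBall hθ (by simp)
  have h1 : fderiv ℝ Φ ν ν = Φ ν := by simpa using hΦ.fderiv_apply_self hν0
  have h2 : fderiv ℝ Φ θ θ = Φ θ := by simpa using hΦ.fderiv_apply_self hθ0
  have h3 : ‖(Φ ν - fderiv ℝ Φ θ ν) - (Φ θ - fderiv ℝ Φ θ θ)‖ ≤ L * ‖ν - θ‖ * ‖ν - θ‖ := by
    refine (convex_closedBall θ ‖ν - θ‖).norm_image_sub_le_of_norm_hasFDerivWithin_le (𝕜 := ℝ)
      (f := fun x => Φ x - fderiv ℝ Φ θ x) (f' := fun x => fderiv ℝ Φ x - fderiv ℝ Φ θ)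
      (fun x hx => ?_) (fun x hx => ?_) (by simp) (by simp [dist_eq_norm])
    · have hx0 : ‖x - θ‖ ≤ 1 / 2 := (by simpa [dist_eq_norm] using hx : ‖x - θ‖ ≤ ‖ν - θ‖).trans hν
      exact ((hΦ.differentiableAt (ne_zero_of_mem_closedBall hθ hx0)).hasFDerivAt.sub
        (fderiv ℝ Φ θ).hasFDerivAt).hasFDerivWithinAt
    · have hx1 : ‖x - θ‖ ≤ ‖ν - θ‖ := by simpa [dist_eq_norm] using hx
      exact (hL θ x hθ (hx1.trans hν)).trans (by gcongr)
  rw [h2, sub_self, sub_zero] at h3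
  rw [h1, abs_sub_comm, ← Real.norm_eq_abs]
  linarith [h3, sq (‖ν - θ‖)]

end PhaseEstimates

end

/-! ### The sector symbol and its derivatives -/

section

/-- The symbol `exp(i(Φ(ξ) - DΦ(ν)ξ)) ρ((ξ/|ξ| - ν)/ε) a(ξ/λ)` localised to the sector of aperture
`ε` around `ν`, with the linear part of the phase removed. -/
def sectorSymbol {n : ℕ} (Φ : Rn n → ℝ) (ρ a : Rn n → ℂ) (lam ε : ℝ) (ν ξ : Rn n) : ℂ :=
  Complex.exp (Complex.I * ((Φ ξ - fderiv ℝ Φ ν ξ : ℝ) : ℂ)) *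
    ρ (ε⁻¹ • (‖ξ‖⁻¹ • ξ - ν)) * a (lam⁻¹ • ξ)

/-- A smooth amplitude supported in the annulus `c ≤ |η| ≤ c'`. -/
structure IsAnnularSymbol {n : ℕ} (c c' : ℝ) (a : Rn n → ℂ) : Prop where
  smooth : ContDiff ℝ ∞ a
  lower : ∀ η, ‖η‖ < c → a η = 0
  upper : ∀ η, c' < ‖η‖ → a η = 0

lemma IsAnnularSymbol.hasCompactSupport {n : ℕ} {c c' : ℝ} {a : Rn n → ℂ}
    (ha : IsAnnularSymbol c c' a) : HasCompactSupport a :=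
  HasCompactSupport.intro (isCompact_closedBall (0 : Rn n) c') fun x hx =>
    ha.upper x (by simpa using hx)

/-- A smooth function supported in the unit ball. -/
structure IsUnitBump {n : ℕ} (ρ : Rn n → ℂ) : Prop where
  smooth : ContDiff ℝ ∞ ρ
  eq_zero : ∀ x, 1 ≤ ‖x‖ → ρ x = 0

lemma IsUnitBump.hasCompactSupport {n : ℕ} {ρ : Rn n → ℂ} (hρ : IsUnitBump ρ) :
    HasCompactSupport ρ :=
  HasCompactSupport.intro (isCompact_closedBall (0 : Rn n) 1) fun x hx =>
    hρ.eq_zero x (le_of_lt (by simpa using hx))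

section

variable {n : ℕ} {Φ : Rn n → ℝ} {ρ a : Rn n → ℂ} {c c' lam ε : ℝ} {ν : Rn n}

lemma norm_direction {ξ : Rn n} (hξ : ξ ≠ 0) : ‖‖ξ‖⁻¹ • ξ‖ = 1 := by
  rw [norm_smul, norm_inv, norm_norm, inv_mul_cancel₀ (norm_ne_zero_iff.2 hξ)]

lemma sectorSymbol_eq_zero_of_norm_lt (ha : IsAnnularSymbol c c' a) (hlam : 0 < lam) {ξ : Rn n}
    (hξ : ‖ξ‖ < c * lam) : sectorSymbol Φ ρ a lam ε ν ξ = 0 := by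
  rw [sectorSymbol, ha.lower, mul_zero]
  rw [norm_smul, norm_inv, Real.norm_of_nonneg hlam.le, inv_mul_lt_iff₀ hlam]
  linarith

lemma sectorSymbol_eq_zero_of_lt_norm (ha : IsAnnularSymbol c c' a) (hlam : 0 < lam) {ξ : Rn n}
    (hξ : c' * lam < ‖ξ‖) : sectorSymbol Φ ρ a lam ε ν ξ = 0 := by
  rw [sectorSymbol, ha.upper, mul_zero]
  rw [norm_smul, norm_inv, Real.norm_of_nonneg hlam.le, lt_inv_mul_iff₀ hlam]
  linarith

lemma sectorSymbol_eq_zero_of_lt_norm_sub (hρ : IsUnitBump ρ) (hε : 0 < ε) {ξ : Rn n}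
    (hξ : ε ≤ ‖‖ξ‖⁻¹ • ξ - ν‖) : sectorSymbol Φ ρ a lam ε ν ξ = 0 := by
  rw [sectorSymbol, hρ.eq_zero, mul_zero, zero_mul]
  rw [norm_smul, norm_inv, Real.norm_of_nonneg hε.le, le_inv_mul_iff₀ hε]
  linarith

lemma contDiffOn_phase_factor (hΦ : IsSmoothHomogeneous 1 Φ) (ν : Rn n) :
    ContDiffOn ℝ ∞ (fun ξ => Φ ξ - fderiv ℝ Φ ν ξ) {0}ᶜ :=
  hΦ.smooth.sub (fderiv ℝ Φ ν).contDiff.contDiffOn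

lemma contDiffOn_angular (n : ℕ) (ε : ℝ) (ν : Rn n) :
    ContDiffOn ℝ ∞ (fun ξ : Rn n => ε⁻¹ • (‖ξ‖⁻¹ • ξ - ν)) {0}ᶜ :=
  ((isSmoothHomogeneous_direction n).smooth.sub contDiffOn_const).const_smul _

lemma contDiff_radial (ha : IsAnnularSymbol c c' a) (lam : ℝ) :
    ContDiff ℝ ∞ fun ξ => a (lam⁻¹ • ξ) := ha.smooth.comp (contDiff_const_smul _)

lemma contDiff_sectorSymbol (hΦ : IsSmoothHomogeneous 1 Φ) (hρ : IsUnitBump ρ)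
    (ha : IsAnnularSymbol c c' a) (hc : 0 < c) (hlam : 0 < lam) :
    ContDiff ℝ ∞ (sectorSymbol Φ ρ a lam ε ν) := by
  rw [contDiff_iff_contDiffAt]
  intro ξ
  by_cases hξ : ξ = 0
  · have : sectorSymbol Φ ρ a lam ε ν =ᶠ[nhds ξ] fun _ => 0 := by
      filter_upwards [Metric.ball_mem_nhds ξ (mul_pos hc hlam)] with x hx
      rw [hξ, mem_ball_zero_iff] at hx
      exact sectorSymbol_eq_zero_of_norm_lt ha hlam hx
    exact contDiffAt_const.congr_of_eventuallyEq this
  · have hn : ({0}ᶜ : Set (Rn n)) ∈ nhds ξ := isOpen_compl_singleton.mem_nhds hξ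
    have h1 : ContDiffAt ℝ ∞ (fun ξ => Complex.exp (Complex.I * ((Φ ξ - fderiv ℝ Φ ν ξ : ℝ) : ℂ))) ξ :=
      contDiff_cexp_I_mul.contDiffAt.comp ξ ((contDiffOn_phase_factor hΦ ν).contDiffAt hn)
    have h2 : ContDiffAt ℝ ∞ (fun ξ => ρ (ε⁻¹ • (‖ξ‖⁻¹ • ξ - ν))) ξ :=
      hρ.smooth.contDiffAt.comp ξ ((contDiffOn_angular n ε ν).contDiffAt hn)
    exact (h1.mul h2).mul (contDiff_radial ha lam).contDiffAt

lemma hasCompactSupport_sectorSymbol (ha : IsAnnularSymbol c c' a) (hlam : 0 < lam) :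
    HasCompactSupport (sectorSymbol Φ ρ a lam ε ν) :=
  HasCompactSupport.intro (isCompact_closedBall (0 : Rn n) (c' * lam)) fun x hx =>
    sectorSymbol_eq_zero_of_lt_norm ha hlam (by simpa using hx)

/-- Outside the closed sector, and outside the closed annulus, the symbol vanishes locally. -/
lemma sectorSymbol_eventuallyEq_zero (hρ : IsUnitBump ρ) (ha : IsAnnularSymbol c c' a) (hc : 0 < c)
    (hlam : 0 < lam) (hε : 0 < ε) {ξ : Rn n}
    (h : ‖ξ‖ < c * lam ∨ ε < ‖‖ξ‖⁻¹ • ξ - ν‖) :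
    sectorSymbol Φ ρ a lam ε ν =ᶠ[nhds ξ] fun _ => 0 := by
  by_cases h1 : ‖ξ‖ < c * lam
  · filter_upwards [continuous_norm.continuousAt.eventually (gt_mem_nhds h1)] with x hx
    exact sectorSymbol_eq_zero_of_norm_lt ha hlam hx
  · have hξ : ξ ≠ 0 := by
      rintro rfl; exact h1 (by rw [norm_zero]; positivity)
    have h2 := h.resolve_left h1
    have hcont : ContinuousAt (fun ξ : Rn n => ‖‖ξ‖⁻¹ • ξ - ν‖) ξ :=
      (((isSmoothHomogeneous_direction n).contDiffAt hξ).continuousAt.sub continuousAt_const).norm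
    filter_upwards [hcont.eventually (lt_mem_nhds h2)] with x hx
    exact sectorSymbol_eq_zero_of_lt_norm_sub hρ hε (le_of_lt hx)

lemma norm_fderiv_apply_le_of_norm_iteratedFDeriv_le {E F : Type*} [NormedAddCommGroup E]
    [NormedSpace ℝ E] [NormedAddCommGroup F] [NormedSpace ℝ F] {f : E → F} {x : E} {A : ℝ}
    (h : ‖iteratedFDeriv ℝ 1 f x‖ ≤ A) (v : E) : ‖fderiv ℝ f x v‖ ≤ A * ‖v‖ := by
  rw [norm_iteratedFDeriv_one] at h
  exact (fderiv ℝ f x).le_of_opNorm_le h v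

/-- Symbol estimates in the sector: each derivative costs a factor `ε`, and the derivative in the
direction `ν` costs a factor `ε²`. -/
lemma exists_sectorSymbol_bounds (hΦ : IsSmoothHomogeneous 1 Φ) (hρ : IsUnitBump ρ)
    (ha : IsAnnularSymbol c c' a) (hc : 0 < c) (N : ℕ) : ∃ C : ℝ, 1 ≤ C ∧
    ∀ (lam ε : ℝ) (ν ξ : Rn n), 0 < lam → 0 < ε → ε ≤ 1 / 2 → lam⁻¹ ≤ ε ^ 2 →
      (∀ i ≤ N, ‖iteratedFDeriv ℝ i (sectorSymbol Φ ρ a lam ε ν) ξ‖ ≤ C * ε ^ i) ∧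
      ‖fderiv ℝ (sectorSymbol Φ ρ a lam ε ν) ξ ν‖ ≤ C * ε ^ 2 := by
  obtain ⟨L, hL0, hL⟩ := exists_norm_fderiv_sub_le hΦ
  obtain ⟨C₁, hC₁, hΦb⟩ := hΦ.exists_norm_iteratedFDeriv_le_uniform (N + 1)
  obtain ⟨C₂, hC₂, hdb⟩ := (isSmoothHomogeneous_direction n).exists_norm_iteratedFDeriv_le_uniform
    (N + 1)
  obtain ⟨A, hA, hab⟩ := exists_norm_iteratedFDeriv_le_of_hasCompactSupport ha.smooth
    ha.hasCompactSupport (N + 1)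
  obtain ⟨B, hB, hρb⟩ := exists_norm_iteratedFDeriv_le_of_hasCompactSupport hρ.smooth
    hρ.hasCompactSupport (N + 1)
  set K₁ := max (max C₁ L) c⁻¹
  have hK₁C : C₁ ≤ K₁ := (le_max_left _ _).trans (le_max_left _ _)
  have hK₁L : L ≤ K₁ := (le_max_right _ _).trans (le_max_left _ _)
  have hK₁c : c⁻¹ ≤ K₁ := le_max_right _ _
  have hK₁ : 1 ≤ K₁ := hC₁.trans hK₁C
  set K₂ := C₂ * max c⁻¹ 1
  have hK₂c : C₂ * c⁻¹ ≤ K₂ := by simp only [K₂]; gcongr; exact le_max_left _ _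
  have hK₂ : 1 ≤ K₂ := one_le_mul_of_one_le_of_one_le hC₂ (le_max_right _ _)
  set K := max K₁ K₂
  have hK : 1 ≤ K := hK₁.trans (le_max_left _ _)
  set M := 2 ^ N * (2 ^ N * (N.factorial * 1 * (N.factorial * B)) * A) * K ^ N
  set M' := K₁ * B * A + B * K₂ * A + B * (A * 2)
  have hM0 : 0 ≤ M := by positivity
  have hM'0 : 0 ≤ M' := by positivity
  refine ⟨max 1 (M + M'), le_max_left _ _, fun lam ε ν ξ hlam hε hε2 hlamε => ?_⟩
  -- Below the annulus or outside the closed sector the symbol vanishes near `ξ`. In the remaining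
  -- case `‖ξ‖⁻¹ = O(ε²)` and `ξ/‖ξ‖` is within `ε` of `ν`.
  by_cases hcase : ‖ξ‖ < c * lam ∨ ε < ‖‖ξ‖⁻¹ • ξ - ν‖
  · have h0 := sectorSymbol_eventuallyEq_zero (Φ := Φ) hρ ha hc hlam hε hcase
    have hC0 : 0 ≤ max 1 (M + M') := by positivity
    constructor
    · intro i _
      rw [(h0.iteratedFDeriv ℝ i).eq_of_nhds]
      have : iteratedFDeriv ℝ i (fun _ : Rn n => (0 : ℂ)) ξ = 0 := by
        simp
      rw [this, norm_zero]
      positivity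
    · rw [h0.fderiv_eq]
      simp only [fderiv_fun_const, Pi.zero_apply, zero_apply, norm_zero]
      positivity
  push Not at hcase
  obtain ⟨hξ1, hξ2⟩ := hcase
  have hcl : 0 < c * lam := mul_pos hc hlam
  have hξpos : 0 < ‖ξ‖ := hcl.trans_le hξ1
  have hξ0 : ξ ≠ 0 := norm_pos_iff.1 hξpos
  set θ := ‖ξ‖⁻¹ • ξ
  have hθ : ‖θ‖ = 1 := norm_direction hξ0
  have hνθ : ‖ν - θ‖ ≤ ε := by rw [norm_sub_rev]; exact hξ2
  have hνθ2 : ‖ν - θ‖ ≤ 1 / 2 := hνθ.trans hε2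
  have hν2 : ‖ν‖ ≤ 2 := by
    calc ‖ν‖ = ‖(ν - θ) + θ‖ := by rw [sub_add_cancel]
      _ ≤ ‖ν - θ‖ + ‖θ‖ := norm_add_le _ _
      _ ≤ 2 := by rw [hθ]; linarith
  have hε1 : ε ≤ 1 := hε2.trans (by norm_num)
  have hinv : ‖ξ‖⁻¹ ≤ c⁻¹ * ε ^ 2 := by
    calc ‖ξ‖⁻¹ ≤ (c * lam)⁻¹ := by gcongr
      _ = c⁻¹ * lam⁻¹ := mul_inv _ _
      _ ≤ _ := by gcongr
  have hDθ : fderiv ℝ Φ ξ = fderiv ℝ Φ θ := by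
    have := hΦ.fderiv_smul hξ0 (inv_pos.2 hξpos)
    simp only [sub_self, Real.rpow_zero, one_smul] at this
    exact this.symm
  have hmem : ξ ∈ ({0}ᶜ : Set (Rn n)) := hξ0
  have ho : IsOpen ({0}ᶜ : Set (Rn n)) := isOpen_compl_singleton
  -- the phase
  have hph1 : ‖fderiv ℝ Φ ξ - fderiv ℝ Φ ν‖ ≤ L * ε := by
    rw [hDθ, norm_sub_rev]
    exact (hL θ ν hθ hνθ2).trans (by gcongr)
  have hphd : HasFDerivAt (fun ξ => Φ ξ - fderiv ℝ Φ ν ξ) (fderiv ℝ Φ ξ - fderiv ℝ Φ ν) ξ :=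
    (hΦ.differentiableAt hξ0).hasFDerivAt.sub (fderiv ℝ Φ ν).hasFDerivAt
  have hphase : ∀ i, 1 ≤ i → i ≤ N →
      ‖iteratedFDeriv ℝ i (fun ξ => Φ ξ - fderiv ℝ Φ ν ξ) ξ‖ ≤ (K * ε) ^ i := by
    intro i hi hiN
    have hle : (K₁ * ε) ^ i ≤ (K * ε) ^ i := by gcongr; exact le_max_left _ _
    refine le_trans ?_ hle
    rcases eq_or_lt_of_le hi with rfl | hi2
    · rw [norm_iteratedFDeriv_one, hphd.fderiv, pow_one]
      exact hph1.trans (by gcongr)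
    -- From order two on, the linear part drops out and homogeneity gives `‖ξ‖^(1-i)`, which is
    -- `O(ε^(2(i-1)))`; this is enough because `2(i-1) ≥ i`.
    · have h1 : iteratedFDeriv ℝ i (fun ξ => Φ ξ - fderiv ℝ Φ ν ξ) ξ = iteratedFDeriv ℝ i Φ ξ := by
        have := iteratedFDeriv_sub_apply (𝕜 := ℝ) (i := i) (f := Φ) (g := fderiv ℝ Φ ν) (x := ξ)
          ((hΦ.contDiffAt hξ0).of_le (mod_cast le_top)) (fderiv ℝ Φ ν).contDiff.contDiffAt
        rw [iteratedFDeriv_clm_of_two_le _ hi2, sub_zero] at this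
        exact this
      rw [h1]
      obtain ⟨k, rfl⟩ := Nat.exists_eq_add_of_le hi
      have h2 := hΦb (1 + k) (by omega) ξ hξ0
      rw [show (1 : ℝ) - ((1 + k : ℕ) : ℝ) = -(k : ℝ) by push_cast; ring, Real.rpow_neg hξpos.le,
        Real.rpow_natCast, ← inv_pow] at h2
      refine h2.trans ?_
      calc C₁ * ‖ξ‖⁻¹ ^ k ≤ K₁ * (c⁻¹ * ε ^ 2) ^ k := by gcongr
        _ = K₁ * c⁻¹ ^ k * ε ^ (2 * k) := by rw [mul_pow, ← pow_mul]; ring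
        _ ≤ K₁ * K₁ ^ k * ε ^ (1 + k) := by
            have : ε ^ (2 * k) ≤ ε ^ (1 + k) :=
              pow_le_pow_of_le_one hε.le hε1 (by omega)
            gcongr
        _ = _ := by rw [mul_pow, pow_add K₁]; ring
  have hphaseE : ∀ i ≤ N, ‖iteratedFDeriv ℝ i
      (fun ξ => Complex.exp (Complex.I * ((Φ ξ - fderiv ℝ Φ ν ξ : ℝ) : ℂ))) ξ‖ ≤
      (N.factorial * 1) * (K * ε) ^ i :=
    norm_iteratedFDeriv_comp_le_of_le ho contDiff_cexp_I_mul (contDiffOn_phase_factor hΦ ν) hmem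
      (by positivity) (fun i _ => (norm_iteratedFDeriv_cexp_I_mul i _).le) hphase
  -- the angular cut-off
  have hang : ∀ i, 1 ≤ i → i ≤ N →
      ‖iteratedFDeriv ℝ i (fun ξ : Rn n => ε⁻¹ • (‖ξ‖⁻¹ • ξ - ν)) ξ‖ ≤ (K * ε) ^ i := by
    intro i hi hiN
    have hle : (K₂ * ε) ^ i ≤ (K * ε) ^ i := by gcongr; exact le_max_right _ _
    refine le_trans ?_ hle
    have hdc : ContDiffAt ℝ i (fun ξ : Rn n => ‖ξ‖⁻¹ • ξ) ξ :=
      ((isSmoothHomogeneous_direction n).contDiffAt hξ0).of_le (mod_cast le_top)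
    have h1 : iteratedFDeriv ℝ i (fun ξ : Rn n => ε⁻¹ • (‖ξ‖⁻¹ • ξ - ν)) ξ =
        ε⁻¹ • iteratedFDeriv ℝ i (fun ξ : Rn n => ‖ξ‖⁻¹ • ξ) ξ := by
      rw [iteratedFDeriv_const_smul_apply' (hdc.sub contDiffAt_const)]
      congr 1
      have := iteratedFDeriv_sub_apply (𝕜 := ℝ) (i := i) (f := fun ξ : Rn n => ‖ξ‖⁻¹ • ξ)
        (g := fun _ => ν) (x := ξ) hdc contDiffAt_const
      rw [iteratedFDeriv_const_of_ne (by omega), Pi.zero_apply, sub_zero] at this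
      exact this
    rw [h1, norm_smul, norm_inv, Real.norm_of_nonneg hε.le]
    have h2 := hdb i (by omega) ξ hξ0
    rw [zero_sub, Real.rpow_neg hξpos.le, Real.rpow_natCast, ← inv_pow] at h2
    -- Each derivative gains `‖ξ‖⁻¹ ≤ c⁻¹ ε²` and the dilation loses a single `ε⁻¹`; since `2i - 1 ≥
    -- i`, a power `ε ^ i` remains.
    calc ε⁻¹ * ‖iteratedFDeriv ℝ i (fun ξ : Rn n => ‖ξ‖⁻¹ • ξ) ξ‖
        ≤ ε⁻¹ * (C₂ ^ i * (c⁻¹ * ε ^ 2) ^ i) := by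
          gcongr
          refine h2.trans ?_
          gcongr
          exact le_self_pow₀ hC₂ (by omega)
      _ = (C₂ * c⁻¹) ^ i * (ε⁻¹ * ε ^ (2 * i)) := by rw [mul_pow, mul_pow, ← pow_mul]; ring
      _ ≤ K₂ ^ i * (ε⁻¹ * ε ^ (1 + i)) := by
          have : ε ^ (2 * i) ≤ ε ^ (1 + i) := pow_le_pow_of_le_one hε.le hε1 (by omega)
          gcongr
      _ = _ := by rw [pow_add, pow_one, inv_mul_cancel_left₀ hε.ne', mul_pow K₂]
  have hangE : ∀ i ≤ N, ‖iteratedFDeriv ℝ i (fun ξ => ρ (ε⁻¹ • (‖ξ‖⁻¹ • ξ - ν))) ξ‖ ≤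
      (N.factorial * B) * (K * ε) ^ i :=
    norm_iteratedFDeriv_comp_le_of_le ho hρ.smooth (contDiffOn_angular n ε ν) hmem
      (by positivity) (fun i hi => hρb i (by omega) _) hang
  -- the radial amplitude
  have hradd : ∀ i ≤ N + 1, ‖iteratedFDeriv ℝ i (fun ξ => a (lam⁻¹ • ξ)) ξ‖ ≤ A * (lam⁻¹) ^ i := by
    intro i hi
    have h2 := (lam⁻¹ • ContinuousLinearMap.id ℝ (Rn n)).iteratedFDeriv_comp_right ha.smooth ξ
      (i := i) (mod_cast le_top)
    have h3 : (iteratedFDeriv ℝ i a (lam⁻¹ • ξ)).compContinuousLinearMap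
        (fun _ => lam⁻¹ • ContinuousLinearMap.id ℝ (Rn n)) =
        (lam⁻¹) ^ i • iteratedFDeriv ℝ i a (lam⁻¹ • ξ) := by
      ext m
      simpa using (iteratedFDeriv ℝ i a (lam⁻¹ • ξ)).map_smul_univ (fun _ => lam⁻¹) m
    have h4 := h2.trans h3
    have h5 : (a ∘ (lam⁻¹ • ContinuousLinearMap.id ℝ (Rn n) : Rn n →L[ℝ] Rn n)) =
      fun ξ => a (lam⁻¹ • ξ) := rfl
    rw [h5] at h4
    rw [h4, norm_smul, norm_pow, Real.norm_of_nonneg (by positivity), mul_comm]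
    gcongr
    exact hab i hi _
  have hrad : ∀ i ≤ N, ‖iteratedFDeriv ℝ i (fun ξ => a (lam⁻¹ • ξ)) ξ‖ ≤ A * (K * ε) ^ i := by
    intro i hi
    refine (hradd i (by omega)).trans ?_
    gcongr
    calc lam⁻¹ ≤ ε ^ 2 := hlamε
      _ ≤ 1 * ε := by rw [sq]; gcongr
      _ ≤ K * ε := by gcongr
  have c1 : ContDiffOn ℝ ∞ (fun ξ => Complex.exp (Complex.I * ((Φ ξ - fderiv ℝ Φ ν ξ : ℝ) : ℂ))) {0}ᶜ :=
    contDiff_cexp_I_mul.comp_contDiffOn (contDiffOn_phase_factor hΦ ν)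
  have c2 : ContDiffOn ℝ ∞ (fun ξ => ρ (ε⁻¹ • (‖ξ‖⁻¹ • ξ - ν))) {0}ᶜ :=
    hρ.smooth.comp_contDiffOn (contDiffOn_angular n ε ν)
  have c3 : ContDiffOn ℝ ∞ (fun ξ => a (lam⁻¹ • ξ)) {0}ᶜ := (contDiff_radial ha lam).contDiffOn
  constructor
  · intro i hi
    have h12 := norm_iteratedFDeriv_mul_le_of_le ho c1 c2 hmem (by positivity) (by positivity)
      hphaseE hangE
    have h123 := norm_iteratedFDeriv_mul_le_of_le ho (c1.mul c2) c3 hmem (by positivity)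
      (by positivity) h12 hrad i hi
    refine h123.trans ?_
    calc _ = 2 ^ N * (2 ^ N * (N.factorial * 1 * (N.factorial * B)) * A) * K ^ i * ε ^ i := by
          rw [mul_pow]; ring
      _ ≤ M * ε ^ i := by
          simp only [M]
          gcongr
      _ ≤ _ := by
          gcongr
          exact le_trans (by linarith) (le_max_right _ _)
  · have d1 : HasFDerivAt (fun ξ => Complex.exp (Complex.I * ((Φ ξ - fderiv ℝ Φ ν ξ : ℝ) : ℂ)))
        (fderiv ℝ (fun ξ => Complex.exp (Complex.I * ((Φ ξ - fderiv ℝ Φ ν ξ : ℝ) : ℂ))) ξ) ξ :=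
      ((c1.contDiffAt (ho.mem_nhds hmem)).differentiableAt (by norm_num)).hasFDerivAt
    have d2 : HasFDerivAt (fun ξ => ρ (ε⁻¹ • (‖ξ‖⁻¹ • ξ - ν)))
        (fderiv ℝ (fun ξ => ρ (ε⁻¹ • (‖ξ‖⁻¹ • ξ - ν))) ξ) ξ :=
      ((c2.contDiffAt (ho.mem_nhds hmem)).differentiableAt (by norm_num)).hasFDerivAt
    have d3 : HasFDerivAt (fun ξ => a (lam⁻¹ • ξ)) (fderiv ℝ (fun ξ => a (lam⁻¹ • ξ)) ξ) ξ :=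
      ((c3.contDiffAt (ho.mem_nhds hmem)).differentiableAt (by norm_num)).hasFDerivAt
    -- Along `ν` the derivative of the phase is the quadratic Taylor remainder bounded in
    -- `abs_fderiv_sub_apply_le`.
    have e1 : ‖fderiv ℝ (fun ξ => Complex.exp (Complex.I * ((Φ ξ - fderiv ℝ Φ ν ξ : ℝ) : ℂ))) ξ ν‖ ≤
        K₁ * ε ^ 2 := by
      have hE : HasDerivAt (fun t : ℝ => Complex.exp (Complex.I * t))
          (deriv (fun t : ℝ => Complex.exp (Complex.I * t)) (Φ ξ - fderiv ℝ Φ ν ξ))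
          (Φ ξ - fderiv ℝ Φ ν ξ) :=
        (contDiff_cexp_I_mul.differentiable (by norm_num) _).hasDerivAt
      have h2 := hE.hasFDerivAt.comp ξ hphd
      have h3 : ‖deriv (fun t : ℝ => Complex.exp (Complex.I * t)) (Φ ξ - fderiv ℝ Φ ν ξ)‖ = 1 := by
        rw [← iteratedDeriv_one, ← norm_iteratedFDeriv_eq_norm_iteratedDeriv,
          norm_iteratedFDeriv_cexp_I_mul]
      have h4 := abs_fderiv_sub_apply_le hΦ hL0 hL hθ hνθ2
      have h5 : fderiv ℝ (fun ξ => Complex.exp (Complex.I * ((Φ ξ - fderiv ℝ Φ ν ξ : ℝ) : ℂ))) ξ =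
        _ := h2.fderiv
      rw [h5]
      simp only [ContinuousLinearMap.comp_apply, sub_apply, norm_smul,
        ContinuousLinearMap.toSpanSingleton_apply]
      rw [h3, mul_one, hDθ, Real.norm_eq_abs]
      exact h4.trans (by gcongr)
    have e2 : ‖fderiv ℝ (fun ξ => ρ (ε⁻¹ • (‖ξ‖⁻¹ • ξ - ν))) ξ ν‖ ≤ B * K₂ * ε ^ 2 := by
      have hdir := (isSmoothHomogeneous_direction n).differentiableAt hξ0
      have hd : HasFDerivAt (fun ξ : Rn n => ε⁻¹ • (‖ξ‖⁻¹ • ξ - ν))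
          (ε⁻¹ • fderiv ℝ (fun ξ : Rn n => ‖ξ‖⁻¹ • ξ) ξ) ξ :=
        (hdir.hasFDerivAt.sub_const ν).fun_const_smul _
      have h2 := (hρ.smooth.differentiable (by norm_num)
        (ε⁻¹ • (‖ξ‖⁻¹ • ξ - ν))).hasFDerivAt.comp ξ hd
      have h5 : fderiv ℝ (fun ξ => ρ (ε⁻¹ • (‖ξ‖⁻¹ • ξ - ν))) ξ = _ := h2.fderiv
      -- The direction map has degree zero, so its radial derivative vanishes and `ν` may be
      -- replaced by `ν - θ`. This factor `ε` cancels the `ε⁻¹` of the dilation.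
      have h6 : fderiv ℝ (fun ξ : Rn n => ‖ξ‖⁻¹ • ξ) ξ ν =
          fderiv ℝ (fun ξ : Rn n => ‖ξ‖⁻¹ • ξ) ξ (ν - θ) := by
        have := (isSmoothHomogeneous_direction n).fderiv_apply_self hξ0
        rw [zero_smul] at this
        rw [map_sub, (fderiv ℝ (fun ξ : Rn n => ‖ξ‖⁻¹ • ξ) ξ).map_smul, this, smul_zero, sub_zero]
      have h7 := hdb 1 (by omega) ξ hξ0
      rw [show (0 : ℝ) - ((1 : ℕ) : ℝ) = -1 by norm_num, Real.rpow_neg_one] at h7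
      have h8 := norm_fderiv_apply_le_of_norm_iteratedFDeriv_le h7 (ν - θ)
      have h9 := norm_fderiv_apply_le_of_norm_iteratedFDeriv_le
        (hρb 1 (by omega) (ε⁻¹ • (‖ξ‖⁻¹ • ξ - ν)))
        (ε⁻¹ • fderiv ℝ (fun ξ : Rn n => ‖ξ‖⁻¹ • ξ) ξ ν)
      rw [h5, ContinuousLinearMap.comp_apply, smul_apply]
      refine h9.trans ?_
      rw [norm_smul, norm_inv, Real.norm_of_nonneg hε.le, h6, mul_assoc B K₂]
      refine mul_le_mul_of_nonneg_left ?_ (by positivity)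
      calc ε⁻¹ * ‖fderiv ℝ (fun ξ : Rn n => ‖ξ‖⁻¹ • ξ) ξ (ν - θ)‖
          ≤ ε⁻¹ * (C₂ * (c⁻¹ * ε ^ 2) * ε) := by
            gcongr
            exact h8.trans (by gcongr)
        _ = C₂ * c⁻¹ * ε ^ 2 := by field_simp
        _ ≤ _ := by gcongr
    have e3 : ‖fderiv ℝ (fun ξ => a (lam⁻¹ • ξ)) ξ ν‖ ≤ A * 2 * ε ^ 2 := by
      have h1 := hradd 1 (by omega)
      rw [pow_one] at h1
      refine (norm_fderiv_apply_le_of_norm_iteratedFDeriv_le h1 ν).trans ?_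
      calc A * lam⁻¹ * ‖ν‖ ≤ A * ε ^ 2 * 2 := by gcongr
        _ = _ := by ring
    have n1 : ‖Complex.exp (Complex.I * ((Φ ξ - fderiv ℝ Φ ν ξ : ℝ) : ℂ))‖ = 1 := norm_cexp_I_mul _
    have n2 : ‖ρ (ε⁻¹ • (‖ξ‖⁻¹ • ξ - ν))‖ ≤ B := by
      simpa using hρb 0 (by omega) (ε⁻¹ • (‖ξ‖⁻¹ • ξ - ν))
    have n3 : ‖a (lam⁻¹ • ξ)‖ ≤ A := by simpa using hab 0 (by omega) (lam⁻¹ • ξ)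
    have hprod : fderiv ℝ (sectorSymbol Φ ρ a lam ε ν) ξ = _ := ((d1.mul d2).mul d3).fderiv
    rw [hprod]
    simp only [add_apply, smul_apply, smul_eq_mul]
    set E1 := Complex.exp (Complex.I * ((Φ ξ - fderiv ℝ Φ ν ξ : ℝ) : ℂ))
    set R1 := ρ (ε⁻¹ • (‖ξ‖⁻¹ • ξ - ν))
    set A1 := a (lam⁻¹ • ξ)
    set F1 := fderiv ℝ (fun ξ => Complex.exp (Complex.I * ((Φ ξ - fderiv ℝ Φ ν ξ : ℝ) : ℂ))) ξ ν
    set F2 := fderiv ℝ (fun ξ => ρ (ε⁻¹ • (‖ξ‖⁻¹ • ξ - ν))) ξ ν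
    set F3 := fderiv ℝ (fun ξ => a (lam⁻¹ • ξ)) ξ ν
    calc ‖E1 * R1 * F3 + A1 * (E1 * F2 + R1 * F1)‖
        ≤ ‖E1‖ * ‖R1‖ * ‖F3‖ + ‖A1‖ * (‖E1‖ * ‖F2‖ + ‖R1‖ * ‖F1‖) := by
          refine (norm_add_le _ _).trans ?_
          rw [norm_mul, norm_mul, norm_mul]
          gcongr
          refine (norm_add_le _ _).trans ?_
          rw [norm_mul, norm_mul]
      _ ≤ 1 * B * (A * 2 * ε ^ 2) + A * (1 * (B * K₂ * ε ^ 2) + B * (K₁ * ε ^ 2)) := by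
          rw [n1]; gcongr
      _ = M' * ε ^ 2 := by simp only [M']; ring
      _ ≤ _ := by
          gcongr
          exact le_trans (by linarith) (le_max_right _ _)

end

end

/-! ### Energy densities on the frequency side -/

section

open FourierTransform LineDeriv

section Leibniz

variable {n : ℕ}

lemma iteratedDeriv_line (f : 𝓢(Rn n, ℂ)) (ξ e : Rn n) (j : ℕ) :
    iteratedDeriv j (fun t : ℝ => f (ξ + t • e)) = fun t => (∂_{e})^[j] f (ξ + t • e) := by
  induction j with
  | zero => simp
  | succ j ih =>
    rw [iteratedDeriv_succ, ih]
    ext t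
    rw [Function.iterate_succ_apply', SchwartzMap.lineDerivOp_apply_eq_fderiv]
    have h1 : HasDerivAt (fun t : ℝ => ξ + t • e) e t := by
      simpa using ((hasDerivAt_id t).smul_const e).const_add ξ
    exact ((((∂_{e})^[j] f).differentiableAt.hasFDerivAt (x := ξ + t • e)).comp_hasDerivAt t h1).deriv

lemma contDiff_line (f : 𝓢(Rn n, ℂ)) (ξ e : Rn n) : ContDiff ℝ ∞ fun t : ℝ => f (ξ + t • e) :=
  (f.smooth ⊤).comp (contDiff_const.add (contDiff_id.smul contDiff_const))

/-- Restriction to the line `ξ + t • e` reduces the formula to the Leibniz rule in one variable. -/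
lemma iterate_lineDerivOp_eq_sum (b f H : 𝓢(Rn n, ℂ)) (hH : ∀ ξ, H ξ = b ξ * f ξ) (e : Rn n)
    (N : ℕ) (ξ : Rn n) :
    (∂_{e})^[N] H ξ = ∑ j ∈ Finset.range (N + 1),
      (N.choose j : ℂ) * (∂_{e})^[j] b ξ * (∂_{e})^[N - j] f ξ := by
  have h1 := congrFun (iteratedDeriv_line H ξ e N) 0
  have h2 : (fun t : ℝ => H (ξ + t • e)) = (fun t : ℝ => b (ξ + t • e)) * fun t => f (ξ + t • e) :=
    funext fun t => hH _
  rw [h2, iteratedDeriv_mul ((contDiff_line b ξ e).contDiffAt.of_le (mod_cast le_top))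
    ((contDiff_line f ξ e).contDiffAt.of_le (mod_cast le_top))] at h1
  simp only [iteratedDeriv_line, zero_smul, add_zero] at h1
  exact h1.symm

lemma norm_iterate_lineDerivOp_le (b : 𝓢(Rn n, ℂ)) (e : Rn n) (he : ‖e‖ ≤ 1) (j : ℕ) (ξ : Rn n) :
    ‖(∂_{e})^[j] b ξ‖ ≤ ‖iteratedFDeriv ℝ j b ξ‖ := by
  rw [← iteratedLineDerivOp_const_eq_iter_lineDerivOp, SchwartzMap.iteratedLineDerivOp_eq_iteratedFDeriv]
  refine ((iteratedFDeriv ℝ j b ξ).le_opNorm _).trans ?_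
  refine mul_le_of_le_one_right (norm_nonneg _) ?_
  simpa using pow_le_one₀ (norm_nonneg e) he

lemma lineDerivOp_eq_sum (f : 𝓢(Rn n, ℂ)) (e ξ : Rn n) :
    ∂_{e} f ξ = ∑ i, (e i : ℂ) * ∂_{EuclideanSpace.single i (1 : ℝ)} f ξ := by
  have h : e = ∑ i, e i • EuclideanSpace.single i (1 : ℝ) := by
    have := (EuclideanSpace.basisFun (Fin n) ℝ).sum_repr e
    simpa using this.symm
  simp only [SchwartzMap.lineDerivOp_apply_eq_fderiv]
  conv_lhs => rw [h]
  simp [map_sum]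

lemma norm_lineDerivOp_le_sum (f : 𝓢(Rn n, ℂ)) {e : Rn n} (he : ‖e‖ ≤ 1) (ξ : Rn n) :
    ‖∂_{e} f ξ‖ ≤ ∑ i : Fin n, ‖∂_{EuclideanSpace.single i (1 : ℝ)} f ξ‖ := by
  rw [lineDerivOp_eq_sum]
  refine (norm_sum_le _ _).trans (Finset.sum_le_sum fun i _ => ?_)
  rw [norm_mul]
  refine mul_le_of_le_one_left (norm_nonneg _) ?_
  rw [Complex.norm_real]
  exact (PiLp.norm_apply_le e i).trans he

end Leibniz

/-- The density controlling the energies of all sector pieces of `Γ`. -/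
def frequencyDensity {n : ℕ} (ε : ℝ) (f : 𝓢(Rn n, ℂ)) (ξ : Rn n) : ℝ :=
  ‖f ξ‖ ^ 2 + (ε⁻¹) ^ 4 * ∑ i : Fin n, ‖∂_{EuclideanSpace.single i (1 : ℝ)} f ξ‖ ^ 2 +
    ∑ i : Fin n, ∑ j ∈ Finset.range (3 * n + 1),
      (ε⁻¹) ^ (2 * j) * ‖(∂_{EuclideanSpace.single i (1 : ℝ)})^[j] f ξ‖ ^ 2

section

variable {n : ℕ} {ε : ℝ}

lemma frequencyDensity_nonneg (f : 𝓢(Rn n, ℂ)) (ξ : Rn n) : 0 ≤ frequencyDensity ε f ξ := by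
  unfold frequencyDensity
  have h : ∀ i : Fin n, ∀ j ∈ Finset.range (3 * n + 1),
      0 ≤ (ε⁻¹) ^ (2 * j) * ‖(∂_{EuclideanSpace.single i (1 : ℝ)})^[j] f ξ‖ ^ 2 := fun i j _ => by
    rw [pow_mul]; positivity
  have := Finset.sum_nonneg fun i (_ : i ∈ Finset.univ) => Finset.sum_nonneg (h i)
  have : 0 ≤ (ε⁻¹) ^ 4 * ∑ i : Fin n, ‖∂_{EuclideanSpace.single i (1 : ℝ)} f ξ‖ ^ 2 := by positivity
  positivity

lemma integrable_frequencyDensity (f : 𝓢(Rn n, ℂ)) : Integrable (frequencyDensity ε f) := by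
  unfold frequencyDensity
  refine ((SchwartzMap.integrable_norm_sq f).add ((integrable_finsetSum _ fun i _ =>
    SchwartzMap.integrable_norm_sq _).const_mul _)).add
    (integrable_finsetSum _ fun i _ => integrable_finsetSum _ fun j _ =>
      (SchwartzMap.integrable_norm_sq _).const_mul _)

lemma continuous_frequencyDensity (f : 𝓢(Rn n, ℂ)) : Continuous (frequencyDensity ε f) := by
  unfold frequencyDensity
  fun_prop

/-- Since `G` lives in `‖x‖ ≤ ε²`, each derivative of `𝓕⁻ G` costs `2π ε²` in `L²`. This cancels the
weight `ε⁻⁴` of the first derivatives exactly and leaves `ε^(2j) ≤ 1` for those of order `j`. -/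
lemma exists_integral_frequencyDensity_le (n : ℕ) : ∃ C : ℝ, 0 < C ∧
    ∀ (ε : ℝ) (G : 𝓢(Rn n, ℂ)), 0 < ε → ε ≤ 1 → (∀ x, ε ^ 2 < ‖x‖ → G x = 0) →
      ∫ ξ, frequencyDensity ε (𝓕⁻ G) ξ ≤ C * ∫ x, ‖G x‖ ^ 2 := by
  set P := 1 + n * (2 * Real.pi) ^ 2 +
    (n * (∑ j ∈ Finset.range (3 * n + 1), (2 * Real.pi) ^ (2 * j)))
  refine ⟨P, by positivity, fun ε G hε hε1 hG => ?_⟩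
  set E := ∫ x, ‖G x‖ ^ 2
  have hE : 0 ≤ E := integral_nonneg fun x => by positivity
  have hs : ∀ i : Fin n, ‖(EuclideanSpace.single i (1 : ℝ) : Rn n)‖ ≤ 1 := fun i => by simp
  have hb : ∀ (i : Fin n) j, ∫ ξ, ‖(∂_{EuclideanSpace.single i (1 : ℝ)})^[j] (𝓕⁻ G) ξ‖ ^ 2 ≤
      (2 * Real.pi * ε ^ 2) ^ (2 * j) * E := fun i j =>
    integral_norm_sq_iterate_lineDerivOp_fourierInv_le G hG _ (hs i) j
  have h0 : ∫ ξ, ‖(𝓕⁻ G) ξ‖ ^ 2 = E := by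
    have := integral_norm_sq_iterate_lineDerivOp_fourierInv (0 : Rn n) 0 G
    simpa using this
  have i1 := SchwartzMap.integrable_norm_sq (𝓕⁻ G)
  have i2 : Integrable fun ξ => (ε⁻¹) ^ 4 * ∑ i : Fin n,
      ‖∂_{EuclideanSpace.single i (1 : ℝ)} (𝓕⁻ G) ξ‖ ^ 2 :=
    (integrable_finsetSum _ fun i _ => SchwartzMap.integrable_norm_sq _).const_mul _
  have i12 : Integrable fun ξ => ‖(𝓕⁻ G) ξ‖ ^ 2 + (ε⁻¹) ^ 4 * ∑ i : Fin n,
      ‖∂_{EuclideanSpace.single i (1 : ℝ)} (𝓕⁻ G) ξ‖ ^ 2 := i1.add i2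
  have i4 : ∀ (i : Fin n) (j : ℕ), Integrable fun ξ => (ε⁻¹) ^ (2 * j) *
      ‖(∂_{EuclideanSpace.single i (1 : ℝ)})^[j] (𝓕⁻ G) ξ‖ ^ 2 := fun i j =>
    (SchwartzMap.integrable_norm_sq _).const_mul _
  have i3 : Integrable fun ξ => ∑ i : Fin n, ∑ j ∈ Finset.range (3 * n + 1), (ε⁻¹) ^ (2 * j) *
      ‖(∂_{EuclideanSpace.single i (1 : ℝ)})^[j] (𝓕⁻ G) ξ‖ ^ 2 :=
    integrable_finsetSum _ fun i _ => integrable_finsetSum _ fun j _ => i4 i j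
  unfold frequencyDensity
  rw [integral_add i12 i3, integral_add i1 i2, h0, integral_const_mul,
    integral_finsetSum _ fun i _ => SchwartzMap.integrable_norm_sq _,
    integral_finsetSum _ fun i _ => integrable_finsetSum _ fun j _ => i4 i j]
  have t2 : (ε⁻¹) ^ 4 * ∑ i : Fin n, ∫ ξ, ‖∂_{EuclideanSpace.single i (1 : ℝ)} (𝓕⁻ G) ξ‖ ^ 2 ≤
      n * (2 * Real.pi) ^ 2 * E := by
    calc _ ≤ (ε⁻¹) ^ 4 * ∑ i : Fin n, (2 * Real.pi * ε ^ 2) ^ (2 * 1) * E := by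
          gcongr with i
          exact hb i 1
      _ = _ := by
          simp only [Finset.sum_const, Finset.card_univ, Fintype.card_fin, nsmul_eq_mul]
          field_simp
          ring
  have t3 : ∑ i : Fin n, ∫ ξ, ∑ j ∈ Finset.range (3 * n + 1), (ε⁻¹) ^ (2 * j) *
      ‖(∂_{EuclideanSpace.single i (1 : ℝ)})^[j] (𝓕⁻ G) ξ‖ ^ 2 ≤
      (n * (∑ j ∈ Finset.range (3 * n + 1), (2 * Real.pi) ^ (2 * j))) * E := by
    calc _ ≤ ∑ i : Fin n, (∑ j ∈ Finset.range (3 * n + 1), (2 * Real.pi) ^ (2 * j)) * E := by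
          refine Finset.sum_le_sum fun i _ => ?_
          rw [integral_finsetSum _ fun j _ => i4 i j, Finset.sum_mul]
          refine Finset.sum_le_sum fun j _ => ?_
          rw [integral_const_mul]
          calc _ ≤ (ε⁻¹) ^ (2 * j) * ((2 * Real.pi * ε ^ 2) ^ (2 * j) * E) := by
                gcongr; exact hb i j
            _ = (2 * Real.pi * ε) ^ (2 * j) * E := by
                rw [← mul_assoc, ← mul_pow]; congr 2; field_simp
            _ ≤ _ := by
                exact mul_le_mul_of_nonneg_right (pow_le_pow_left₀ (by positivity)
                  (mul_le_of_le_one_right (by positivity) hε1) _) hE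
      _ = _ := by simp; ring
  calc _ ≤ E + n * (2 * Real.pi) ^ 2 * E +
        (n * (∑ j ∈ Finset.range (3 * n + 1), (2 * Real.pi) ^ (2 * j))) * E := by gcongr
    _ = P * E := by simp only [P]; ring

/-- Pointwise control of the derivatives entering the energy of a sector piece. -/
lemma energy_density_le {C : ℝ} (hC : 1 ≤ C) (hε : 0 < ε) (b f H : 𝓢(Rn n, ℂ))
    (hH : ∀ ξ, H ξ = b ξ * f ξ) {e : Rn n} (he : ‖e‖ = 1) {ξ : Rn n}
    (hb : ∀ i ≤ 3 * n, ‖iteratedFDeriv ℝ i b ξ‖ ≤ C * ε ^ i)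
    (hbe : ‖fderiv ℝ b ξ e‖ ≤ C * ε ^ 2) :
    ‖H ξ‖ ^ 2 + ((ε ^ 2)⁻¹) ^ 2 * ‖∂_{e} H ξ‖ ^ 2 +
      (ε⁻¹) ^ (6 * n) * ∑ i : Fin n, ‖(∂_{EuclideanSpace.single i (1 : ℝ)})^[3 * n] H ξ‖ ^ 2 ≤
    (C ^ 2 * (3 + 2 * n + 2 ^ (6 * n) * (3 * n + 1))) * frequencyDensity ε f ξ := by
  set X := ‖f ξ‖
  set S := ∑ i : Fin n, ‖∂_{EuclideanSpace.single i (1 : ℝ)} f ξ‖ ^ 2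
  set T := ∑ i : Fin n, ∑ j ∈ Finset.range (3 * n + 1),
      (ε⁻¹) ^ (2 * j) * ‖(∂_{EuclideanSpace.single i (1 : ℝ)})^[j] f ξ‖ ^ 2
  have hS : 0 ≤ S := by positivity
  have hT : 0 ≤ T := by positivity
  have hb0 : ‖b ξ‖ ≤ C := by simpa using hb 0 (Nat.zero_le _)
  have h1 : ‖H ξ‖ ^ 2 ≤ C ^ 2 * X ^ 2 := by
    rw [hH, norm_mul, mul_pow]; gcongr
  have h2 : ((ε ^ 2)⁻¹) ^ 2 * ‖∂_{e} H ξ‖ ^ 2 ≤ 2 * C ^ 2 * X ^ 2 + 2 * n * C ^ 2 * ((ε⁻¹) ^ 4 * S) := by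
    have h3 : ∂_{e} H ξ = b ξ * ∂_{e} f ξ + ∂_{e} b ξ * f ξ := by
      have := iterate_lineDerivOp_eq_sum b f H hH e 1 ξ
      simpa [Finset.sum_range_succ] using this
    have h4 : ‖∂_{e} H ξ‖ ≤ C * (∑ i : Fin n, ‖∂_{EuclideanSpace.single i (1 : ℝ)} f ξ‖) +
        C * ε ^ 2 * X := by
      rw [h3]
      refine (norm_add_le _ _).trans ?_
      rw [norm_mul, norm_mul]
      have := norm_lineDerivOp_le_sum f he.le ξ
      have h5 : ‖∂_{e} b ξ‖ ≤ C * ε ^ 2 := hbe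
      gcongr
    have h6 := sq_sum_le_card_mul_sum_sq (s := Finset.univ)
      (f := fun i : Fin n => ‖∂_{EuclideanSpace.single i (1 : ℝ)} f ξ‖)
    rw [Finset.card_univ, Fintype.card_fin] at h6
    set s := ∑ i : Fin n, ‖∂_{EuclideanSpace.single i (1 : ℝ)} f ξ‖
    have h7 : ‖∂_{e} H ξ‖ ^ 2 ≤ 2 * C ^ 2 * (n * S) + 2 * C ^ 2 * ε ^ 4 * X ^ 2 := by
      calc _ ≤ (C * s + C * ε ^ 2 * X) ^ 2 := by gcongr
        _ ≤ 2 * C ^ 2 * s ^ 2 + 2 * C ^ 2 * ε ^ 4 * X ^ 2 := by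
            nlinarith [sq_nonneg (C * s - C * ε ^ 2 * X)]
        _ ≤ _ := by gcongr
    calc _ ≤ ((ε ^ 2)⁻¹) ^ 2 * (2 * C ^ 2 * (n * S) + 2 * C ^ 2 * ε ^ 4 * X ^ 2) := by gcongr
      _ = _ := by field_simp; ring
  have h3 : (ε⁻¹) ^ (6 * n) * ∑ i : Fin n, ‖(∂_{EuclideanSpace.single i (1 : ℝ)})^[3 * n] H ξ‖ ^ 2 ≤
      C ^ 2 * (2 ^ (6 * n) * (3 * n + 1)) * T := by
    simp only [T]
    rw [Finset.mul_sum, Finset.mul_sum]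
    refine Finset.sum_le_sum fun i _ => ?_
    have hei : ‖(EuclideanSpace.single i (1 : ℝ) : Rn n)‖ ≤ 1 := by simp
    set v : Rn n := EuclideanSpace.single i (1 : ℝ)
    have h4 : ‖(∂_{v})^[3 * n] H ξ‖ ≤ ∑ j ∈ Finset.range (3 * n + 1),
        2 ^ (3 * n) * C * ε ^ j * ‖(∂_{v})^[3 * n - j] f ξ‖ := by
      rw [iterate_lineDerivOp_eq_sum b f H hH]
      refine (norm_sum_le _ _).trans (Finset.sum_le_sum fun j hj => ?_)
      rw [norm_mul, norm_mul, Complex.norm_natCast, mul_assoc _ C]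
      have h5 := (norm_iterate_lineDerivOp_le b v hei j ξ).trans
        (hb j (Nat.lt_succ_iff.1 (Finset.mem_range.1 hj)))
      have h6 : ((3 * n).choose j : ℝ) ≤ 2 ^ (3 * n) := by
        exact_mod_cast Nat.choose_le_two_pow (3 * n) j
      gcongr
    have h5 : ‖(∂_{v})^[3 * n] H ξ‖ ^ 2 ≤ (3 * n + 1) * ∑ j ∈ Finset.range (3 * n + 1),
        (2 ^ (3 * n) * C * ε ^ j * ‖(∂_{v})^[3 * n - j] f ξ‖) ^ 2 := by
      calc _ ≤ _ := pow_le_pow_left₀ (norm_nonneg _) h4 2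
        _ ≤ _ := sq_sum_le_card_mul_sum_sq
        _ = _ := by simp
    rw [← Finset.sum_range_reflect (fun j => (ε⁻¹) ^ (2 * j) * ‖(∂_{v})^[j] f ξ‖ ^ 2)]
    calc _ ≤ (ε⁻¹) ^ (6 * n) * ((3 * n + 1) * ∑ j ∈ Finset.range (3 * n + 1),
          (2 ^ (3 * n) * C * ε ^ j * ‖(∂_{v})^[3 * n - j] f ξ‖) ^ 2) := by gcongr
      _ = _ := by
          rw [← mul_assoc, Finset.mul_sum, Finset.mul_sum]
          refine Finset.sum_congr rfl fun j hj => ?_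
          have hj' : j ≤ 3 * n := Nat.lt_succ_iff.1 (Finset.mem_range.1 hj)
          rw [show 3 * n + 1 - 1 - j = 3 * n - j by omega]
          -- The weight is shared out: `ε^(-2j)` is absorbed by the `j` derivatives falling on `b`,
          -- and the rest is the weight that the density assigns to the `3n - j` derivatives of `f`.
          have h6 : (ε⁻¹) ^ (6 * n) = (ε⁻¹) ^ (2 * (3 * n - j)) * (ε⁻¹) ^ (2 * j) := by
            rw [← pow_add]; congr 1; omega
          have h7 : (ε⁻¹) ^ (2 * j) * (ε ^ j) ^ 2 = 1 := by
            rw [← pow_mul, mul_comm j 2, ← mul_pow, inv_mul_cancel₀ hε.ne', one_pow]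
          have h8 : ((2 : ℝ) ^ (3 * n)) ^ 2 = 2 ^ (6 * n) := by rw [← pow_mul]; congr 1; ring
          rw [h6, mul_pow, mul_pow, mul_pow, h8]
          calc _ = (ε⁻¹ ^ (2 * j) * (ε ^ j) ^ 2) * (C ^ 2 * (2 ^ (6 * n) * (3 * n + 1)) *
                (ε⁻¹ ^ (2 * (3 * n - j)) * ‖(∂_{v})^[3 * n - j] f ξ‖ ^ 2)) := by ring
            _ = _ := by rw [h7, one_mul]
  have hC2 : 0 ≤ C ^ 2 := by positivity
  have e1 : 0 ≤ C ^ 2 * X ^ 2 := by positivity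
  have e2 : 0 ≤ C ^ 2 * ((ε⁻¹) ^ 4 * S) := by positivity
  have e3 : 0 ≤ C ^ 2 * T := by positivity
  have hn0 : (0 : ℝ) ≤ n := by positivity
  set Q : ℝ := 2 ^ (6 * n) * (3 * n + 1)
  have hQ : 0 ≤ Q := by positivity
  have hexp : C ^ 2 * (3 + 2 * n + Q) * (X ^ 2 + (ε⁻¹) ^ 4 * S + T) =
      (3 + 2 * n + Q) * (C ^ 2 * X ^ 2) + (3 + 2 * n + Q) * (C ^ 2 * ((ε⁻¹) ^ 4 * S)) +
      (3 + 2 * n + Q) * (C ^ 2 * T) := by ring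
  have hfd : frequencyDensity ε f ξ = X ^ 2 + (ε⁻¹) ^ 4 * S + T := rfl
  rw [hfd, hexp]
  nlinarith [mul_nonneg hn0 e1, mul_nonneg hQ e1, mul_nonneg hQ e2, mul_nonneg hn0 e3]

end

end

/-! ### The `L¹` bound for one sector -/

section

open FourierTransform LineDeriv

variable {n : ℕ} {Φ : Rn n → ℝ} {ρ a : Rn n → ℂ} {c c' : ℝ}

lemma iterate_lineDerivOp_eq_zero_of_eventuallyEq {H : 𝓢(Rn n, ℂ)} {ξ : Rn n}
    (h : H =ᶠ[nhds ξ] fun _ => (0 : ℂ)) {e : Rn n} (he : ‖e‖ ≤ 1) (j : ℕ) :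
    (∂_{e})^[j] H ξ = 0 := by
  rw [← norm_le_zero_iff]
  refine (norm_iterate_lineDerivOp_le H e he j ξ).trans_eq ?_
  rw [(h.iteratedFDeriv ℝ j).eq_of_nhds, iteratedFDeriv_fun_zero]
  simp

/-- The closed sector (in the frequency space) of aperture `ε` around `ν`. -/
def sector (ε : ℝ) (ν : Rn n) : Set (Rn n) := {ξ | ‖‖ξ‖⁻¹ • ξ - ν‖ ≤ ε}

lemma measurableSet_sector_graph (ε : ℝ) :
    MeasurableSet {p : Rn n × Rn n | p.2 ∈ sector ε p.1} := by
  have h : Measurable fun p : Rn n × Rn n => ‖‖p.2‖⁻¹ • p.2 - p.1‖ := by fun_prop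
  exact h measurableSet_Iic

lemma measurableSet_sector (ε : ℝ) (ν : Rn n) : MeasurableSet (sector ε ν) := by
  have h : Measurable fun p : Rn n => ‖‖p‖⁻¹ • p - ν‖ := by fun_prop
  exact h measurableSet_Iic

/-- The plank estimate is applied with `e = ν/‖ν‖`, thickness `ε²` and width `ε`, so that the volume
is `ε² ε^(n-1) = ε^(n+1)`. The energy is dominated by a density independent of `ν`; the direction
enters only through the domain of integration. -/
lemma exists_integral_fourier_sectorSymbol_le (hn : 0 < n) (hΦ : IsSmoothHomogeneous 1 Φ)
    (hρ : IsUnitBump ρ) (ha : IsAnnularSymbol c c' a) (hc : 0 < c) : ∃ C : ℝ, 0 < C ∧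
    ∀ (lam ε κ : ℝ) (ν : Rn n) (Γ : 𝓢(Rn n, ℂ)), 0 < lam → 0 < ε → ε ≤ 1 / 2 → lam⁻¹ ≤ ε ^ 2 →
      0 < κ → 1 / 2 ≤ ‖ν‖ →
      ∫ y, ‖𝓕 (SchwartzMap.smulLeftCLM ℂ (sectorSymbol Φ ρ a lam ε ν) Γ) y‖ ≤
        C * (κ * ε ^ (n + 1) + κ⁻¹ * ∫ ξ in sector ε ν, frequencyDensity ε Γ ξ) := by
  obtain ⟨C₁, hC₁, h1⟩ := exists_integral_norm_fourier_le n hn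
  obtain ⟨C₂, hC₂, h2⟩ := exists_sectorSymbol_bounds hΦ hρ ha hc (3 * n)
  -- The symbol bound concerns `ν` itself; normalising it with `‖ν‖ ≥ 1/2` costs the factor `2`. The
  -- rest is the constant of `energy_density_le`.
  set M := (2 * C₂) ^ 2 * (3 + 2 * n + 2 ^ (6 * n) * (3 * n + 1))
  have hM : 0 ≤ M := by positivity
  refine ⟨C₁ * (1 + M), by positivity, fun lam ε κ ν Γ hlam hε hε2 hle hκ hν => ?_⟩
  have hν0 : ν ≠ 0 := by rw [← norm_pos_iff]; linarith
  have hsupp := hasCompactSupport_sectorSymbol (Φ := Φ) (ρ := ρ) (ε := ε) (ν := ν) ha hlam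
  have hsm := contDiff_sectorSymbol (ε := ε) (ν := ν) hΦ hρ ha hc hlam
  set b : 𝓢(Rn n, ℂ) := hsupp.toSchwartzMap hsm
  have hbc : (b : Rn n → ℂ) = sectorSymbol Φ ρ a lam ε ν := rfl
  set H := SchwartzMap.smulLeftCLM ℂ (sectorSymbol Φ ρ a lam ε ν) Γ
  have hH : ∀ ξ, H ξ = b ξ * Γ ξ := fun ξ => by
    simp only [H]
    rw [SchwartzMap.smulLeftCLM_apply_apply (hsupp.hasTemperateGrowth hsm)]
    rfl
  set e := ‖ν‖⁻¹ • ν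
  have he : ‖e‖ = 1 := norm_direction hν0
  have hpt : ∀ ξ, ‖H ξ‖ ^ 2 + ((ε ^ 2)⁻¹) ^ 2 * ‖∂_{e} H ξ‖ ^ 2 +
      (ε⁻¹) ^ (6 * n) * ∑ i : Fin n, ‖(∂_{EuclideanSpace.single i (1 : ℝ)})^[3 * n] H ξ‖ ^ 2 ≤
      (sector ε ν).indicator (fun ξ => M * frequencyDensity ε Γ ξ) ξ := by
    intro ξ
    obtain ⟨hb1, hb2⟩ := h2 lam ε ν ξ hlam hε hε2 hle
    by_cases hξ : ξ ∈ sector ε ν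
    · rw [indicator_of_mem hξ]
      refine energy_density_le (by linarith) hε b Γ H hH he (fun i hi => ?_) ?_
      · refine (hb1 i hi).trans ?_
        gcongr
        linarith
      · rw [hbc]
        simp only [e, map_smul, norm_smul, norm_inv, norm_norm]
        have : ‖ν‖⁻¹ ≤ 2 := by
          rw [inv_le_comm₀ (by linarith) (by norm_num)]; linarith
        calc _ ≤ 2 * (C₂ * ε ^ 2) := by gcongr
          _ = _ := by ring
    · rw [indicator_of_notMem hξ]
      have hz : H =ᶠ[nhds ξ] fun _ => (0 : ℂ) := by
        filter_upwards [sectorSymbol_eventuallyEq_zero (Φ := Φ) hρ ha hc hlam hε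
          (Or.inr (not_le.1 hξ))] with x hx
        rw [hH, hbc, hx, zero_mul]
      have z1 : ∂_{e} H ξ = 0 := iterate_lineDerivOp_eq_zero_of_eventuallyEq hz he.le 1
      have z2 : ∀ i : Fin n, (∂_{(EuclideanSpace.single i (1 : ℝ) : Rn n)})^[3 * n] H ξ = 0 :=
        fun i => iterate_lineDerivOp_eq_zero_of_eventuallyEq hz (by simp) _
      have z0 : H ξ = 0 := hz.eq_of_nhds
      simp [z0, z1, z2]
  have i1 := SchwartzMap.integrable_norm_sq H
  have i2 : Integrable fun ξ => ((ε ^ 2)⁻¹) ^ 2 * ‖∂_{e} H ξ‖ ^ 2 :=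
    (SchwartzMap.integrable_norm_sq _).const_mul _
  have i3 : ∀ i : Fin n, Integrable fun ξ =>
      ‖(∂_{EuclideanSpace.single i (1 : ℝ)})^[3 * n] H ξ‖ ^ 2 :=
    fun i => SchwartzMap.integrable_norm_sq _
  have i4 : Integrable fun ξ => (ε⁻¹) ^ (6 * n) * ∑ i : Fin n,
      ‖(∂_{EuclideanSpace.single i (1 : ℝ)})^[3 * n] H ξ‖ ^ 2 :=
    (integrable_finsetSum _ fun i _ => i3 i).const_mul _
  have i12 : Integrable fun ξ => ‖H ξ‖ ^ 2 + ((ε ^ 2)⁻¹) ^ 2 * ‖∂_{e} H ξ‖ ^ 2 := i1.add i2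
  have hE : sectorEnergy e (ε ^ 2) ε H ≤ M * ∫ ξ in sector ε ν, frequencyDensity ε Γ ξ := by
    have : sectorEnergy e (ε ^ 2) ε H = ∫ ξ, ‖H ξ‖ ^ 2 + ((ε ^ 2)⁻¹) ^ 2 * ‖∂_{e} H ξ‖ ^ 2 +
      (ε⁻¹) ^ (6 * n) * ∑ i : Fin n, ‖(∂_{EuclideanSpace.single i (1 : ℝ)})^[3 * n] H ξ‖ ^ 2 := by
      rw [integral_add i12 i4, integral_add i1 i2, integral_const_mul, integral_const_mul,
        integral_finsetSum _ fun i _ => i3 i]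
      rfl
    rw [this, ← integral_const_mul, ← integral_indicator (measurableSet_sector ε ν)]
    exact integral_mono (i12.add i4)
      (((integrable_frequencyDensity Γ).const_mul M).indicator (measurableSet_sector ε ν)) hpt
  have hI : 0 ≤ ∫ ξ in sector ε ν, frequencyDensity ε Γ ξ :=
    integral_nonneg fun ξ => frequencyDensity_nonneg Γ ξ
  calc _ ≤ C₁ * (κ * (ε ^ 2 * ε ^ (n - 1)) + κ⁻¹ * sectorEnergy e (ε ^ 2) ε H) :=
        h1 e (ε ^ 2) ε κ H he (by positivity) hε hκ
    _ ≤ C₁ * (κ * (ε ^ 2 * ε ^ (n - 1)) +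
          κ⁻¹ * (M * ∫ ξ in sector ε ν, frequencyDensity ε Γ ξ)) := by gcongr
    _ = C₁ * (κ * ε ^ (n + 1) + M * (κ⁻¹ * ∫ ξ in sector ε ν, frequencyDensity ε Γ ξ)) := by
        rw [← pow_add, show 2 + (n - 1) = n + 1 by omega]; ring
    _ ≤ C₁ * ((1 + M) * (κ * ε ^ (n + 1)) +
          (1 + M) * (κ⁻¹ * ∫ ξ in sector ε ν, frequencyDensity ε Γ ξ)) := by
        have : 0 ≤ κ * ε ^ (n + 1) := by positivity
        have : 0 ≤ κ⁻¹ * ∫ ξ in sector ε ν, frequencyDensity ε Γ ξ := by positivity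
        refine mul_le_mul_of_nonneg_left ?_ hC₁.le
        nlinarith
    _ = _ := by ring

/-- Sectors are averaged over centres `ν` in the whole space, and only this shell contributes; its
thickness supplies one factor `ε`. The bound follows from `(1 + ε)^n - (1 - ε)^n = O(ε)`. -/
lemma exists_volume_shell_le (n : ℕ) : ∃ C : ℝ, 0 < C ∧ ∀ ε : ℝ, 0 < ε → ε ≤ 1 / 2 →
    volume {ν : Rn n | |‖ν‖ - 1| ≤ ε} ≤ ENNReal.ofReal (C * ε) := by
  refine ⟨2 * n * 2 ^ (n - 1) * volume.real (Metric.ball (0 : Rn n) 1) + 1, by positivity,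
    fun ε hε hε2 => ?_⟩
  have hsub : {ν : Rn n | |‖ν‖ - 1| ≤ ε} ⊆
      Metric.closedBall 0 (1 + ε) \ Metric.ball 0 (1 - ε) := by
    intro ν hν
    have hν' := abs_le.1 (show |‖ν‖ - 1| ≤ ε from hν)
    simp only [mem_sdiff, Metric.mem_closedBall, dist_zero_right, Metric.mem_ball, not_lt]
    constructor <;> linarith
  have hB : volume (Metric.ball (0 : Rn n) 1) ≠ ⊤ := measure_ball_lt_top.ne
  refine (measure_mono hsub).trans ?_
  rw [measure_sdiff (Metric.ball_subset_closedBall.trans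
    (Metric.closedBall_subset_closedBall (by linarith))) measurableSet_ball.nullMeasurableSet
    measure_ball_lt_top.ne, Measure.addHaar_closedBall _ _ (by linarith),
    Measure.addHaar_ball_of_pos _ _ (by linarith : 0 < 1 - ε), finrank_euclideanSpace_fin,
    ← ENNReal.sub_mul (fun _ _ => hB), ← ENNReal.ofReal_sub _ (by bound),
    ← ENNReal.ofReal_toReal hB, ← ENNReal.ofReal_mul' ENNReal.toReal_nonneg]
  refine ENNReal.ofReal_le_ofReal ?_
  have h1 := (le_abs_self _).trans (abs_pow_sub_pow_le (1 + ε) (1 - ε) n)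
  rw [show 1 + ε - (1 - ε) = 2 * ε by ring, abs_of_pos (by linarith : 0 < 2 * ε),
    abs_of_pos (by linarith : 0 < 1 + ε), abs_of_pos (by linarith : 0 < 1 - ε),
    max_eq_left (by linarith)] at h1
  have h2 : (1 + ε) ^ (n - 1) ≤ 2 ^ (n - 1) := by gcongr; linarith
  have h3 : (0 : ℝ) ≤ volume.real (Metric.ball (0 : Rn n) 1) := measureReal_nonneg
  calc _ ≤ 2 * ε * n * 2 ^ (n - 1) * volume.real (Metric.ball (0 : Rn n) 1) := by
        rw [measureReal_def]
        gcongr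
        refine h1.trans ?_
        gcongr
    _ ≤ _ := by nlinarith

end

/-! ### Averaging over sectors and removal of the linear phase -/

section

open FourierTransform

variable {n : ℕ} {Φ : Rn n → ℝ} {ρ a : Rn n → ℂ} {c c' : ℝ}

lemma exists_isUnitBump (n : ℕ) : ∃ ρ : Rn n → ℂ, IsUnitBump ρ ∧ ∫ x, ρ x = 1 := by
  let b : ContDiffBump (0 : Rn n) := ⟨1 / 2, 1, by norm_num, by norm_num⟩
  refine ⟨fun x => (b.normed volume x : ℂ), ⟨?_, fun x hx => ?_⟩, ?_⟩
  · exact Complex.ofRealCLM.contDiff.comp b.contDiff_normed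
  · have : x ∉ Function.support (b.normed volume) := by
      rw [b.support_normed_eq]; simpa [b] using hx
    simpa using this
  · rw [integral_complex_ofReal, b.integral_normed, Complex.ofReal_one]

lemma integral_comp_inv_smul_sub (f : Rn n → ℂ) {ε : ℝ} (hε : 0 < ε) (θ : Rn n) :
    ∫ ν, f (ε⁻¹ • (θ - ν)) = (ε ^ n : ℝ) * ∫ x, f x := by
  rw [integral_sub_left_eq_self (fun ν => f (ε⁻¹ • ν)) volume θ, Measure.integral_comp_smul,
    finrank_euclideanSpace_fin, abs_of_pos (by positivity), inv_pow, inv_inv]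
  simp

section Averaging

variable (hρ : IsUnitBump ρ) {ε : ℝ} (hε : 0 < ε)
include hρ hε

lemma integrable_sector_kernel {h : Rn n → ℂ} (hm : Measurable h) (hi : Integrable h) (y : Rn n) :
    Integrable (fun p : Rn n × Rn n =>
      Real.fourierChar (-⟪p.1, y⟫_ℝ) • (ρ (ε⁻¹ • (‖p.1‖⁻¹ • p.1 - p.2)) * h p.1))
      (volume.prod volume) := by
  have hρm : Measurable ρ := hρ.smooth.continuous.measurable
  have hρi : Integrable ρ := hρ.smooth.continuous.integrable_of_hasCompactSupport hρ.hasCompactSupport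
  have hmeas : Measurable (fun p : Rn n × Rn n =>
      Real.fourierChar (-⟪p.1, y⟫_ℝ) • (ρ (ε⁻¹ • (‖p.1‖⁻¹ • p.1 - p.2)) * h p.1)) := by
    simp only [Circle.smul_def, smul_eq_mul]
    have h1 : Measurable fun p : Rn n × Rn n => (Real.fourierChar (-⟪p.1, y⟫_ℝ) : ℂ) := by
      have : Continuous fun p : Rn n × Rn n => (Real.fourierChar (-⟪p.1, y⟫_ℝ) : ℂ) := by
        fun_prop
      exact this.measurable
    have h2 : Measurable fun p : Rn n × Rn n => ρ (ε⁻¹ • (‖p.1‖⁻¹ • p.1 - p.2)) :=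
      hρm.comp (by fun_prop)
    exact h1.mul (h2.mul (hm.comp measurable_fst))
  rw [integrable_prod_iff hmeas.aestronglyMeasurable]
  have hs : ∀ θ : Rn n, Integrable fun ν => ρ (ε⁻¹ • (θ - ν)) := fun θ =>
    (hρi.comp_smul (R := ε⁻¹) (by positivity)).comp_sub_left θ
  refine ⟨Filter.Eventually.of_forall fun ξ => ?_, ?_⟩
  · simp only [Circle.smul_def, smul_eq_mul]
    exact ((hs _).mul_const _).const_mul _
  · simp only [Circle.norm_smul, norm_mul]
    have h1 : ∀ ξ : Rn n, ∫ ν, ‖ρ (ε⁻¹ • (‖ξ‖⁻¹ • ξ - ν))‖ * ‖h ξ‖ = ε ^ n * (∫ x, ‖ρ x‖) * ‖h ξ‖ := by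
      intro ξ
      rw [integral_mul_const]
      have := integral_comp_inv_smul_sub (fun x => (‖ρ x‖ : ℂ)) hε (‖ξ‖⁻¹ • ξ)
      rw [integral_complex_ofReal, integral_complex_ofReal] at this
      congr 1
      exact_mod_cast this
    simp only [h1]
    exact hi.norm.const_mul _

/-- For every `ξ` the function `ε^(-n) ρ(ε⁻¹(ξ/‖ξ‖ - ν))` has integral one in `ν`. This is a
continuous partition of unity into sectors, so no discrete family of directions has to be chosen. -/
lemma lintegral_fourier_le_sector_average (hρ1 : ∫ x, ρ x = 1) {h : Rn n → ℂ} (hm : Measurable h)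
    (hi : Integrable h) :
    ∫⁻ y, ‖𝓕 h y‖ₑ ≤ ENNReal.ofReal ((ε ^ n)⁻¹) *
      ∫⁻ ν, ∫⁻ y, ‖𝓕 (fun ξ => ρ (ε⁻¹ • (‖ξ‖⁻¹ • ξ - ν)) * h ξ) y‖ₑ := by
  have hρm : Measurable ρ := hρ.smooth.continuous.measurable
  have key : ∀ y, 𝓕 h y = ((ε ^ n)⁻¹ : ℝ) *
      ∫ ν, 𝓕 (fun ξ => ρ (ε⁻¹ • (‖ξ‖⁻¹ • ξ - ν)) * h ξ) y := by
    intro y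
    simp only [Real.fourier_eq]
    rw [← integral_integral_swap (integrable_sector_kernel hρ hε hm hi y), ← integral_const_mul]
    refine integral_congr_ae (Filter.Eventually.of_forall fun ξ => ?_)
    simp only [Circle.smul_def, smul_eq_mul]
    rw [integral_const_mul, integral_mul_const, integral_comp_inv_smul_sub ρ hε, hρ1]
    have : ((ε : ℂ) ^ n) ≠ 0 := pow_ne_zero _ (by exact_mod_cast hε.ne')
    push_cast
    field_simp
  have hjoint : Measurable fun p : Rn n × Rn n =>
      ‖𝓕 (fun ξ => ρ (ε⁻¹ • (‖ξ‖⁻¹ • ξ - p.2)) * h ξ) p.1‖ₑ := by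
    refine StronglyMeasurable.enorm ?_
    simp only [Real.fourier_eq]
    refine StronglyMeasurable.integral_prod_right' (f := fun q : (Rn n × Rn n) × Rn n =>
      Real.fourierChar (-⟪q.2, q.1.1⟫_ℝ) • (ρ (ε⁻¹ • (‖q.2‖⁻¹ • q.2 - q.1.2)) * h q.2)) ?_
    refine Measurable.stronglyMeasurable ?_
    simp only [Circle.smul_def, smul_eq_mul]
    have h1 : Measurable fun q : (Rn n × Rn n) × Rn n =>
        (Real.fourierChar (-⟪q.2, q.1.1⟫_ℝ) : ℂ) := by
      have : Continuous fun q : (Rn n × Rn n) × Rn n =>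
          (Real.fourierChar (-⟪q.2, q.1.1⟫_ℝ) : ℂ) := by fun_prop
      exact this.measurable
    have h2 : Measurable fun q : (Rn n × Rn n) × Rn n => ρ (ε⁻¹ • (‖q.2‖⁻¹ • q.2 - q.1.2)) :=
      hρm.comp (by fun_prop)
    exact h1.mul (h2.mul (hm.comp measurable_snd))
  rw [lintegral_lintegral_swap (f := fun ν y => ‖𝓕 (fun ξ => ρ (ε⁻¹ • (‖ξ‖⁻¹ • ξ - ν)) * h ξ) y‖ₑ)
    (hjoint.comp measurable_swap).aemeasurable,
    ← lintegral_const_mul' _ _ ENNReal.ofReal_ne_top]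
  refine lintegral_mono fun y => ?_
  rw [key, enorm_mul]
  gcongr
  · rw [← ofReal_norm, Complex.norm_real, Real.norm_of_nonneg (by positivity)]
  · exact enorm_integral_le_lintegral_enorm _

end Averaging

/-- The oscillatory symbol `exp(i(Φ(ξ) + w·ξ)) a(ξ/λ)`. -/
def oscSymbol (Φ : Rn n → ℝ) (a : Rn n → ℂ) (lam : ℝ) (w ξ : Rn n) : ℂ :=
  Complex.exp (Complex.I * ((Φ ξ + ⟪w, ξ⟫_ℝ : ℝ) : ℂ)) * a (lam⁻¹ • ξ)

section

variable {lam : ℝ} {w : Rn n}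

lemma contDiff_oscSymbol (hΦ : IsSmoothHomogeneous 1 Φ) (ha : IsAnnularSymbol c c' a) (hc : 0 < c)
    (hlam : 0 < lam) : ContDiff ℝ ∞ (oscSymbol Φ a lam w) := by
  rw [contDiff_iff_contDiffAt]
  intro ξ
  by_cases h : ‖ξ‖ < c * lam
  · refine (contDiffAt_const (c := (0 : ℂ))).congr_of_eventuallyEq ?_
    filter_upwards [continuous_norm.continuousAt.eventually (gt_mem_nhds h)] with x hx
    have : ‖lam⁻¹ • x‖ < c := by
      rw [norm_smul, norm_inv, Real.norm_of_nonneg hlam.le, inv_mul_lt_iff₀ hlam, mul_comm]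
      exact hx
    rw [oscSymbol, ha.lower _ this, mul_zero]
  · have hξ : ξ ≠ 0 := by
      rintro rfl; exact h (by rw [norm_zero]; positivity)
    have h1 : ContDiffAt ℝ ∞ (fun ξ => Φ ξ + ⟪w, ξ⟫_ℝ) ξ :=
      (hΦ.contDiffAt hξ).add (contDiff_const.inner ℝ contDiff_id).contDiffAt
    exact (contDiff_cexp_I_mul.contDiffAt.comp ξ h1).mul (contDiff_radial ha lam).contDiffAt

lemma hasCompactSupport_oscSymbol (ha : IsAnnularSymbol c c' a) (hlam : 0 < lam) :
    HasCompactSupport (oscSymbol Φ a lam w) :=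
  HasCompactSupport.intro (isCompact_closedBall (0 : Rn n) (c' * lam)) fun x hx => by
    have : c' < ‖lam⁻¹ • x‖ := by
      rw [norm_smul, norm_inv, Real.norm_of_nonneg hlam.le, lt_inv_mul_iff₀ hlam, mul_comm]
      simpa using hx
    rw [oscSymbol, ha.upper _ this, mul_zero]

lemma hasTemperateGrowth_oscSymbol (hΦ : IsSmoothHomogeneous 1 Φ) (ha : IsAnnularSymbol c c' a)
    (hc : 0 < c) (hlam : 0 < lam) : (oscSymbol Φ a lam w).HasTemperateGrowth :=
  (hasCompactSupport_oscSymbol ha hlam).hasTemperateGrowth (contDiff_oscSymbol hΦ ha hc hlam)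

/-- Removing the linear part of the phase amounts to a translation of the Fourier transform. -/
lemma exists_fourier_oscSymbol_sector_eq (Γ : Rn n → ℂ) (ε : ℝ) (ν : Rn n) : ∃ z : Rn n, ∀ y,
    𝓕 (fun ξ => ρ (ε⁻¹ • (‖ξ‖⁻¹ • ξ - ν)) * (oscSymbol Φ a lam w ξ * Γ ξ)) y =
      𝓕 (fun ξ => sectorSymbol Φ ρ a lam ε ν ξ * Γ ξ) (y - z) := by
  set x := (InnerProductSpace.toDual ℝ (Rn n)).symm (fderiv ℝ Φ ν)
  have hx : ∀ ξ, fderiv ℝ Φ ν ξ = ⟪x, ξ⟫_ℝ := fun ξ => by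
    simp [x]
  refine ⟨(2 * Real.pi)⁻¹ • (w + x), fun y => ?_⟩
  simp only [Real.fourier_eq']
  refine integral_congr_ae (Filter.Eventually.of_forall fun ξ => ?_)
  simp only [oscSymbol, sectorSymbol, smul_eq_mul, hx]
  have h1 : ∀ A B C D E F : ℂ, A * D = B * E → A * (C * (D * F * Γ ξ)) = B * (E * C * F * Γ ξ) := by
    intro A B C D E F h
    linear_combination (C * F * Γ ξ) * h
  refine h1 _ _ _ _ _ _ ?_
  rw [← Complex.exp_add, ← Complex.exp_add]
  congr 1
  rw [inner_sub_right, inner_smul_right, inner_add_right, real_inner_comm w ξ, real_inner_comm x ξ]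
  have : (Real.pi : ℂ) ≠ 0 := by exact_mod_cast Real.pi_ne_zero
  push_cast
  field_simp
  ring

end

end

/-! ### The fundamental `L¹` estimate -/

section

open FourierTransform

variable {n : ℕ} {Φ : Rn n → ℝ} {ρ a : Rn n → ℂ} {c c' : ℝ}

lemma norm_sub_one_le_of_mem_sector {ε : ℝ} {ν ξ : Rn n} (hξ : ξ ≠ 0) (h : ξ ∈ sector ε ν) :
    |‖ν‖ - 1| ≤ ε := by
  rw [← norm_direction hξ, abs_sub_comm]
  exact (abs_norm_sub_norm_le _ _).trans h

/-- By Tonelli: for fixed `ξ`, the centres `ν` whose sector contains `ξ` form the closed ball of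
radius `ε` about `ξ/‖ξ‖`. -/
lemma lintegral_sector_setLIntegral {ε : ℝ} (hε : 0 ≤ ε) {f : Rn n → ℝ≥0∞} (hf : Measurable f) :
    ∫⁻ ν, ∫⁻ ξ in sector ε ν, f ξ = ENNReal.ofReal (ε ^ n) * volume (Metric.ball (0 : Rn n) 1) *
      ∫⁻ ξ, f ξ := by
  have h1 : ∀ ν : Rn n, ∫⁻ ξ in sector ε ν, f ξ = ∫⁻ ξ, (sector ε ν).indicator f ξ := fun ν =>
    (lintegral_indicator (measurableSet_sector ε ν) f).symm
  simp only [h1]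
  rw [lintegral_lintegral_swap, ← lintegral_const_mul _ hf]
  · refine lintegral_congr fun ξ => ?_
    have h2 : ∀ ν : Rn n, (sector ε ν).indicator f ξ =
        (Metric.closedBall (‖ξ‖⁻¹ • ξ) ε).indicator (fun _ => f ξ) ν := fun ν => by
      simp only [indicator, sector, mem_ofPred_eq, Metric.mem_closedBall, dist_eq_norm,
        norm_sub_rev ν]
      congr
    simp only [h2]
    rw [lintegral_indicator measurableSet_closedBall, setLIntegral_const,
      Measure.addHaar_closedBall _ _ hε, finrank_euclideanSpace_fin, mul_comm]
  · have : (Function.uncurry fun ν ξ : Rn n => (sector ε ν).indicator f ξ) =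
        {p : Rn n × Rn n | p.2 ∈ sector ε p.1}.indicator fun p => f p.2 := by
      ext p
      rfl
    rw [this]
    exact ((hf.comp measurable_snd).indicator (measurableSet_sector_graph ε)).aemeasurable

/-- The fundamental `L¹` estimate: the oscillating multiplier maps `L²` functions supported in a
ball of radius `ε² ≥ λ⁻¹` to `L¹` with norm `O(ε)`. -/
theorem exists_integral_fourier_oscSymbol_le (hn : 0 < n) (hΦ : IsSmoothHomogeneous 1 Φ)
    (ha : IsAnnularSymbol c c' a) (hc : 0 < c) : ∃ C : ℝ, 0 < C ∧
    ∀ (lam ε g : ℝ) (w : Rn n) (G : 𝓢(Rn n, ℂ)), 0 < lam → 0 < ε → ε ≤ 1 / 2 → lam⁻¹ ≤ ε ^ 2 →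
      0 < g → (∀ x, ε ^ 2 < ‖x‖ → G x = 0) → ∫ x, ‖G x‖ ^ 2 ≤ g ^ 2 →
      ∫ y, ‖𝓕 (SchwartzMap.smulLeftCLM ℂ (oscSymbol Φ a lam w) (𝓕⁻ G)) y‖ ≤ C * (ε * g) := by
  obtain ⟨ρ, hρ, hρ1⟩ := exists_isUnitBump n
  obtain ⟨C₁, hC₁, h1⟩ := exists_integral_fourier_sectorSymbol_le hn hΦ hρ ha hc
  obtain ⟨C₂, hC₂, h2⟩ := exists_volume_shell_le n
  obtain ⟨C₃, hC₃, h3⟩ := exists_integral_frequencyDensity_le n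
  set V := volume.real (Metric.ball (0 : Rn n) 1)
  have hV : 0 ≤ V := measureReal_nonneg
  refine ⟨C₁ * (C₂ + V * C₃), by positivity,
    fun lam ε g w G hlam hε hε2 hle hg hG hGg => ?_⟩
  set Γ : 𝓢(Rn n, ℂ) := 𝓕⁻ G
  set h : 𝓢(Rn n, ℂ) := SchwartzMap.smulLeftCLM ℂ (oscSymbol Φ a lam w) Γ
  have hh : (h : Rn n → ℂ) = fun ξ => oscSymbol Φ a lam w ξ * Γ ξ := funext fun ξ =>
    SchwartzMap.smulLeftCLM_apply_apply (hasTemperateGrowth_oscSymbol hΦ ha hc hlam) _ _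
  -- This value balances the two contributions `κ ε²` and `κ⁻¹ g²` left after averaging.
  set κ := g / ε
  have hκ : 0 < κ := by positivity
  set D : Rn n → ℝ := frequencyDensity ε Γ
  have hDi : Integrable D := integrable_frequencyDensity Γ
  have hD0 : ∀ ξ, 0 ≤ D ξ := frequencyDensity_nonneg Γ
  have hDm : Measurable fun ξ => ENNReal.ofReal (D ξ) :=
    (continuous_frequencyDensity Γ).measurable.ennreal_ofReal
  set Sh : Set (Rn n) := {ν | |‖ν‖ - 1| ≤ ε}
  have hShm : MeasurableSet Sh := by
    have : Measurable fun ν : Rn n => |‖ν‖ - 1| := by fun_prop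
    exact this measurableSet_Iic
  have hpiece : ∀ ν : Rn n, ∫⁻ y, ‖𝓕 (fun ξ => ρ (ε⁻¹ • (‖ξ‖⁻¹ • ξ - ν)) * h ξ) y‖ₑ ≤
      Sh.indicator (fun _ => ENNReal.ofReal (C₁ * (κ * ε ^ (n + 1)))) ν +
        ENNReal.ofReal (C₁ * κ⁻¹) * ∫⁻ ξ in sector ε ν, ENNReal.ofReal (D ξ) := by
    intro ν
    by_cases hν : ν ∈ Sh
    · have hν' : 1 / 2 ≤ ‖ν‖ := by
        have := (abs_le.1 (show |‖ν‖ - 1| ≤ ε from hν)).1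
        linarith
      obtain ⟨z, hz⟩ := exists_fourier_oscSymbol_sector_eq (Φ := Φ) (a := a) (ρ := ρ) (lam := lam)
        (w := w) Γ ε ν
      have hsS : ((SchwartzMap.smulLeftCLM ℂ (sectorSymbol Φ ρ a lam ε ν) Γ : 𝓢(Rn n, ℂ)) :
          Rn n → ℂ) = fun ξ => sectorSymbol Φ ρ a lam ε ν ξ * Γ ξ := funext fun ξ =>
        SchwartzMap.smulLeftCLM_apply_apply ((hasCompactSupport_sectorSymbol ha hlam).hasTemperateGrowth
          (contDiff_sectorSymbol hΦ hρ ha hc hlam)) _ _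
      rw [hh]
      simp only [hz]
      rw [lintegral_sub_right_eq_self (fun y => ‖𝓕 (fun ξ => sectorSymbol Φ ρ a lam ε ν ξ * Γ ξ) y‖ₑ) z,
        ← hsS, indicator_of_mem hν]
      have h4 := h1 lam ε κ ν Γ hlam hε hε2 hle hκ hν'
      have h5 : ∫⁻ y, ‖𝓕 (SchwartzMap.smulLeftCLM ℂ (sectorSymbol Φ ρ a lam ε ν) Γ) y‖ₑ =
          ENNReal.ofReal (∫ y, ‖𝓕 (SchwartzMap.smulLeftCLM ℂ (sectorSymbol Φ ρ a lam ε ν) Γ) y‖) :=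
        (ofReal_integral_norm_eq_lintegral_enorm (SchwartzMap.integrable _)).symm
      change ∫⁻ y, ‖𝓕 (SchwartzMap.smulLeftCLM ℂ (sectorSymbol Φ ρ a lam ε ν) Γ) y‖ₑ ≤ _
      rw [h5, ← ofReal_integral_eq_lintegral_ofReal hDi.integrableOn
        (Filter.Eventually.of_forall hD0), ← ENNReal.ofReal_mul (by positivity),
        ← ENNReal.ofReal_add (by positivity)
          (mul_nonneg (by positivity) (integral_nonneg hD0))]
      refine ENNReal.ofReal_le_ofReal (h4.trans_eq ?_)
      ring
    -- Off the shell no unit vector lies within `ε` of `ν`, so the piece is identically zero.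
    · have h6 : ∀ y, 𝓕 (fun ξ => ρ (ε⁻¹ • (‖ξ‖⁻¹ • ξ - ν)) * h ξ) y = 0 := fun y => by
        have : (fun ξ => ρ (ε⁻¹ • (‖ξ‖⁻¹ • ξ - ν)) * h ξ) = fun _ => (0 : ℂ) := by
          ext ξ
          by_cases hξ : ξ = 0
          -- At `ξ = 0` the expression `‖ξ‖⁻¹ • ξ` takes the default value `0`, not a unit vector,
          -- so the vanishing comes from the amplitude and not from the angular cut-off.
          · have : oscSymbol Φ a lam w 0 = 0 := by
              rw [oscSymbol, smul_zero, ha.lower 0 (by simpa using hc), mul_zero]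
            rw [hξ, hh]
            simp [this]
          · have h7 : ε < ‖‖ξ‖⁻¹ • ξ - ν‖ := by
              by_contra h8
              exact hν (norm_sub_one_le_of_mem_sector hξ (not_lt.1 h8))
            rw [hρ.eq_zero, zero_mul]
            rw [norm_smul, norm_inv, Real.norm_of_nonneg hε.le, le_inv_mul_iff₀ hε, mul_one]
            exact h7.le
        rw [this, Real.fourier_eq]
        simp
      simp [h6]
  have hsum := (lintegral_fourier_le_sector_average hρ hε hρ1 h.continuous.measurable
    h.integrable).trans (mul_le_mul_right (lintegral_mono hpiece) _)
  rw [lintegral_add_left (measurable_const.indicator hShm), lintegral_indicator hShm,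
    setLIntegral_const, lintegral_const_mul' _ _ ENNReal.ofReal_ne_top,
    lintegral_sector_setLIntegral hε.le hDm,
    ← ofReal_integral_eq_lintegral_ofReal hDi (Filter.Eventually.of_forall hD0)] at hsum
  have hDI : ∫ ξ, D ξ ≤ C₃ * g ^ 2 := (h3 ε G hε (by linarith) hG).trans (by gcongr)
  have hDI0 : 0 ≤ ∫ ξ, D ξ := integral_nonneg hD0
  have hfin : ∫⁻ y, ‖𝓕 h y‖ₑ ≤ ENNReal.ofReal ((ε ^ n)⁻¹ * (C₁ * (κ * ε ^ (n + 1)) * (C₂ * ε) +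
      C₁ * κ⁻¹ * (ε ^ n * V * (C₃ * g ^ 2)))) := by
    refine hsum.trans ?_
    rw [ENNReal.ofReal_mul (p := (ε ^ n)⁻¹) (by positivity), ENNReal.ofReal_add (by positivity) (by positivity),
      ENNReal.ofReal_mul (p := C₁ * (κ * ε ^ (n + 1))) (by positivity),
      ENNReal.ofReal_mul (p := C₁ * κ⁻¹) (by positivity),
      ENNReal.ofReal_mul (p := ε ^ n * V) (by positivity),
      ENNReal.ofReal_mul (p := ε ^ n) (by positivity)]
    gcongr
    · exact h2 ε hε hε2
    · exact (ENNReal.ofReal_toReal measure_ball_lt_top.ne).ge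
  have h5 : ∫⁻ y, ‖𝓕 h y‖ₑ = ENNReal.ofReal (∫ y, ‖𝓕 h y‖) :=
    (ofReal_integral_norm_eq_lintegral_enorm (SchwartzMap.integrable _)).symm
  rw [h5, ENNReal.ofReal_le_ofReal_iff (by positivity)] at hfin
  refine hfin.trans_eq ?_
  simp only [κ]
  field_simp
  ring

end

/-! ### Functions of moderate growth and kernel representations -/

section

open FourierTransform

variable {n : ℕ}

/-- The weight `(1 + |y|)^(-n-1)`. -/
def polyWeight (n : ℕ) (y : Rn n) : ℝ := ((1 + ‖y‖) ^ (n + 1))⁻¹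

lemma polyWeight_pos (y : Rn n) : 0 < polyWeight n y := by
  unfold polyWeight; positivity

lemma continuous_polyWeight : Continuous (polyWeight n) := by
  unfold polyWeight
  exact Continuous.inv₀ (by fun_prop) fun y => by positivity

lemma integrable_polyWeight : Integrable (polyWeight n) := by
  have := integrable_one_add_norm (E := Rn n) (μ := volume) (r := (n : ℝ) + 1)
    (by rw [finrank_euclideanSpace_fin]; linarith)
  refine this.congr (Filter.Eventually.of_forall fun y => ?_)
  simp only [polyWeight]
  rw [Real.rpow_neg (by positivity)]
  congr 1
  exact_mod_cast Real.rpow_natCast (1 + ‖y‖) (n + 1)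

/-- A Peetre-type inequality: `1 + ‖y‖ ≤ (1 + ‖x‖)(1 + ‖y - x‖)`. -/
lemma polyWeight_sub_le (x y : Rn n) :
    polyWeight n (y - x) ≤ (1 + ‖x‖) ^ (n + 1) * polyWeight n y := by
  unfold polyWeight
  rw [← div_eq_mul_inv, inv_eq_one_div, div_le_div_iff₀ (by positivity) (by positivity), one_mul,
    ← mul_pow]
  have : ‖y‖ ≤ ‖x‖ + ‖y - x‖ := by
    simpa using norm_add_le x (y - x)
  gcongr
  nlinarith [norm_nonneg x, norm_nonneg (y - x)]

lemma SchwartzMap.exists_norm_le_polyWeight (g : 𝓢(Rn n, ℂ)) :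
    ∃ C : ℝ, 0 ≤ C ∧ ∀ y, ‖g y‖ ≤ C * polyWeight n y := by
  refine ⟨2 ^ (n + 1) * (Finset.Iic (n + 1, 0)).sup (fun m => SchwartzMap.seminorm ℂ m.1 m.2) g,
    by positivity, fun y => ?_⟩
  have := SchwartzMap.one_add_le_sup_seminorm_apply (𝕜 := ℂ) (m := (n + 1, 0)) le_rfl le_rfl g y
  rw [polyWeight, ← div_eq_mul_inv, le_div_iff₀' (by positivity)]
  simpa using this

/-- Functions which are integrable against the weight `(1 + |y|)^(-n-1)`. -/
def HasModerateGrowth (f : Rn n → ℂ) : Prop := Integrable fun y => polyWeight n y • f y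

namespace HasModerateGrowth

variable {f : Rn n → ℂ} (hf : HasModerateGrowth f)
include hf

lemma aestronglyMeasurable : AEStronglyMeasurable f := by
  have h : f = fun y => (polyWeight n y)⁻¹ • (polyWeight n y • f y) := by
    ext y
    rw [smul_smul, inv_mul_cancel₀ (polyWeight_pos y).ne', one_smul]
  rw [h]
  exact (continuous_polyWeight.inv₀ fun y =>
    (polyWeight_pos y).ne').aestronglyMeasurable.smul (Integrable.aestronglyMeasurable hf)

lemma integrable_mul {g : Rn n → ℂ} (hg : Continuous g) {C : ℝ}
    (hC : ∀ y, ‖g y‖ ≤ C * polyWeight n y) : Integrable fun y => g y * f y := by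
  refine (hf.norm.const_mul C).mono' (hg.aestronglyMeasurable.mul hf.aestronglyMeasurable)
    (Filter.Eventually.of_forall fun y => ?_)
  rw [norm_mul, norm_smul, Real.norm_of_nonneg (polyWeight_pos y).le, ← mul_assoc]
  gcongr
  exact hC y

lemma integrable_schwartz_mul (g : 𝓢(Rn n, ℂ)) : Integrable fun y => g y * f y := by
  obtain ⟨C, -, hC⟩ := g.exists_norm_le_polyWeight
  exact hf.integrable_mul g.continuous hC

lemma exists_tempered_represents : ∃ U : 𝓢'(Rn n, ℂ), Represents U f := by
  let L : 𝓢(Rn n, ℂ) →L[ℂ] ℂ := SchwartzMap.mkCLMtoNormedSpace (fun g => ∫ y, g y * f y)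
    (fun g h => by
      rw [← integral_add (hf.integrable_schwartz_mul g) (hf.integrable_schwartz_mul h)]
      refine integral_congr_ae (Filter.Eventually.of_forall fun y => ?_)
      simp only [add_apply]; ring)
    (fun a g => by
      simp only [smul_apply, smul_eq_mul, RingHom.id_apply, mul_assoc]
      exact integral_const_mul _ _)
    ⟨Finset.Iic (n + 1, 0), 2 ^ (n + 1) * ∫ y, ‖polyWeight n y • f y‖, by positivity, fun g => by
      rw [mul_right_comm, ← integral_const_mul]
      refine norm_integral_le_of_norm_le (hf.norm.const_mul _) (Filter.Eventually.of_forall fun y => ?_)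
      have := SchwartzMap.one_add_le_sup_seminorm_apply (𝕜 := ℂ) (m := (n + 1, 0)) le_rfl le_rfl g y
      rw [norm_iteratedFDeriv_zero] at this
      rw [norm_mul, norm_smul, Real.norm_of_nonneg (polyWeight_pos y).le, ← mul_assoc]
      gcongr
      rw [polyWeight, ← div_eq_mul_inv, le_div_iff₀' (by positivity)]
      exact this⟩
  exact ⟨ContinuousLinearMap.toPointwiseConvergenceCLM _ _ _ _ L, fun g => ⟨hf.integrable_schwartz_mul g, rfl⟩⟩

/-- The polynomial loss from translating the weight is absorbed by the decay of `v`. This justifies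
exchanging the integrals when a multiplier is transposed. -/
lemma integrable_kernel (κ v : 𝓢(Rn n, ℂ)) :
    Integrable (fun p : Rn n × Rn n => v p.1 * (κ (p.2 - p.1) * f p.2)) (volume.prod volume) := by
  obtain ⟨C, hC0, hC⟩ := κ.exists_norm_le_polyWeight
  have h1 : Integrable fun x : Rn n => C * ((1 + ‖x‖) ^ (n + 1) * ‖v x‖) := by
    have h2 := ((v.integrable_pow_mul volume 0).add (v.integrable_pow_mul volume (n + 1))).const_mul
      (C * 2 ^ (n + 1))
    refine h2.mono' (by fun_prop) (Filter.Eventually.of_forall fun x => ?_)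
    rw [Real.norm_of_nonneg (by positivity)]
    simp only [Pi.add_apply, pow_zero, one_mul]
    have h3 : (1 + ‖x‖) ^ (n + 1) ≤ 2 ^ (n + 1) * (1 + ‖x‖ ^ (n + 1)) := by
      rcases le_total ‖x‖ 1 with h | h
      · calc (1 + ‖x‖) ^ (n + 1) ≤ 2 ^ (n + 1) := by gcongr; linarith
          _ ≤ _ := le_mul_of_one_le_right (by positivity) (by
            have : 0 ≤ ‖x‖ ^ (n + 1) := by positivity
            linarith)
      · calc (1 + ‖x‖) ^ (n + 1) ≤ (2 * ‖x‖) ^ (n + 1) := by gcongr; linarith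
          _ = 2 ^ (n + 1) * ‖x‖ ^ (n + 1) := mul_pow _ _ _
          _ ≤ _ := by gcongr; linarith
    calc C * ((1 + ‖x‖) ^ (n + 1) * ‖v x‖) ≤ C * ((2 ^ (n + 1) * (1 + ‖x‖ ^ (n + 1))) * ‖v x‖) := by
          gcongr
      _ = _ := by ring
  refine (h1.mul_prod hf.norm).mono' ?_ (Filter.Eventually.of_forall fun p => ?_)
  · have hκ : Continuous fun p : Rn n × Rn n => κ (p.2 - p.1) := by fun_prop
    have hv : Continuous fun p : Rn n × Rn n => v p.1 := by fun_prop
    exact hv.aestronglyMeasurable.mul (hκ.aestronglyMeasurable.mul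
      (hf.aestronglyMeasurable.comp_quasiMeasurePreserving
        Measure.quasiMeasurePreserving_snd))
  · rw [norm_mul, norm_mul, norm_smul, Real.norm_of_nonneg (polyWeight_pos _).le]
    calc ‖v p.1‖ * (‖κ (p.2 - p.1)‖ * ‖f p.2‖)
        ≤ ‖v p.1‖ * ((C * ((1 + ‖p.1‖) ^ (n + 1) * polyWeight n p.2)) * ‖f p.2‖) := by
          gcongr
          exact (hC _).trans (by gcongr; exact polyWeight_sub_le _ _)
      _ = _ := by ring

lemma continuous_integral_kernel (κ : 𝓢(Rn n, ℂ)) :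
    Continuous fun x => ∫ y, κ (y - x) * f y := by
  obtain ⟨C, hC0, hC⟩ := κ.exists_norm_le_polyWeight
  rw [continuous_iff_continuousAt]
  intro x₀
  refine continuousAt_of_dominated
    (bound := fun y => C * (2 + ‖x₀‖) ^ (n + 1) * ‖polyWeight n y • f y‖)
    (Filter.Eventually.of_forall fun x => ?_) ?_ (hf.norm.const_mul _)
    (Filter.Eventually.of_forall fun y => ?_)
  · have hκ : Continuous fun y : Rn n => κ (y - x) := by fun_prop
    exact hκ.aestronglyMeasurable.mul hf.aestronglyMeasurable
  · filter_upwards [Metric.ball_mem_nhds x₀ one_pos] with x hx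
    refine Filter.Eventually.of_forall fun y => ?_
    rw [norm_mul, norm_smul, Real.norm_of_nonneg (polyWeight_pos _).le, ← mul_assoc]
    have h1 : ‖x‖ ≤ 1 + ‖x₀‖ := by
      have := norm_add_le (x - x₀) x₀
      rw [Metric.mem_ball, dist_eq_norm] at hx
      simp only [sub_add_cancel] at this
      linarith
    gcongr
    calc ‖κ (y - x)‖ ≤ C * ((1 + ‖x‖) ^ (n + 1) * polyWeight n y) :=
          (hC _).trans (by gcongr; exact polyWeight_sub_le _ _)
      _ ≤ C * ((2 + ‖x₀‖) ^ (n + 1) * polyWeight n y) := by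
          have := (polyWeight_pos y).le
          have h2 : 1 + ‖x‖ ≤ 2 + ‖x₀‖ := by linarith
          gcongr
      _ = _ := by ring
  · have hκ : Continuous fun x : Rn n => κ (y - x) := by fun_prop
    exact (hκ.mul continuous_const).continuousAt

end HasModerateGrowth

/-- The convolution theorem, obtained by applying the inverse transform to `𝓕 τ * G`. -/
lemma fourier_smulLeft_fourierInv_apply (τ G : 𝓢(Rn n, ℂ)) (y : Rn n) :
    𝓕 (SchwartzMap.smulLeftCLM ℂ (τ : Rn n → ℂ) (𝓕⁻ G)) y = ∫ x, 𝓕 τ (y - x) * G x := by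
  have h1 : SchwartzMap.smulLeftCLM ℂ (τ : Rn n → ℂ) (𝓕⁻ G) =
      𝓕⁻ (SchwartzMap.convolution (ContinuousLinearMap.mul ℂ ℂ) (𝓕 τ) G) := by
    ext ξ
    rw [SchwartzMap.smulLeftCLM_apply_apply τ.hasTemperateGrowth]
    have h2 : ∀ (H : 𝓢(Rn n, ℂ)), (𝓕⁻ H) ξ = (𝓕 H) (-ξ) := fun H => by
      rw [SchwartzMap.fourierInv_coe, SchwartzMap.fourier_coe, Real.fourierInv_eq_fourier_neg]
    rw [h2, h2, SchwartzMap.fourier_convolution, SchwartzMap.pairing_apply_apply, ← h2 (𝓕 τ)]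
    simp
  rw [h1, FourierTransform.fourier_fourierInv_eq, SchwartzMap.convolution_apply,
    convolution_eq_swap]
  rfl

/-- The kernel representation of the transposed Fourier multiplier. -/
lemma HasModerateGrowth.integral_fourier_smulLeft_mul {f : Rn n → ℂ} (hf : HasModerateGrowth f)
    (τ G : 𝓢(Rn n, ℂ)) :
    ∫ y, 𝓕 (SchwartzMap.smulLeftCLM ℂ (τ : Rn n → ℂ) (𝓕⁻ G)) y * f y =
      ∫ x, G x * ∫ y, 𝓕 τ (y - x) * f y := by
  simp only [fourier_smulLeft_fourierInv_apply, ← integral_const_mul]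
  rw [integral_integral_swap (hf.integrable_kernel (𝓕 τ) G)]
  refine integral_congr_ae (Filter.Eventually.of_forall fun y => ?_)
  simp only
  rw [← integral_mul_const]
  refine integral_congr_ae (Filter.Eventually.of_forall fun x => ?_)
  simp only
  ring

end

/-! ### Local `L²` bounds by duality -/

section

variable {n : ℕ}

/-- A local `L²` bound by duality against test functions. -/
lemma setIntegral_norm_sq_le_of_forall_schwartz {F : Rn n → ℂ} (hF : Continuous F) {c : Rn n}
    {l A : ℝ} (hl : 0 < l)
    (h : ∀ (G : 𝓢(Rn n, ℂ)) (g : ℝ), (∀ x, l < ‖x - c‖ → G x = 0) → 0 < g →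
      ∫ x, ‖G x‖ ^ 2 ≤ g ^ 2 → ‖∫ x, G x * F x‖ ≤ A * g) :
    ∫ x in Metric.ball c (l / 2), ‖F x‖ ^ 2 ≤ A ^ 2 := by
  let η : ContDiffBump c := ⟨l / 2, l, by positivity, by linarith⟩
  have hηc : HasCompactSupport η := η.hasCompactSupport
  have hηi : ∀ {E : Type} [NormedAddCommGroup E] [NormedSpace ℝ E] {u : Rn n → E}, Continuous u →
      Integrable fun x => η x • u x := fun hu =>
    (η.continuous.smul hu).integrable_of_hasCompactSupport hηc.smul_right
  set X := ∫ x, η x ^ 2 * ‖F x‖ ^ 2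
  set M₁ := ∫ x, η x * ‖F x‖
  set M₀ := ∫ x, η x
  have iX : Integrable fun x => η x ^ 2 * ‖F x‖ ^ 2 := by
    have := hηi (u := fun x => η x * ‖F x‖ ^ 2) (by have := η.continuous; fun_prop)
    refine this.congr (Filter.Eventually.of_forall fun x => ?_)
    simp only [smul_eq_mul]; ring
  have i1 : Integrable fun x => η x * ‖F x‖ := hηi (u := fun x => ‖F x‖) (by fun_prop)
  have i0 : Integrable fun x => η x := η.continuous.integrable_of_hasCompactSupport hηc
  have hX0 : 0 ≤ X := integral_nonneg fun x => by positivity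
  have hM1 : 0 ≤ M₁ := integral_nonneg fun x => mul_nonneg η.nonneg (norm_nonneg _)
  have hM0 : 0 ≤ M₀ := integral_nonneg fun x => η.nonneg
  have hcont : Continuous fun x => η x • F x := η.continuous.smul hF
  have huc : UniformContinuous fun x => η x • F x :=
    hcont.uniformContinuous_of_tendsto_cocompact hηc.smul_right.is_zero_at_infty
  have hδ : ∀ δ : ℝ, 0 < δ →
      X ≤ δ * M₁ + A * √(X + 2 * δ * M₁ + δ ^ 2 * M₀ + δ) := by
    intro δ hδ
    -- The natural test function `η² conj F` is only continuous. With a smooth `u` uniformly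
    -- `δ`-close to `η F`, the function `η conj u` is admissible, and the errors vanish as `δ → 0`.
    obtain ⟨u, hu, hud⟩ := huc.exists_contDiff_dist_le hδ
    have hGs : ContDiff ℝ ∞ fun x => η x • (starRingEnd ℂ) (u x) :=
      η.contDiff.smul (Complex.conjCLE.contDiff.comp hu)
    have hGc : HasCompactSupport fun x => η x • (starRingEnd ℂ) (u x) := hηc.smul_right
    set G : 𝓢(Rn n, ℂ) := hGc.toSchwartzMap hGs
    have hG : ∀ x, G x = η x • (starRingEnd ℂ) (u x) := fun x => rfl
    -- The first three summands bound `‖G‖₂²`; the last one makes `g` strictly positive.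
    set g := √(X + 2 * δ * M₁ + δ ^ 2 * M₀ + δ)
    have hg : 0 < g := Real.sqrt_pos.2 (by positivity)
    have hgs : g ^ 2 = X + 2 * δ * M₁ + δ ^ 2 * M₀ + δ := Real.sq_sqrt (by positivity)
    have hdist : ∀ x, ‖u x - η x • F x‖ ≤ δ := fun x => by
      have := (hud x).le
      rwa [dist_eq_norm] at this
    have h1 := h G g (fun x hx => by
        rw [hG, η.zero_of_le_dist (by rw [dist_eq_norm]; exact hx.le), zero_smul]) hg (by
      rw [hgs]
      calc ∫ x, ‖G x‖ ^ 2 ≤ ∫ x, η x ^ 2 * ‖F x‖ ^ 2 + 2 * δ * (η x * ‖F x‖) + δ ^ 2 * η x := by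
            refine integral_mono (SchwartzMap.integrable_norm_sq G)
              ((iX.add (i1.const_mul _)).add (i0.const_mul _)) fun x => ?_
            simp only
            have h2 : ‖u x‖ ≤ η x * ‖F x‖ + δ := by
              have := norm_add_le (u x - η x • F x) (η x • F x)
              rw [sub_add_cancel, norm_smul, Real.norm_of_nonneg η.nonneg] at this
              linarith [hdist x]
            have h3 : ‖G x‖ ≤ η x * (η x * ‖F x‖ + δ) := by
              rw [hG, norm_smul, Real.norm_of_nonneg η.nonneg, RCLike.norm_conj]
              have := η.nonneg (x := x)
              gcongr
            have e0 := η.nonneg (x := x)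
            have e1 := η.le_one (x := x)
            have e2 : (η x) ^ 2 ≤ η x := by nlinarith
            have e3 : (η x) ^ 2 ≤ 1 := by nlinarith
            calc ‖G x‖ ^ 2 ≤ (η x * (η x * ‖F x‖ + δ)) ^ 2 := by gcongr
              _ = (η x) ^ 2 * (η x ^ 2 * ‖F x‖ ^ 2) + (η x) ^ 2 * (2 * δ * (η x * ‖F x‖)) +
                  δ ^ 2 * (η x) ^ 2 := by ring
              _ ≤ 1 * (η x ^ 2 * ‖F x‖ ^ 2) + 1 * (2 * δ * (η x * ‖F x‖)) + δ ^ 2 * η x := by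
                  gcongr
              _ = _ := by ring
        _ = X + 2 * δ * M₁ + δ ^ 2 * M₀ := by
            have iA : Integrable fun x => η x ^ 2 * ‖F x‖ ^ 2 + 2 * δ * (η x * ‖F x‖) :=
              iX.add (i1.const_mul _)
            rw [integral_add iA (i0.const_mul _), integral_add iX (i1.const_mul _),
              integral_const_mul, integral_const_mul]
        _ ≤ _ := by linarith)
    have iGF : Integrable fun x => G x * F x := by
      refine (hηi (u := fun x => (starRingEnd ℂ) (u x) * F x)
        ((Complex.continuous_conj.comp hu.continuous).mul hF)).congr
        (Filter.Eventually.of_forall fun x => ?_)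
      simp only [hG, Complex.real_smul]; ring
    have h4 : ‖∫ x, G x * F x - ((η x ^ 2 * ‖F x‖ ^ 2 : ℝ) : ℂ)‖ ≤ δ * M₁ := by
      rw [← integral_const_mul]
      refine norm_integral_le_of_norm_le (i1.const_mul _) (Filter.Eventually.of_forall fun x => ?_)
      have : G x * F x - ((η x ^ 2 * ‖F x‖ ^ 2 : ℝ) : ℂ) =
          (starRingEnd ℂ) (u x - η x • F x) * (η x • F x) := by
        rw [hG]
        push_cast
        rw [← Complex.conj_mul' (F x)]
        simp only [Complex.real_smul, map_sub, map_mul, Complex.conj_ofReal]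
        ring
      rw [this, norm_mul, RCLike.norm_conj, norm_smul, Real.norm_of_nonneg η.nonneg]
      have := η.nonneg (x := x)
      gcongr
      exact hdist x
    have iXc : Integrable fun x => ((η x ^ 2 * ‖F x‖ ^ 2 : ℝ) : ℂ) := iX.ofReal
    rw [integral_sub iGF iXc, integral_complex_ofReal] at h4
    have h5 : ‖(X : ℂ)‖ ≤ ‖∫ x, G x * F x‖ + ‖(∫ x, G x * F x) - (X : ℂ)‖ := by
      have := norm_sub_le (∫ x, G x * F x) ((∫ x, G x * F x) - (X : ℂ))
      rwa [sub_sub_cancel] at this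
    rw [Complex.norm_real, Real.norm_of_nonneg hX0] at h5
    linarith
  have hlim : X ≤ A * √X := by
    have ht : Filter.Tendsto (fun δ : ℝ => δ * M₁ + A * √(X + 2 * δ * M₁ + δ ^ 2 * M₀ + δ))
        (nhdsWithin 0 (Ioi 0)) (nhds (A * √X)) := by
      have : Continuous fun δ : ℝ => δ * M₁ + A * √(X + 2 * δ * M₁ + δ ^ 2 * M₀ + δ) := by fun_prop
      have h2 := (this.tendsto 0).mono_left (nhdsWithin_le_nhds (s := Ioi 0))
      simpa using h2
    exact ge_of_tendsto ht (by filter_upwards [self_mem_nhdsWithin] with δ hd using hδ δ hd)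
  have hXA : X ≤ A ^ 2 := by
    have h1 := Real.sq_sqrt hX0
    have h2 := Real.sqrt_nonneg X
    rcases h2.eq_or_lt with h3 | h3
    · rw [← h1, ← h3, zero_pow two_ne_zero]; positivity
    · have : √X ≤ A := by
        by_contra h4
        nlinarith
      calc X = √X ^ 2 := h1.symm
        _ ≤ A ^ 2 := by gcongr
  refine le_trans ?_ hXA
  rw [← integral_indicator measurableSet_ball]
  refine integral_mono_of_nonneg (Filter.Eventually.of_forall fun x =>
    indicator_nonneg (fun x _ => by positivity) x) iX (Filter.Eventually.of_forall fun x => ?_)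
  simp only
  by_cases hx : x ∈ Metric.ball c (l / 2)
  · rw [indicator_of_mem hx, η.one_of_mem_closedBall (Metric.ball_subset_closedBall hx)]
    simp
  · rw [indicator_of_notMem hx]
    positivity

end

/-! ### Oscillation estimates in `BMO` -/

section

open FourierTransform

variable {n : ℕ} {f : Rn n → ℂ}

lemma laverage_le_bmoSeminorm (f : Rn n → ℂ) (x : Rn n) {r : ℝ} (hr : 0 < r) :
    ⨍⁻ y in Metric.ball x r, ‖f y - ⨍ z in Metric.ball x r, f z‖ₑ ∂volume ≤ bmoSeminorm f :=
  le_iSup_of_le x (le_iSup_of_le r (le_iSup_of_le hr le_rfl))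

lemma volume_ball_Rn (x : Rn n) {r : ℝ} (hr : 0 < r) :
    volume (Metric.ball x r) = ENNReal.ofReal (r ^ n) * volume (Metric.ball (0 : Rn n) 1) := by
  rw [Measure.addHaar_ball_of_pos _ _ hr, finrank_euclideanSpace_fin]

lemma enorm_setAverage_sub_le (hf : LocallyIntegrable f) (x : Rn n) {r : ℝ} (hr : 0 < r) (a : ℂ) :
    ‖(⨍ z in Metric.ball x r, f z) - a‖ₑ ≤ ⨍⁻ y in Metric.ball x r, ‖f y - a‖ₑ ∂volume := by
  have hne : NeZero (volume.restrict (Metric.ball x r)) := ⟨by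
    rw [Ne, Measure.restrict_eq_zero]; exact (Metric.measure_ball_pos _ _ hr).ne'⟩
  have hfin : IsFiniteMeasure (volume.restrict (Metric.ball x r)) :=
    ⟨by simpa using measure_ball_lt_top⟩
  have hi : Integrable f (volume.restrict (Metric.ball x r)) :=
    (hf.integrableOn_isCompact (isCompact_closedBall x r)).mono_set Metric.ball_subset_closedBall
  have h1 : (⨍ z in Metric.ball x r, f z) - a = ⨍ z in Metric.ball x r, (f z - a) := by
    have h2 := average_const (volume.restrict (Metric.ball x r)) a
    simp only [average] at h2 ⊢
    rw [integral_sub hi.to_average (integrable_const a), h2]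
  rw [h1]
  exact enorm_integral_le_lintegral_enorm _

lemma laverage_ball_le_two_pow_mul (x : Rn n) {r : ℝ} (hr : 0 < r) (g : Rn n → ℝ≥0∞) :
    ⨍⁻ y in Metric.ball x r, g y ∂volume ≤ 2 ^ n * ⨍⁻ y in Metric.ball x (2 * r), g y ∂volume := by
  rw [setLAverage_eq, setLAverage_eq, volume_ball_Rn x hr, volume_ball_Rn x (by positivity : 0 < 2 * r),
    mul_pow, ENNReal.ofReal_mul (by positivity), mul_assoc]
  set v := ENNReal.ofReal (r ^ n) * volume (Metric.ball (0 : Rn n) 1)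
  have h2 : ENNReal.ofReal (2 ^ n) = 2 ^ n := by
    rw [ENNReal.ofReal_pow (by norm_num), ENNReal.ofReal_ofNat]
  rw [h2, div_eq_mul_inv, div_eq_mul_inv, ENNReal.mul_inv (a := 2 ^ n) (b := v)
    (Or.inl (by positivity)) (Or.inl (by simp))]
  calc _ ≤ (∫⁻ y in Metric.ball x (2 * r), g y) * v⁻¹ := by
        gcongr
        linarith
    _ = (2 ^ n * (2 ^ n)⁻¹) * ((∫⁻ y in Metric.ball x (2 * r), g y) * v⁻¹) := by
        rw [ENNReal.mul_inv_cancel (by positivity) (by simp), one_mul]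
    _ = _ := by ring

/-- Telescoping over doublings: each changes the average by at most `2 ^ n` times the seminorm, the
ratio of the volumes. The growth is only linear in `j`, which a geometric factor can absorb. -/
lemma enorm_setAverage_dyadic_sub_le (hf : LocallyIntegrable f) (x : Rn n) {r : ℝ} (hr : 0 < r)
    (j : ℕ) : ‖(⨍ z in Metric.ball x (2 ^ j * r), f z) - ⨍ z in Metric.ball x r, f z‖ₑ ≤
      j * 2 ^ n * bmoSeminorm f := by
  induction j with
  | zero => simp
  | succ j ih =>
    have h1 : ‖(⨍ z in Metric.ball x (2 ^ j * r), f z) -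
        ⨍ z in Metric.ball x (2 ^ (j + 1) * r), f z‖ₑ ≤ 2 ^ n * bmoSeminorm f := by
      refine (enorm_setAverage_sub_le hf x (by positivity) _).trans
        ((laverage_ball_le_two_pow_mul x (by positivity) _).trans ?_)
      rw [← mul_assoc, ← pow_succ']
      gcongr
      exact laverage_le_bmoSeminorm f x (by positivity)
    calc _ ≤ ‖(⨍ z in Metric.ball x (2 ^ (j + 1) * r), f z) -
          ⨍ z in Metric.ball x (2 ^ j * r), f z‖ₑ + _ := by
          rw [← sub_add_sub_cancel _ (⨍ z in Metric.ball x (2 ^ j * r), f z)]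
          exact enorm_add_le _ _
      _ ≤ 2 ^ n * bmoSeminorm f + j * 2 ^ n * bmoSeminorm f := by
          gcongr
          rwa [← enorm_neg, neg_sub]
      _ = _ := by push_cast; ring

lemma setLIntegral_dyadic_ball_le (hf : LocallyIntegrable f) (x : Rn n) {r : ℝ} (hr : 0 < r)
    (j : ℕ) : ∫⁻ y in Metric.ball x (2 ^ j * r), ‖f y - ⨍ z in Metric.ball x r, f z‖ₑ ≤
      volume (Metric.ball x (2 ^ j * r)) * ((1 + j * 2 ^ n) * bmoSeminorm f) := by
  set a := ⨍ z in Metric.ball x r, f z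
  set b := ⨍ z in Metric.ball x (2 ^ j * r), f z
  calc _ ≤ ∫⁻ y in Metric.ball x (2 ^ j * r), (‖f y - b‖ₑ + ‖b - a‖ₑ) := by
        refine lintegral_mono fun y => ?_
        rw [← sub_add_sub_cancel _ b]
        exact enorm_add_le _ _
    _ = volume (Metric.ball x (2 ^ j * r)) * (⨍⁻ y in Metric.ball x (2 ^ j * r), ‖f y - b‖ₑ ∂volume) +
          ‖b - a‖ₑ * volume (Metric.ball x (2 ^ j * r)) := by
        rw [lintegral_add_right _ measurable_const, setLIntegral_const,
          measure_mul_setLAverage _ measure_ball_lt_top.ne]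
    _ ≤ volume (Metric.ball x (2 ^ j * r)) * bmoSeminorm f +
          (j * 2 ^ n * bmoSeminorm f) * volume (Metric.ball x (2 ^ j * r)) := by
        gcongr
        · exact laverage_le_bmoSeminorm f x (by positivity)
        · exact enorm_setAverage_dyadic_sub_le hf x hr j
    _ = _ := by ring

lemma exists_polyWeight_le_dyadic (y : Rn n) : ∃ j : ℕ, ‖y‖ < 2 ^ j ∧
    polyWeight n y ≤ 2 ^ (n + 1) * ((2 : ℝ) ^ (j * (n + 1)))⁻¹ := by
  have hex : ∃ j : ℕ, ‖y‖ < 2 ^ j := pow_unbounded_of_one_lt _ (by norm_num)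
  classical
  refine ⟨Nat.find hex, Nat.find_spec hex, ?_⟩
  unfold polyWeight
  rcases hj : Nat.find hex with _ | j
  · simp only [zero_mul, pow_zero, inv_one, mul_one]
    calc ((1 + ‖y‖) ^ (n + 1))⁻¹ ≤ 1 := inv_le_one_of_one_le₀ (one_le_pow₀ (by simp))
      _ ≤ _ := one_le_pow₀ (by norm_num)
  · have h1 : (2 : ℝ) ^ j ≤ ‖y‖ := not_lt.1 (Nat.find_min hex (by omega))
    rw [← div_eq_mul_inv, inv_eq_one_div, div_le_div_iff₀ (by positivity) (by positivity), one_mul,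
      pow_mul, ← mul_pow]
    gcongr
    rw [pow_succ]
    linarith

/-- The global oscillation estimate for functions of bounded mean oscillation. -/
lemma exists_lintegral_oscillation_le (n : ℕ) : ∃ C : ℝ, 0 < C ∧
    ∀ (f : Rn n → ℂ) (x : Rn n) (r : ℝ), LocallyIntegrable f → 0 < r →
      ∫⁻ y, ENNReal.ofReal (polyWeight n (r⁻¹ • (y - x))) *
        ‖f y - ⨍ z in Metric.ball x r, f z‖ₑ ≤ ENNReal.ofReal (C * r ^ n) * bmoSeminorm f := by
  -- On the `j`-th dyadic ball the weight is `2^(-j(n+1))`, the volume `2^(jn)` and the mean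
  -- oscillation `1 + j 2^n`, up to constants and scaling; the product is the summand.
  have hsum : Summable fun j : ℕ => (1 / 2 : ℝ) ^ j * (1 + j * 2 ^ n) := by
    have h1 : Summable fun j : ℕ => (1 / 2 : ℝ) ^ j := summable_geometric_of_lt_one (by norm_num) (by norm_num)
    have h2 : Summable fun j : ℕ => (j : ℝ) ^ 1 * (1 / 2 : ℝ) ^ j :=
      summable_pow_mul_geometric_of_norm_lt_one 1 (by norm_num)
    refine (h1.add (h2.mul_right (2 ^ n))).congr fun j => ?_
    ring
  set M := ∑' j : ℕ, (1 / 2 : ℝ) ^ j * (1 + j * 2 ^ n)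
  have hM : 0 ≤ M := tsum_nonneg fun j => by positivity
  set v := volume.real (Metric.ball (0 : Rn n) 1)
  have hv0 : 0 ≤ v := measureReal_nonneg
  have hv : volume (Metric.ball (0 : Rn n) 1) = ENNReal.ofReal v :=
    (ENNReal.ofReal_toReal measure_ball_lt_top.ne).symm
  refine ⟨2 ^ (n + 1) * v * M + 1, by positivity, fun f x r hf hr => ?_⟩
  set a := ⨍ z in Metric.ball x r, f z
  have hpt : ∀ y, ENNReal.ofReal (polyWeight n (r⁻¹ • (y - x))) * ‖f y - a‖ₑ ≤
      ∑' j : ℕ, ENNReal.ofReal (2 ^ (n + 1) * ((2 : ℝ) ^ (j * (n + 1)))⁻¹) *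
        (Metric.ball x (2 ^ j * r)).indicator (fun y => ‖f y - a‖ₑ) y := by
    intro y
    obtain ⟨j, hj1, hj2⟩ := exists_polyWeight_le_dyadic (r⁻¹ • (y - x))
    refine le_trans ?_ (ENNReal.le_tsum j)
    have : y ∈ Metric.ball x (2 ^ j * r) := by
      rw [norm_smul, norm_inv, Real.norm_of_nonneg hr.le, inv_mul_lt_iff₀ hr, mul_comm] at hj1
      rwa [Metric.mem_ball, dist_eq_norm]
    rw [indicator_of_mem this]
    gcongr
  have hfm : AEMeasurable fun y => ‖f y - a‖ₑ :=
    (hf.aestronglyMeasurable.sub aestronglyMeasurable_const).enorm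
  refine (lintegral_mono hpt).trans ?_
  rw [lintegral_tsum fun j => (hfm.indicator measurableSet_ball).const_mul _]
  have hterm : ∀ j : ℕ, ∫⁻ y, ENNReal.ofReal (2 ^ (n + 1) * ((2 : ℝ) ^ (j * (n + 1)))⁻¹) *
        (Metric.ball x (2 ^ j * r)).indicator (fun y => ‖f y - a‖ₑ) y ≤
      ENNReal.ofReal (2 ^ (n + 1) * v * r ^ n) * bmoSeminorm f *
        ENNReal.ofReal ((1 / 2 : ℝ) ^ j * (1 + j * 2 ^ n)) := by
    intro j
    rw [lintegral_const_mul' _ _ ENNReal.ofReal_ne_top, lintegral_indicator measurableSet_ball]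
    have hc : (1 + j * 2 ^ n : ℝ≥0∞) = ENNReal.ofReal (1 + j * 2 ^ n) := by
      rw [ENNReal.ofReal_add (by norm_num) (by positivity), ENNReal.ofReal_mul (by positivity),
        ENNReal.ofReal_pow (by norm_num)]
      simp
    calc _ ≤ ENNReal.ofReal (2 ^ (n + 1) * ((2 : ℝ) ^ (j * (n + 1)))⁻¹) *
          (volume (Metric.ball x (2 ^ j * r)) * ((1 + j * 2 ^ n) * bmoSeminorm f)) := by
          gcongr
          exact setLIntegral_dyadic_ball_le hf x hr j
      _ = ENNReal.ofReal (2 ^ (n + 1) * ((2 : ℝ) ^ (j * (n + 1)))⁻¹ * ((2 ^ j * r) ^ n * v *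
            (1 + j * 2 ^ n))) * bmoSeminorm f := by
          rw [volume_ball_Rn x (by positivity), hv, hc, ← ENNReal.ofReal_mul (by positivity),
            ← mul_assoc (ENNReal.ofReal ((2 ^ j * r) ^ n * v)), ← ENNReal.ofReal_mul (by positivity),
            ← mul_assoc, ← ENNReal.ofReal_mul (by positivity)]
      _ = _ := by
          rw [mul_right_comm _ (bmoSeminorm f), ← ENNReal.ofReal_mul (by positivity)]
          congr 2
          rw [mul_pow, ← pow_mul, one_div, inv_pow]
          have : (2 : ℝ) ^ (j * (n + 1)) = 2 ^ (j * n) * 2 ^ j := by rw [← pow_add]; ring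
          rw [this]
          field_simp
  refine (ENNReal.tsum_le_tsum hterm).trans ?_
  rw [ENNReal.tsum_mul_left, ← ENNReal.ofReal_tsum_of_nonneg (fun j => by positivity) hsum,
    mul_right_comm, ← ENNReal.ofReal_mul (by positivity)]
  refine mul_le_mul' (ENNReal.ofReal_le_ofReal ?_) le_rfl
  have : 0 ≤ r ^ n := by positivity
  change 2 ^ (n + 1) * v * r ^ n * M ≤ _
  nlinarith

lemma hasModerateGrowth_of_bmoSeminorm_ne_top (hf : LocallyIntegrable f) (hb : bmoSeminorm f ≠ ⊤) :
    HasModerateGrowth f := by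
  obtain ⟨C, -, h⟩ := exists_lintegral_oscillation_le n
  have h1 := h f 0 1 hf one_pos
  set a := ⨍ z in Metric.ball (0 : Rn n) 1, f z
  have h2 : Integrable fun y => polyWeight n y • (f y - a) := by
    refine ⟨continuous_polyWeight.aestronglyMeasurable.smul
      (hf.aestronglyMeasurable.sub aestronglyMeasurable_const), ?_⟩
    refine lt_of_le_of_lt ?_ (ENNReal.mul_lt_top (a := ENNReal.ofReal (C * 1 ^ n))
      ENNReal.ofReal_lt_top (lt_top_iff_ne_top.2 hb))
    refine le_trans (lintegral_mono fun y => ?_) h1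
    rw [enorm_smul, inv_one, one_smul, sub_zero, ← ofReal_norm (polyWeight n y),
      Real.norm_of_nonneg (polyWeight_pos y).le]
  refine (h2.add (integrable_polyWeight.smul_const a)).congr (Filter.Eventually.of_forall fun y => ?_)
  simp only [Pi.add_apply]
  rw [← smul_add, sub_add_cancel]

end

/-! ### Oscillating multipliers on `BMO` -/

section

open FourierTransform

variable {n : ℕ}

lemma exists_annularSymbol_eq_one (n : ℕ) {c : ℝ} (hc : 0 < c) (c' : ℝ) :
    ∃ (b' : ℝ) (th : Rn n → ℂ), IsAnnularSymbol (c / 2) b' th ∧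
      ∀ η, c ≤ ‖η‖ → ‖η‖ ≤ c' → th η = 1 := by
  let b₁ : ContDiffBump (0 : Rn n) :=
    ⟨max c' c, max c' c + 1, lt_of_lt_of_le hc (le_max_right _ _), by linarith⟩
  let b₂ : ContDiffBump (0 : Rn n) := ⟨c / 2, c, by positivity, by linarith⟩
  refine ⟨max c' c + 1, fun η => ((b₁ η - b₂ η : ℝ) : ℂ), ⟨?_, fun η hη => ?_, fun η hη => ?_⟩,
    fun η h1 h2 => ?_⟩
  · exact Complex.ofRealCLM.contDiff.comp (b₁.contDiff.sub b₂.contDiff)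
  · rw [b₁.one_of_mem_closedBall, b₂.one_of_mem_closedBall, sub_self, Complex.ofReal_zero]
    · simpa [b₂] using hη.le
    · have := le_max_right c' c
      simp only [b₁, Metric.mem_closedBall, dist_zero_right]
      linarith
  · rw [b₁.zero_of_le_dist, b₂.zero_of_le_dist, sub_self, Complex.ofReal_zero]
    · have := le_max_right c' c
      simp only [b₂, dist_zero_right]
      linarith
    · simpa [b₁] using hη.le
  · simp only
    rw [b₁.one_of_mem_closedBall, b₂.zero_of_le_dist, sub_zero, Complex.ofReal_one]
    · simpa [b₂] using h1
    · simpa [b₁] using Or.inl h2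

lemma fourier_comp_inv_smul (th : Rn n → ℂ) {lam : ℝ} (hlam : 0 < lam) (y : Rn n) :
    𝓕 (fun ξ => th (lam⁻¹ • ξ)) y = (lam ^ n : ℝ) * 𝓕 th (lam • y) := by
  rw [Real.fourier_eq, Real.fourier_eq]
  have h := Measure.integral_comp_smul volume
    (fun ξ : Rn n => Real.fourierChar (-⟪ξ, lam • y⟫_ℝ) • th ξ) lam⁻¹
  rw [finrank_euclideanSpace_fin, abs_of_pos (by positivity), inv_pow, inv_inv,
    Complex.real_smul] at h
  rw [← h]
  refine integral_congr_ae (Filter.Eventually.of_forall fun ξ => ?_)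
  simp only [inner_smul_left, inner_smul_right, RCLike.conj_to_real]
  congr 3
  field_simp

lemma integral_fourier_eq_apply_zero (τ : 𝓢(Rn n, ℂ)) : ∫ y, 𝓕 τ y = τ 0 := by
  have h : (𝓕⁻ (𝓕 τ)) 0 = τ 0 := by rw [FourierTransform.fourierInv_fourier_eq]
  rw [← h, SchwartzMap.fourierInv_coe, Real.fourierInv_eq]
  simp

/-- The kernel is an `L¹`-normalised dilate at scale `lam⁻¹`, with integral `th 0 = 0`. Hence the
mean of `f` over the ball of radius `lam⁻¹` can be subtracted, and the global oscillation estimate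
applies at that radius. -/
lemma exists_norm_integral_kernel_le {c c' : ℝ} {th : Rn n → ℂ} (hth : IsAnnularSymbol c c' th)
    (hc : 0 < c) : ∃ C : ℝ, 0 < C ∧
    ∀ (lam : ℝ) (τ : 𝓢(Rn n, ℂ)) (f : Rn n → ℂ) (x : Rn n), 0 < lam →
      (∀ ξ, τ ξ = th (lam⁻¹ • ξ)) → LocallyIntegrable f → bmoSeminorm f ≠ ⊤ →
      ‖∫ y, 𝓕 τ (y - x) * f y‖ ≤ C * (bmoSeminorm f).toReal := by
  obtain ⟨C₁, hC₁, h1⟩ := exists_lintegral_oscillation_le n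
  set T : 𝓢(Rn n, ℂ) := hth.hasCompactSupport.toSchwartzMap hth.smooth
  have hT : (T : Rn n → ℂ) = th := rfl
  obtain ⟨C₂, hC₂, h2⟩ := (𝓕 T).exists_norm_le_polyWeight
  refine ⟨C₂ * C₁ + 1, by positivity, fun lam τ f x hlam hτ hf hb => ?_⟩
  have hτ' : (τ : Rn n → ℂ) = fun ξ => th (lam⁻¹ • ξ) := funext hτ
  have hmod := hasModerateGrowth_of_bmoSeminorm_ne_top hf hb
  set a := ⨍ z in Metric.ball x lam⁻¹, f z
  have hk : ∀ y, ‖𝓕 τ y‖ ≤ lam ^ n * (C₂ * polyWeight n (lam • y)) := fun y => by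
    rw [SchwartzMap.fourier_coe, hτ', fourier_comp_inv_smul th hlam, norm_mul, Complex.norm_real,
      Real.norm_of_nonneg (by positivity)]
    gcongr
    exact h2 (lam • y)
  have i1 : Integrable fun y => 𝓕 τ (y - x) * f y := by
    have := hmod.integrable_schwartz_mul (SchwartzMap.compSubConstCLM ℂ x (𝓕 τ))
    simpa using this
  have i2 : Integrable fun y => 𝓕 τ (y - x) * a :=
    ((𝓕 τ).integrable.comp_sub_right x).mul_const a
  have h0 : ∫ y, 𝓕 τ (y - x) * a = 0 := by
    rw [integral_mul_const, integral_sub_right_eq_self (fun y => 𝓕 τ y) x,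
      integral_fourier_eq_apply_zero, hτ, smul_zero, hth.lower 0 (by simpa using hc), zero_mul]
  have h3 : ∫ y, 𝓕 τ (y - x) * f y = ∫ y, 𝓕 τ (y - x) * (f y - a) := by
    simp only [mul_sub]
    rw [integral_sub i1 i2, h0, sub_zero]
  have h4 : ‖∫ y, 𝓕 τ (y - x) * f y‖ₑ ≤
      ENNReal.ofReal ((C₂ * C₁ + 1) * (bmoSeminorm f).toReal) := by
    rw [h3]
    calc _ ≤ ∫⁻ y, ‖𝓕 τ (y - x) * (f y - a)‖ₑ := enorm_integral_le_lintegral_enorm _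
      _ ≤ ∫⁻ y, ENNReal.ofReal (lam ^ n * C₂) *
            (ENNReal.ofReal (polyWeight n ((lam⁻¹)⁻¹ • (y - x))) * ‖f y - a‖ₑ) := by
          refine lintegral_mono fun y => ?_
          rw [enorm_mul, ← mul_assoc, ← ENNReal.ofReal_mul (by positivity), inv_inv, mul_assoc,
            ← ofReal_norm]
          gcongr
          exact hk _
      _ = ENNReal.ofReal (lam ^ n * C₂) * ∫⁻ y,
            (ENNReal.ofReal (polyWeight n ((lam⁻¹)⁻¹ • (y - x))) * ‖f y - a‖ₑ) :=
          lintegral_const_mul' _ _ ENNReal.ofReal_ne_top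
      _ ≤ ENNReal.ofReal (lam ^ n * C₂) * (ENNReal.ofReal (C₁ * lam⁻¹ ^ n) * bmoSeminorm f) := by
          gcongr
          exact h1 f x lam⁻¹ hf (by positivity)
      _ = ENNReal.ofReal (C₂ * C₁) * ENNReal.ofReal (bmoSeminorm f).toReal := by
          rw [← mul_assoc, ← ENNReal.ofReal_mul (by positivity), ENNReal.ofReal_toReal hb]
          congr 2
          rw [inv_pow]
          field_simp
      _ ≤ _ := by
          rw [← ENNReal.ofReal_mul (by positivity)]
          refine ENNReal.ofReal_le_ofReal ?_
          gcongr
          linarith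
  rwa [← ofReal_norm, ENNReal.ofReal_le_ofReal_iff (by positivity)] at h4

lemma fourierInv_compSubConst (G : 𝓢(Rn n, ℂ)) (x ξ : Rn n) :
    (𝓕⁻ G) ξ = Complex.exp (Complex.I * ((2 * Real.pi * ⟪x, ξ⟫_ℝ : ℝ) : ℂ)) *
      (𝓕⁻ (SchwartzMap.compSubConstCLM ℂ (-x) G)) ξ := by
  rw [SchwartzMap.fourierInv_coe, SchwartzMap.fourierInv_coe, Real.fourierInv_eq', Real.fourierInv_eq',
    ← integral_const_mul,
    ← integral_add_right_eq_self (fun y : Rn n =>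
      Complex.exp ((2 * Real.pi * ⟪y, ξ⟫_ℝ : ℝ) * Complex.I) • G y) x]
  refine integral_congr_ae (Filter.Eventually.of_forall fun y => ?_)
  simp only [smul_eq_mul, SchwartzMap.compSubConstCLM_apply, sub_neg_eq_add]
  rw [← mul_assoc, ← Complex.exp_add]
  congr 2
  rw [inner_add_left]
  push_cast
  ring

/-- The local `L²` bound for an oscillating multiplier acting on functions of bounded mean
oscillation. -/
theorem exists_setIntegral_norm_sq_kernel_le (hn : 0 < n) {Φ : Rn n → ℝ} {a : Rn n → ℂ} {c c' : ℝ}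
    (hΦ : IsSmoothHomogeneous 1 Φ) (ha : IsAnnularSymbol c c' a) (hc : 0 < c) :
    ∃ C : ℝ, 0 < C ∧
    ∀ (lam l : ℝ) (w x₀ : Rn n) (τ : 𝓢(Rn n, ℂ)) (f : Rn n → ℂ), 0 < lam → lam⁻¹ ≤ l → l ≤ 1 / 4 →
      (∀ ξ, τ ξ = oscSymbol Φ a lam w ξ) → LocallyIntegrable f → bmoSeminorm f ≠ ⊤ →
      ∫ x in Metric.ball x₀ (l / 2), ‖∫ y, 𝓕 τ (y - x) * f y‖ ^ 2 ≤
        (C * (bmoSeminorm f).toReal) ^ 2 * l := by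
  obtain ⟨b', th, hth, hth1⟩ := exists_annularSymbol_eq_one n hc c'
  obtain ⟨C₁, hC₁, h1⟩ := exists_norm_integral_kernel_le hth (by positivity)
  obtain ⟨C₂, hC₂, h2⟩ := exists_integral_fourier_oscSymbol_le hn hΦ ha hc
  refine ⟨C₁ * C₂, by positivity, fun lam l w x₀ τ f hlam hl hl4 hτ hf hb => ?_⟩
  have hl0 : 0 < l := lt_of_lt_of_le (by positivity) hl
  set S := (bmoSeminorm f).toReal
  set ε := √l
  have hε : 0 < ε := Real.sqrt_pos.2 hl0
  have hεl : ε ^ 2 = l := Real.sq_sqrt hl0.le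
  have hε2 : ε ≤ 1 / 2 := by
    rw [show (1 / 2 : ℝ) = √(1 / 4) by
      rw [show (1 / 4 : ℝ) = (1 / 2) ^ 2 by norm_num, Real.sqrt_sq (by norm_num)]]
    exact Real.sqrt_le_sqrt hl4
  have hmod := hasModerateGrowth_of_bmoSeminorm_ne_top hf hb
  have hA : (C₁ * C₂ * S) ^ 2 * l = (C₁ * S * (C₂ * ε)) ^ 2 := by
    rw [← hεl]; ring
  rw [hA]
  refine setIntegral_norm_sq_le_of_forall_schwartz (hmod.continuous_integral_kernel (𝓕 τ)) hl0
    fun G g hG hg hGg => ?_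
  rw [← hmod.integral_fourier_smulLeft_mul τ G]
  set h : 𝓢(Rn n, ℂ) := SchwartzMap.smulLeftCLM ℂ (τ : Rn n → ℂ) (𝓕⁻ G)
  have hh : ∀ ξ, h ξ = τ ξ * (𝓕⁻ G) ξ := fun ξ =>
    SchwartzMap.smulLeftCLM_apply_apply τ.hasTemperateGrowth _ _
  have hths : ContDiff ℝ ∞ fun ξ => th (lam⁻¹ • ξ) := contDiff_radial hth lam
  have hthc : HasCompactSupport fun ξ => th (lam⁻¹ • ξ) :=
    hth.hasCompactSupport.comp_smul (by positivity)
  set t : 𝓢(Rn n, ℂ) := hthc.toSchwartzMap hths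
  have ht : ∀ ξ, t ξ = th (lam⁻¹ • ξ) := fun ξ => rfl
  -- The cut-off equals one on the annulus carrying `h`, so it can be inserted for free. Transposing
  -- it puts it on `f`, and only the `L¹` norm of `𝓕 h` has to be controlled.
  have hth_h : SchwartzMap.smulLeftCLM ℂ (t : Rn n → ℂ) (𝓕⁻ (𝓕 h)) = h := by
    ext ξ
    rw [FourierTransform.fourierInv_fourier_eq,
      SchwartzMap.smulLeftCLM_apply_apply t.hasTemperateGrowth, ht, smul_eq_mul]
    by_cases h3 : c ≤ ‖lam⁻¹ • ξ‖ ∧ ‖lam⁻¹ • ξ‖ ≤ c'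
    · rw [hth1 _ h3.1 h3.2, one_mul]
    · have : h ξ = 0 := by
        rw [hh, hτ, oscSymbol]
        rcases not_and_or.1 h3 with h4 | h4
        · rw [ha.lower _ (not_le.1 h4)]; simp
        · rw [ha.upper _ (not_le.1 h4)]; simp
      rw [this, mul_zero]
  have h5 := hmod.integral_fourier_smulLeft_mul t (𝓕 h)
  rw [hth_h] at h5
  rw [h5]
  have h6 : ‖∫ x, (𝓕 h) x * ∫ y, 𝓕 t (y - x) * f y‖ ≤ ∫ x, ‖(𝓕 h) x‖ * (C₁ * S) := by
    refine norm_integral_le_of_norm_le ((SchwartzMap.integrable _).norm.mul_const _)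
      (Filter.Eventually.of_forall fun x => ?_)
    rw [norm_mul]
    gcongr
    exact h1 lam t f x hlam ht hf hb
  refine h6.trans ?_
  rw [integral_mul_const]
  set G' := SchwartzMap.compSubConstCLM ℂ (-x₀) G
  have hG' : ∀ x, G' x = G (x + x₀) := fun x => by simp [G']
  -- Recentring the support of `G` from `x₀` to the origin multiplies `𝓕⁻ G` by a linear
  -- exponential, which `w` absorbs; the `L¹` estimate is uniform in `w`.
  have h7 : h = SchwartzMap.smulLeftCLM ℂ (oscSymbol Φ a lam (w + (2 * Real.pi) • x₀)) (𝓕⁻ G') := by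
    ext ξ
    rw [hh, SchwartzMap.smulLeftCLM_apply_apply (hasTemperateGrowth_oscSymbol hΦ ha hc hlam), hτ,
      fourierInv_compSubConst G x₀ ξ, smul_eq_mul, oscSymbol, oscSymbol, inner_add_left,
      inner_smul_left]
    have : Complex.exp (Complex.I * ((Φ ξ + (⟪w, ξ⟫_ℝ + (starRingEnd ℝ) (2 * Real.pi) * ⟪x₀, ξ⟫_ℝ) : ℝ) : ℂ)) =
        Complex.exp (Complex.I * ((Φ ξ + ⟪w, ξ⟫_ℝ : ℝ) : ℂ)) *
          Complex.exp (Complex.I * ((2 * Real.pi * ⟪x₀, ξ⟫_ℝ : ℝ) : ℂ)) := by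
      rw [← Complex.exp_add, RCLike.conj_to_real]
      congr 1
      push_cast
      ring
    rw [this]
    ring
  have h8 := h2 lam ε g (w + (2 * Real.pi) • x₀) G' hlam hε hε2 (hεl.symm ▸ hl) hg
    (fun x hx => by
      rw [hG']
      refine hG _ ?_
      rwa [add_sub_cancel_right, ← hεl])
    (by
      simp only [hG']
      rw [integral_add_right_eq_self (fun x => ‖G x‖ ^ 2) x₀]
      exact hGg)
  rw [← h7] at h8
  calc (∫ x, ‖(𝓕 h) x‖) * (C₁ * S) ≤ (C₂ * (ε * g)) * (C₁ * S) := by gcongr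
    _ = _ := by ring

end

/-! ### Symbols of the frequency blocks -/

section

open FourierTransform

variable {n : ℕ} {ϑ : Rn n → ℝ}

/-- The annular cut-off `√(ϑ(Aξ)² - ϑ(Bξ)²)`. -/
def annularRoot (ϑ : Rn n → ℝ) (A B : ℝ) (ξ : Rn n) : ℝ := √(ϑ (A • ξ) ^ 2 - ϑ (B • ξ) ^ 2)

/-- Either `ϑ(Bξ) = 0`, or `‖Bξ‖ < 2` and then `ϑ(Aξ) = 1` because `2A ≤ B`. The product form shows
the root to be smooth. -/
lemma annularRoot_eq_mul (hϑ : IsRadialCutoff ϑ) {A B : ℝ} (hA : 0 < A) (hAB : 2 * A ≤ B)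
    (ξ : Rn n) : annularRoot ϑ A B ξ = ϑ (A • ξ) * √(1 - ϑ (B • ξ) ^ 2) := by
  have hB : 0 < B := by linarith
  unfold annularRoot
  rcases le_or_gt 2 ‖B • ξ‖ with h | h
  · rw [hϑ.eq_zero _ h]
    simp [Real.sqrt_sq (hϑ.nonneg _)]
  · have : ‖A • ξ‖ ≤ 1 := by
      rw [norm_smul, Real.norm_of_nonneg hB.le] at h
      rw [norm_smul, Real.norm_of_nonneg hA.le]
      nlinarith [norm_nonneg ξ]
    rw [hϑ.eq_one _ this]
    simp

lemma isAnnularSymbol_annularRoot (hϑ : IsRadialCutoff ϑ) {A B : ℝ} (hA : 0 < A) (hAB : 2 * A ≤ B) :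
    IsAnnularSymbol B⁻¹ (2 / A) fun ξ => (annularRoot ϑ A B ξ : ℂ) := by
  have hB : 0 < B := by linarith
  refine ⟨?_, fun η hη => ?_, fun η hη => ?_⟩
  · have h : annularRoot ϑ A B = fun ξ => ϑ (A • ξ) * √(1 - ϑ (B • ξ) ^ 2) :=
      funext (annularRoot_eq_mul hϑ hA hAB)
    rw [h]
    exact Complex.ofRealCLM.contDiff.comp ((hϑ.smooth.comp (contDiff_const_smul A)).mul
      (hϑ.smooth_sqrt.comp (contDiff_const_smul B)))
  · have h1 : ‖B • η‖ ≤ 1 := by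
      rw [norm_smul, Real.norm_of_nonneg hB.le, ← le_inv_mul_iff₀ hB, mul_one]
      exact hη.le
    have h2 : ‖A • η‖ ≤ 1 := by
      rw [norm_smul, Real.norm_of_nonneg hB.le] at h1
      rw [norm_smul, Real.norm_of_nonneg hA.le]
      nlinarith [norm_nonneg η]
    simp [annularRoot, hϑ.eq_one _ h1, hϑ.eq_one _ h2]
  · have h1 : 2 ≤ ‖A • η‖ := by
      rw [norm_smul, Real.norm_of_nonneg hA.le]
      rw [div_lt_iff₀ hA] at hη
      linarith
    rw [annularRoot_eq_mul hϑ hA hAB, hϑ.eq_zero _ h1]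
    simp


lemma IsAnnularSymbol.mul_contDiffOn {c c' : ℝ} {a : Rn n → ℂ} (ha : IsAnnularSymbol c c' a)
    (hc : 0 < c) {g : Rn n → ℝ} (hg : ContDiffOn ℝ ∞ g {0}ᶜ) :
    IsAnnularSymbol c c' fun η => a η * (g η : ℂ) := by
  refine ⟨?_, fun η hη => by rw [ha.lower η hη, zero_mul], fun η hη => by
    rw [ha.upper η hη, zero_mul]⟩
  rw [contDiff_iff_contDiffAt]
  intro η
  by_cases h : ‖η‖ < c
  · refine (contDiffAt_const (c := (0 : ℂ))).congr_of_eventuallyEq ?_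
    filter_upwards [continuous_norm.continuousAt.eventually (gt_mem_nhds h)] with x hx
    rw [ha.lower x hx, zero_mul]
  · have hη : η ≠ 0 := by
      rintro rfl; exact h (by rwa [norm_zero])
    exact ha.smooth.contDiffAt.mul (Complex.ofRealCLM.contDiff.contDiffAt.comp η
      (hg.contDiffAt (isOpen_compl_singleton.mem_nhds hη)))

lemma IsAnnularSymbol.comp_smul {c c' : ℝ} {a : Rn n → ℂ} (ha : IsAnnularSymbol c c' a) {t : ℝ}
    (ht : 0 < t) : IsAnnularSymbol (c / t) (c' / t) fun η => a (t • η) := by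
  refine ⟨ha.smooth.comp (contDiff_const_smul t), fun η hη => ha.lower _ ?_,
    fun η hη => ha.upper _ ?_⟩
  · rw [norm_smul, Real.norm_of_nonneg ht.le, mul_comm]
    rwa [lt_div_iff₀ ht] at hη
  · rw [norm_smul, Real.norm_of_nonneg ht.le, mul_comm]
    rwa [div_lt_iff₀ ht] at hη

/-- The common profile of the frequency localisations: the symbol of `Q_K^{u,j}` is
`blockProfile (2^(-K) ξ)` times the modulation. -/
def blockProfile (ϑ : Rn n → ℝ) (s : ℝ) (k₁ j : ℕ) (η : Rn n) : ℂ :=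
  if j = 1 then (annularRoot ϑ (2 ^ (-1 : ℤ)) (2 ^ (2 : ℤ)) η : ℂ) * (‖η‖ ^ s : ℝ)
  else (annularRoot ϑ (2 ^ (-(k₁ : ℤ) - 2)) (2 ^ (3 + (k₁ : ℤ))) η : ℂ)

lemma exists_isAnnularSymbol_blockProfile (hϑ : IsRadialCutoff ϑ) (s : ℝ) (k₁ j : ℕ) :
    ∃ c c' : ℝ, 0 < c ∧ IsAnnularSymbol c c' (blockProfile ϑ s k₁ j) := by
  unfold blockProfile
  by_cases hj : j = 1
  · simp only [hj, if_true]
    exact ⟨_, _, by positivity, (isAnnularSymbol_annularRoot hϑ (by positivity)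
      (by norm_num)).mul_contDiffOn (by positivity) (isSmoothHomogeneous_norm_rpow n s).smooth⟩
  · simp only [hj, if_false]
    refine ⟨_, _, by positivity, isAnnularSymbol_annularRoot hϑ (by positivity) ?_⟩
    rw [← zpow_one_add₀ (by norm_num)]
    exact zpow_le_zpow_right₀ (by norm_num) (by omega)

lemma opQ_eq_multiplier (ϑ : Rn n → ℝ) (s : ℝ) (k₁ j : ℕ) (u : Rn n) (K : ℤ) :
    opQ ϑ s k₁ j u K = multiplier fun ξ =>
      blockProfile ϑ s k₁ j ((2 : ℝ) ^ (-K) • ξ) * modulation u K ξ := by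
  have h2 : (2 : ℝ) ≠ 0 := by norm_num
  unfold opQ blockProfile
  by_cases hj : j = 1
  · simp only [hj, if_true, annularRoot, psi, smul_smul, ← zpow_add₀ h2, sub_eq_add_neg]
    congr 1
    ext ξ
    rw [mul_comm (‖_‖ ^ s), Complex.ofReal_mul]
  · simp only [hj, if_false, annularRoot, zeta, smul_smul, ← zpow_add₀ h2]
    congr 1
    ext ξ
    congr 7
    ring_nf

/-- The amplitude of the composition of the localisation at frequency `2^K` with the Fourier
integral operator, rescaled to unit frequency. -/
def blockAmplitude (ϑ : Rn n → ℝ) (s : ℝ) (k₁ j : ℕ) (χ₀ : Rn n → ℝ) (μ : ℝ) (lam : ℝ)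
    (η : Rn n) : ℂ :=
  blockProfile ϑ s k₁ j ((8 * Real.pi) • η) *
    ((‖(2 * Real.pi) • η‖ ^ μ * χ₀ ((2 * Real.pi * lam) • η) : ℝ) : ℂ)

section

variable {c c' : ℝ} {s : ℝ} {k₁ j : ℕ} {k₀ : ℤ} {χ₀ : Rn n → ℝ} {φ : Rn n → ℝ}

lemma isAnnularSymbol_blockAmplitude (hp : IsAnnularSymbol c c' (blockProfile ϑ s k₁ j)) (hc : 0 < c)
    (hχ₀ : IsHighFrequencyCutoff k₀ χ₀) (μ lam : ℝ) :
    IsAnnularSymbol (c / (8 * Real.pi)) (c' / (8 * Real.pi))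
      (blockAmplitude ϑ s k₁ j χ₀ μ lam) := by
  have hπ := Real.pi_pos
  refine (hp.comp_smul (by positivity : 0 < 8 * Real.pi)).mul_contDiffOn (by positivity) ?_
  refine ContDiffOn.mul ?_ (hχ₀.smooth.comp (contDiff_const_smul _)).contDiffOn
  refine (isSmoothHomogeneous_norm_rpow n μ).smooth.comp (contDiff_const_smul _).contDiffOn
    fun η hη => ?_
  simp only [mem_compl_iff, mem_singleton_iff, smul_eq_zero, not_or] at hη ⊢
  exact ⟨by positivity, hη⟩

/-- On the support of the profile `‖8πη‖ ≥ c`, so for large `lam` the argument of `χ₀` has left the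
transition region. Thus only finitely many different amplitudes occur for `lam = 4 * 2 ^ K`. -/
lemma blockAmplitude_eq_of_le (hp : IsAnnularSymbol c c' (blockProfile ϑ s k₁ j))
    (hχ₀ : IsHighFrequencyCutoff k₀ χ₀) (μ : ℝ) {lam lam' : ℝ} (hlam : 0 < lam)
    (h : 4 * 2 ^ (k₀ - 4) ≤ c * lam) (h' : lam ≤ lam') :
    blockAmplitude ϑ s k₁ j χ₀ μ lam' = blockAmplitude ϑ s k₁ j χ₀ μ lam := by
  have hπ := Real.pi_pos
  ext η
  unfold blockAmplitude
  by_cases hη : ‖(8 * Real.pi) • η‖ < c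
  · rw [hp.lower _ hη, zero_mul, zero_mul]
  · rw [norm_smul, Real.norm_of_nonneg (by positivity), not_lt] at hη
    have h1 : ∀ t, lam ≤ t → χ₀ ((2 * Real.pi * t) • η) = 1 := fun t ht => by
      have ht0 : 0 < t := hlam.trans_le ht
      refine hχ₀.eq_one _ ?_
      rw [norm_smul, Real.norm_of_nonneg (by positivity)]
      have h2 : c * lam ≤ (8 * Real.pi * ‖η‖) * t := by gcongr
      linarith
    rw [h1 _ h', h1 _ le_rfl]

/-- The symbol of the composition in Mathlib's normalisation of the Fourier transform. -/
lemma composite_symbol_eq (hφ : IsPhase φ) (u : Rn n) (K : ℕ) (μ : ℝ) (ξ : Rn n) :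
    (Complex.exp (Complex.I * (φ ((2 * Real.pi) • ξ) : ℂ)) * amplitude χ₀ μ ((2 * Real.pi) • ξ)) *
      (blockProfile ϑ s k₁ j ((2 : ℝ) ^ (-(K : ℤ)) • (2 * Real.pi) • ξ) *
        modulation u K ((2 * Real.pi) • ξ)) =
    (((4 * 2 ^ K : ℝ) ^ μ : ℝ) : ℂ) * oscSymbol (fun ξ => 2 * Real.pi * φ ξ)
      (blockAmplitude ϑ s k₁ j χ₀ μ (4 * 2 ^ K)) (4 * 2 ^ K)
      ((2 * Real.pi * 2 ^ (-(K : ℤ))) • u) ξ := by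
  have hπ := Real.pi_pos
  have hlam : (0 : ℝ) < 4 * 2 ^ K := by positivity
  set lam : ℝ := 4 * 2 ^ K
  -- Here `8π = 4 · 2π`: the `2π` converts to Mathlib's frequency variable, and the `4` is the one
  -- in `lam`, which ensures `lam⁻¹ ≤ 1/4` already at `K = 0`.
  have e1 : (8 * Real.pi) • lam⁻¹ • ξ = (2 : ℝ) ^ (-(K : ℤ)) • (2 * Real.pi) • ξ := by
    rw [smul_smul, smul_smul]
    congr 1
    simp only [lam, zpow_neg, zpow_natCast]
    field_simp
    norm_num
  have e2 : (2 * Real.pi * lam) • lam⁻¹ • ξ = (2 * Real.pi) • ξ := by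
    rw [smul_smul, mul_assoc, mul_inv_cancel₀ hlam.ne', mul_one]
  have e3 : ‖(2 * Real.pi) • ξ‖ ^ μ = lam ^ μ * ‖(2 * Real.pi) • lam⁻¹ • ξ‖ ^ μ := by
    rw [← Real.mul_rpow hlam.le (norm_nonneg _)]
    congr 1
    rw [smul_comm, norm_smul lam⁻¹, norm_inv, Real.norm_of_nonneg hlam.le, ← mul_assoc,
      mul_inv_cancel₀ hlam.ne', one_mul]
  have e4 : Complex.exp (Complex.I * ((2 * Real.pi * φ ξ +
        ⟪(2 * Real.pi * 2 ^ (-(K : ℤ))) • u, ξ⟫_ℝ : ℝ) : ℂ)) =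
      Complex.exp (Complex.I * (φ ((2 * Real.pi) • ξ) : ℂ)) * modulation u K ((2 * Real.pi) • ξ) := by
    rw [modulation, ← Complex.exp_add, hφ.homogeneous ξ _ (by positivity), ← mul_add,
      ← Complex.ofReal_add, real_inner_smul_left, real_inner_smul_left, real_inner_comm]
    congr 4
    ring
  rw [oscSymbol, blockAmplitude, e1, e2, e4, amplitude, e3]
  push_cast
  ring

end

end

/-! ### Uniform bounds for the frequency blocks -/

section

open FourierTransform

variable {n : ℕ} {ϑ : Rn n → ℝ} {s : ℝ} {k₁ j : ℕ} {k₀ : ℤ} {χ₀ : Rn n → ℝ} {φ : Rn n → ℝ}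

lemma IsPhase.const_mul (hφ : IsPhase φ) (t : ℝ) : IsPhase fun ξ => t * φ ξ :=
  ⟨contDiffOn_const.mul hφ.smooth, fun ξ r hr => by rw [hφ.homogeneous ξ r hr]; ring⟩

lemma hasTemperateGrowth_block_symbol (hϑ : IsRadialCutoff ϑ) (u : Rn n) (K : ℤ) :
    (fun ξ => blockProfile ϑ s k₁ j ((2 : ℝ) ^ (-K) • (2 * Real.pi) • ξ) *
      modulation u K ((2 * Real.pi) • ξ)).HasTemperateGrowth := by
  have hπ := Real.pi_pos
  obtain ⟨c, c', -, hp⟩ := exists_isAnnularSymbol_blockProfile hϑ s k₁ j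
  have h1 := (hp.comp_smul (by positivity : (0 : ℝ) < 2 ^ (-K))).comp_smul
    (by positivity : 0 < 2 * Real.pi)
  refine (h1.hasCompactSupport.mul_right).hasTemperateGrowth (h1.smooth.mul ?_)
  refine contDiff_cexp_I_mul.comp (contDiff_const.mul (ContDiff.inner ℝ ?_ contDiff_const))
  exact contDiff_const_smul _

lemma composite_apply (hϑ : IsRadialCutoff ϑ) (hφ : IsPhase φ) (hχ₀ : IsHighFrequencyCutoff k₀ χ₀)
    (u : Rn n) (K : ℕ) (μ : ℝ) (U : 𝓢'(Rn n, ℂ)) (G : 𝓢(Rn n, ℂ)) :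
    (opQ ϑ s k₁ j u (K : ℤ) ∘L fio φ (amplitude χ₀ μ)) U G =
      U (𝓕 (SchwartzMap.smulLeftCLM ℂ (fun ξ => (((4 * 2 ^ K : ℝ) ^ μ : ℝ) : ℂ) *
        oscSymbol (fun ξ => 2 * Real.pi * φ ξ) (blockAmplitude ϑ s k₁ j χ₀ μ (4 * 2 ^ K)) (4 * 2 ^ K)
        ((2 * Real.pi * 2 ^ (-(K : ℤ))) • u) ξ) (𝓕⁻ G))) := by
  have h1 : (fun ξ : Rn n => Complex.exp (Complex.I * (φ ((2 * Real.pi) • ξ) : ℂ)) *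
      amplitude χ₀ μ ((2 * Real.pi) • ξ)).HasTemperateGrowth :=
    (hasTemperateGrowth_fio_symbol hφ hχ₀ μ).comp
      ((2 * Real.pi) • ContinuousLinearMap.id ℝ (Rn n)).hasTemperateGrowth
  rw [ContinuousLinearMap.comp_apply, opQ_eq_multiplier, multiplier, fio, multiplier,
    TemperedDistribution.fourierMultiplierCLM_fourierMultiplierCLM_apply h1
      (hasTemperateGrowth_block_symbol hϑ u K),
    TemperedDistribution.fourierMultiplierCLM_apply_apply]
  congr 4
  ext ξ
  exact composite_symbol_eq hφ u K μ ξ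

lemma exists_forall_le_of_eventually_const {P : ℕ → ℝ → Prop} (hP : ∀ K, ∃ C : ℝ, 0 < C ∧ P K C)
    (hmono : ∀ K C C', 0 < C → C ≤ C' → P K C → P K C') {K₁ : ℕ}
    (hc : ∀ K C, K₁ ≤ K → P K₁ C → P K C) : ∃ C : ℝ, 0 < C ∧ ∀ K, P K C := by
  choose C hC0 hC using hP
  have hle : ∀ K ≤ K₁, C K ≤ ∑ i ∈ Finset.range (K₁ + 1), C i := fun K hK =>
    Finset.single_le_sum (f := C) (fun i _ => (hC0 i).le) (Finset.mem_range.2 (by omega))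
  refine ⟨∑ i ∈ Finset.range (K₁ + 1), C i, (hC0 0).trans_le (hle 0 (Nat.zero_le _)), fun K => ?_⟩
  rcases le_total K K₁ with h | h
  · exact hmono K _ _ (hC0 K) (hle K h) (hC K)
  · exact hc K _ h (hmono K₁ _ _ (hC0 K₁) (hle K₁ le_rfl) (hC K₁))

/-- The kernel estimate has a constant depending on the amplitude. Since the amplitudes stabilise
from some `K₁` on, finitely many constants suffice. -/
lemma exists_uniform_setIntegral_norm_sq_kernel_le (hn : 0 < n) (hϑ : IsRadialCutoff ϑ)
    (hφ : IsPhase φ) (hχ₀ : IsHighFrequencyCutoff k₀ χ₀) (s : ℝ) (k₁ j : ℕ) (μ : ℝ) :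
    ∃ C : ℝ, 0 < C ∧ ∀ (K : ℕ) (l : ℝ) (w x₀ : Rn n) (τ : 𝓢(Rn n, ℂ)) (f : Rn n → ℂ),
      (4 * 2 ^ K : ℝ)⁻¹ ≤ l → l ≤ 1 / 4 →
      (∀ ξ, τ ξ = oscSymbol (fun ξ => 2 * Real.pi * φ ξ)
        (blockAmplitude ϑ s k₁ j χ₀ μ (4 * 2 ^ K)) (4 * 2 ^ K) w ξ) →
      LocallyIntegrable f → bmoSeminorm f ≠ ⊤ →
      ∫ x in Metric.ball x₀ (l / 2), ‖∫ y, 𝓕 τ (y - x) * f y‖ ^ 2 ≤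
        (C * (bmoSeminorm f).toReal) ^ 2 * l := by
  have hπ := Real.pi_pos
  obtain ⟨c, c', hc, hp⟩ := exists_isAnnularSymbol_blockProfile hϑ s k₁ j
  -- From this `K₁` on, `χ₀ = 1` on the support of the block.
  obtain ⟨K₁, hK₁⟩ := pow_unbounded_of_one_lt ((2 : ℝ) ^ (k₀ - 4) / c) (by norm_num : (1 : ℝ) < 2)
  rw [div_lt_iff₀ hc] at hK₁
  let Q : (Rn n → ℂ) → ℝ → Prop := fun a C =>
    ∀ (lam l : ℝ) (w x₀ : Rn n) (τ : 𝓢(Rn n, ℂ)) (f : Rn n → ℂ), 0 < lam → lam⁻¹ ≤ l → l ≤ 1 / 4 →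
      (∀ ξ, τ ξ = oscSymbol (fun ξ => 2 * Real.pi * φ ξ) a lam w ξ) →
      LocallyIntegrable f → bmoSeminorm f ≠ ⊤ →
      ∫ x in Metric.ball x₀ (l / 2), ‖∫ y, 𝓕 τ (y - x) * f y‖ ^ 2 ≤
        (C * (bmoSeminorm f).toReal) ^ 2 * l
  have h := exists_forall_le_of_eventually_const (K₁ := K₁)
    (P := fun K C => Q (blockAmplitude ϑ s k₁ j χ₀ μ (4 * 2 ^ K)) C)
    (fun K => exists_setIntegral_norm_sq_kernel_le hn (hφ.const_mul _).isSmoothHomogeneous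
      (isAnnularSymbol_blockAmplitude hp hc hχ₀ μ (4 * 2 ^ K)) (by positivity))
    (fun K C C' hC hCC' hQ lam l w x₀ τ f h1 h2 h3 h4 h5 h6 => by
      have hl0 : 0 < l := lt_of_lt_of_le (by positivity) h2
      refine (hQ lam l w x₀ τ f h1 h2 h3 h4 h5 h6).trans ?_
      gcongr)
    (fun K C hK hQ => by
      rwa [blockAmplitude_eq_of_le hp hχ₀ μ (lam := 4 * 2 ^ K₁) (lam' := 4 * 2 ^ K) (by positivity)
        (by linarith) (by gcongr; norm_num)])
  obtain ⟨C, hC, h⟩ := h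
  exact ⟨C, hC, fun K l w x₀ τ f h1 h2 h3 h4 h5 =>
    h K (4 * 2 ^ K) l w x₀ τ f (by positivity) h1 h2 h3 h4 h5⟩

/-- The frequency localised pieces of `T_d^φ f` are continuous functions with local `L²` bounds. -/
theorem exists_block_bound (hn : 0 < n) (hϑ : IsRadialCutoff ϑ)
    (hφ : IsPhase φ) (hχ₀ : IsHighFrequencyCutoff k₀ χ₀) (s : ℝ) (k₁ j : ℕ) (μ : ℝ) :
    ∃ C : ℝ, 0 < C ∧ ∀ (u : Rn n) (K : ℕ) (f : Rn n → ℂ) (U : 𝓢'(Rn n, ℂ)),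
      LocallyIntegrable f → bmoSeminorm f ≠ ⊤ → Represents U f →
      ∃ F : Rn n → ℂ, Continuous F ∧
        Represents ((opQ ϑ s k₁ j u (K : ℤ) ∘L fio φ (amplitude χ₀ μ)) U) F ∧
        ∀ (l : ℝ) (x₀ : Rn n), (4 * 2 ^ K : ℝ)⁻¹ ≤ l → l ≤ 1 / 4 →
          ∫ x in Metric.ball x₀ (l / 2), ‖F x‖ ^ 2 ≤
            ((4 * 2 ^ K : ℝ) ^ μ) ^ 2 * ((C * (bmoSeminorm f).toReal) ^ 2 * l) := by
  have hπ := Real.pi_pos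
  obtain ⟨C, hC, h⟩ := exists_uniform_setIntegral_norm_sq_kernel_le hn hϑ hφ hχ₀ s k₁ j μ
  obtain ⟨c, c', hc, hp⟩ := exists_isAnnularSymbol_blockProfile hϑ s k₁ j
  refine ⟨C, hC, fun u K f U hf hb hU => ?_⟩
  have hmod := hasModerateGrowth_of_bmoSeminorm_ne_top hf hb
  have hlam : (0 : ℝ) < 4 * 2 ^ K := by positivity
  set lam : ℝ := 4 * 2 ^ K
  set w : Rn n := (2 * Real.pi * 2 ^ (-(K : ℤ))) • u
  have ha := isAnnularSymbol_blockAmplitude hp hc hχ₀ μ lam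
  have hΦ := (hφ.const_mul (2 * Real.pi)).isSmoothHomogeneous
  set τ : 𝓢(Rn n, ℂ) := (hasCompactSupport_oscSymbol (w := w)
    (Φ := fun ξ => 2 * Real.pi * φ ξ) ha hlam).toSchwartzMap
      (contDiff_oscSymbol hΦ ha (by positivity) hlam)
  have hτ : ∀ ξ, τ ξ = oscSymbol (fun ξ => 2 * Real.pi * φ ξ)
      (blockAmplitude ϑ s k₁ j χ₀ μ lam) lam w ξ := fun ξ => rfl
  have hcont := hmod.continuous_integral_kernel (𝓕 τ)
  refine ⟨fun x => ((lam ^ μ : ℝ) : ℂ) * ∫ y, 𝓕 τ (y - x) * f y, continuous_const.mul hcont,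
    fun G => ⟨?_, ?_⟩, fun l x₀ hl hl4 => ?_⟩
  · have h1 := (hmod.integrable_kernel (𝓕 τ) G).integral_prod_left
    simp only [integral_const_mul] at h1
    refine (h1.const_mul ((lam ^ μ : ℝ) : ℂ)).congr (Filter.Eventually.of_forall fun x => ?_)
    simp only
    ring
  · rw [composite_apply hϑ hφ hχ₀]
    have h2 : SchwartzMap.smulLeftCLM ℂ (fun ξ => ((lam ^ μ : ℝ) : ℂ) *
        oscSymbol (fun ξ => 2 * Real.pi * φ ξ) (blockAmplitude ϑ s k₁ j χ₀ μ lam) lam w ξ) (𝓕⁻ G) =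
        ((lam ^ μ : ℝ) : ℂ) • SchwartzMap.smulLeftCLM ℂ (τ : Rn n → ℂ) (𝓕⁻ G) := by
      ext ξ
      have ht : (fun ξ => ((lam ^ μ : ℝ) : ℂ) * τ ξ).HasTemperateGrowth := by
        have := τ.hasTemperateGrowth
        fun_prop
      rw [smul_apply, SchwartzMap.smulLeftCLM_apply_apply τ.hasTemperateGrowth]
      refine (SchwartzMap.smulLeftCLM_apply_apply ht _ _).trans ?_
      simp only [smul_eq_mul, mul_assoc]
    rw [h2, FourierTransform.fourier_smul, map_smul, (hU _).2,
      hmod.integral_fourier_smulLeft_mul τ G, smul_eq_mul, ← integral_const_mul]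
    refine integral_congr_ae (Filter.Eventually.of_forall fun x => ?_)
    simp only
    ring
  · simp only [norm_mul, mul_pow, Complex.norm_real]
    rw [integral_const_mul, Real.norm_of_nonneg (by positivity)]
    gcongr
    rw [← mul_pow]
    exact h K l w x₀ τ f hl hl4 hτ hf hb

end

/-! ### Cubes, averaging over balls and dyadic sums -/

section

variable {n : ℕ}

lemma isClosed_cube (c : Rn n) (h : ℝ) : IsClosed (cube c h) := by
  have : cube c h = ⋂ i, {x : Rn n | |x i - c i| ≤ h} := by
    ext x; simp [cube]
  rw [this]
  exact isClosed_iInter fun i => isClosed_le (by fun_prop) continuous_const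

lemma ball_subset_cube (c : Rn n) (h : ℝ) : Metric.ball c h ⊆ cube c h := fun x hx i => by
  rw [Metric.mem_ball, dist_eq_norm] at hx
  exact (PiLp.norm_apply_le (x - c) i).trans hx.le

lemma dist_le_of_mem_cube {c x y : Rn n} {h : ℝ} (hh : 0 < h) (hx : x ∈ cube c h)
    (hy : y ∈ cube c h) : dist x y ≤ 2 * n * h := by
  have h1 : ∀ i, ‖(x - y) i‖ ^ 2 ≤ (2 * h) ^ 2 := fun i => by
    have h2 : |x i - y i| ≤ 2 * h := by
      have h3 := abs_le.1 (hx i)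
      have h4 := abs_le.1 (hy i)
      rw [abs_le]
      constructor <;> linarith
    exact pow_le_pow_left₀ (norm_nonneg _) h2 2
  rw [dist_eq_norm, EuclideanSpace.norm_eq]
  refine Real.sqrt_le_iff.2 ⟨by positivity, (Finset.sum_le_sum fun i _ => h1 i).trans ?_⟩
  rw [Finset.sum_const, Finset.card_univ, Fintype.card_fin, nsmul_eq_mul]
  rcases Nat.eq_zero_or_pos n with h0 | h0
  · simp [h0]
  · have : (1 : ℝ) ≤ n := by exact_mod_cast h0
    nlinarith [mul_pos hh hh, mul_nonneg (sub_nonneg.2 this) (mul_pos hh hh).le]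

lemma isBounded_cube (c : Rn n) {h : ℝ} (hh : 0 < h) : Bornology.IsBounded (cube c h) :=
  Metric.isBounded_iff.2 ⟨2 * n * h, fun _ hx _ hy => dist_le_of_mem_cube hh hx hy⟩

lemma diam_cube_le (c : Rn n) {h : ℝ} (hh : 0 < h) : Metric.diam (cube c h) ≤ 2 * n * h :=
  Metric.diam_le_of_forall_dist_le (by positivity) fun _ hx _ hy => dist_le_of_mem_cube hh hx hy

lemma diam_cube_pos (hn : 0 < n) (c : Rn n) {h : ℝ} (hh : 0 < h) : 0 < Metric.diam (cube c h) := by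
  have h1 : c ∈ cube c h := fun i => by simpa using hh.le
  have h2 : c + EuclideanSpace.single ⟨0, hn⟩ h ∈ cube c h := fun i => by
    by_cases hi : i = ⟨0, hn⟩
    · simp [hi, abs_of_pos hh]
    · simp [hi, hh.le]
  have h3 := Metric.dist_le_diam_of_mem (isBounded_cube c hh) h2 h1
  have h4 : dist (c + EuclideanSpace.single ⟨0, hn⟩ h) c = h := by
    rw [dist_eq_norm, add_sub_cancel_left]
    simp [abs_of_pos hh]
  linarith

/-- The cube is symmetric about its centre, so it contains `x` together with its mirror image. -/
lemma two_mul_dist_center_le {c x : Rn n} {h : ℝ} (hh : 0 < h) (hx : x ∈ cube c h) :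
    2 * dist x c ≤ Metric.diam (cube c h) := by
  have h1 : c - (x - c) ∈ cube c h := fun i => by
    have := hx i
    simp only [PiLp.sub_apply]
    rw [show c i - (x i - c i) - c i = -(x i - c i) by ring, abs_neg]
    exact this
  have h2 := Metric.dist_le_diam_of_mem (isBounded_cube c hh) hx h1
  refine le_trans (le_of_eq ?_) h2
  rw [dist_eq_norm, dist_eq_norm, show x - (c - (x - c)) = (2 : ℝ) • (x - c) by
    rw [two_smul]; abel, norm_smul]
  simp

/-- A uniform bound for the integrals over balls gives a bound for integrals over larger sets. -/
lemma volume_ball_mul_setLIntegral_le {g : Rn n → ℝ≥0∞} (hg : Measurable g) {Q Q' : Set (Rn n)}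
    (hQ : MeasurableSet Q) (hQ' : MeasurableSet Q') {r : ℝ} {B : ℝ≥0∞}
    (hB : ∀ x, ∫⁻ y in Metric.ball x r, g y ≤ B) (hsub : ∀ x ∈ Q, Metric.ball x r ⊆ Q') :
    volume (Metric.ball (0 : Rn n) r) * ∫⁻ x in Q, g x ≤ B * volume Q' := by
  have hm : Measurable (Function.uncurry fun x z : Rn n =>
      (Metric.ball z r).indicator (Q.indicator g) x) := by
    have h1 : (Function.uncurry fun x z : Rn n => (Metric.ball z r).indicator (Q.indicator g) x) =
        {p : Rn n × Rn n | dist p.1 p.2 < r}.indicator (fun p => Q.indicator g p.1) := by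
      ext p
      rfl
    rw [h1]
    refine ((hg.indicator hQ).comp measurable_fst).indicator ?_
    exact (isOpen_lt continuous_dist continuous_const).measurableSet
  calc volume (Metric.ball (0 : Rn n) r) * ∫⁻ x in Q, g x
      = ∫⁻ x, ∫⁻ z, (Metric.ball z r).indicator (Q.indicator g) x := by
        rw [← lintegral_indicator hQ, ← lintegral_const_mul _ (hg.indicator hQ)]
        refine lintegral_congr fun x => ?_
        have h1 : ∀ z, (Metric.ball z r).indicator (Q.indicator g) x =
            (Metric.ball x r).indicator (fun _ => Q.indicator g x) z := fun z => by
          by_cases hz : x ∈ Metric.ball z r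
          · rw [indicator_of_mem hz]
            exact (indicator_of_mem (Metric.mem_ball_comm.1 hz) fun _ => Q.indicator g x).symm
          · rw [indicator_of_notMem hz]
            exact (indicator_of_notMem (fun h => hz (Metric.mem_ball_comm.1 h))
              fun _ => Q.indicator g x).symm
        simp only [h1]
        rw [lintegral_indicator measurableSet_ball, setLIntegral_const, mul_comm,
          Measure.addHaar_ball_center volume x]
    _ = ∫⁻ z, ∫⁻ x, (Metric.ball z r).indicator (Q.indicator g) x :=
        lintegral_lintegral_swap hm.aemeasurable
    _ ≤ ∫⁻ z, Q'.indicator (fun _ => B) z := by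
        refine lintegral_mono fun z => ?_
        rw [lintegral_indicator measurableSet_ball]
        by_cases hz : z ∈ Q'
        · rw [indicator_of_mem hz]
          exact (lintegral_mono (indicator_le_self Q g)).trans (hB z)
        · rw [indicator_of_notMem hz, nonpos_iff_eq_zero,
            setLIntegral_congr_fun (g := fun _ => 0) measurableSet_ball]
          · simp
          · intro x hx
            exact indicator_of_notMem (fun hxQ => hz (hsub x hxQ (by rwa [Metric.mem_ball_comm]))) g
    _ = B * volume Q' := by rw [lintegral_indicator hQ', setLIntegral_const]

lemma setLIntegral_enorm_sq_eq {F : Rn n → ℂ} (hF : Continuous F) (x : Rn n) (r : ℝ) :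
    ∫⁻ y in Metric.ball x r, ‖F y‖ₑ ^ 2 =
      ENNReal.ofReal (∫ y in Metric.ball x r, ‖F y‖ ^ 2) := by
  rw [ofReal_integral_eq_lintegral_ofReal _ (Filter.Eventually.of_forall fun y => by positivity)]
  · refine lintegral_congr fun y => ?_
    rw [ENNReal.ofReal_pow (norm_nonneg _), ofReal_norm]
  · exact ((hF.norm.pow 2).continuousOn.integrableOn_compact (isCompact_closedBall x r)).mono_set
      Metric.ball_subset_closedBall

/-- The terms vanish until `2^(-k)` drops below `m`; from there on a geometric series of ratio `1/2`
starts at most at `m`. -/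
lemma tsum_dyadic_le {m : ℝ} (hm : 0 < m) (t : ℕ → ℝ≥0∞) (A : ℝ≥0∞)
    (h0 : ∀ k : ℕ, m < (2 : ℝ) ^ (-(k : ℤ)) → t k = 0)
    (h1 : ∀ k : ℕ, (2 : ℝ) ^ (-(k : ℤ)) ≤ m → t k ≤ A * ENNReal.ofReal ((2 : ℝ) ^ (-(k : ℤ)))) :
    ∑' k, t k ≤ A * ENNReal.ofReal (2 * m) := by
  have hex : ∃ k : ℕ, (2 : ℝ) ^ (-(k : ℤ)) ≤ m := by
    obtain ⟨k, hk⟩ := exists_pow_lt_of_lt_one hm (by norm_num : (1 / 2 : ℝ) < 1)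
    refine ⟨k, ?_⟩
    rw [zpow_neg, zpow_natCast, ← inv_pow, ← one_div]
    exact hk.le
  classical
  set k₀ := Nat.find hex
  have hk₀ : (2 : ℝ) ^ (-(k₀ : ℤ)) ≤ m := Nat.find_spec hex
  have hs : ∑ i ∈ Finset.range k₀, t i = 0 := Finset.sum_eq_zero fun i hi =>
    h0 i (not_le.1 (Nat.find_min hex (Finset.mem_range.1 hi)))
  rw [← Summable.sum_add_tsum_nat_add' (k := k₀) ENNReal.summable, hs, zero_add]
  have hsum : Summable fun i : ℕ => (1 / 2 : ℝ) ^ i := summable_geometric_two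
  calc ∑' i, t (i + k₀) ≤ ∑' i : ℕ, A * ENNReal.ofReal m * ENNReal.ofReal ((1 / 2 : ℝ) ^ i) := by
        refine ENNReal.tsum_le_tsum fun i => ?_
        have e : (2 : ℝ) ^ (-((i + k₀ : ℕ) : ℤ)) = 2 ^ (-(k₀ : ℤ)) * (1 / 2 : ℝ) ^ i := by
          simp only [zpow_neg, zpow_natCast, pow_add, one_div, inv_pow, mul_inv]
          ring
        have h2 : (2 : ℝ) ^ (-((i + k₀ : ℕ) : ℤ)) ≤ m * (1 / 2 : ℝ) ^ i := by
          rw [e]; gcongr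
        refine (h1 _ (h2.trans (mul_le_of_le_one_right hm.le
          (pow_le_one₀ (by norm_num) (by norm_num))))).trans ?_
        rw [mul_assoc, ← ENNReal.ofReal_mul hm.le]
        gcongr
    _ = A * ENNReal.ofReal (2 * m) := by
        rw [ENNReal.tsum_mul_left, ← ENNReal.ofReal_tsum_of_nonneg (fun i => by positivity) hsum,
          tsum_geometric_two, mul_assoc, ← ENNReal.ofReal_mul hm.le, mul_comm m]

lemma squareMeasure_prod_Ioc (F : ℕ → Rn n → ℂ) {Q : Set (Rn n)} (hQ : MeasurableSet Q) (D : ℝ) :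
    squareMeasure F (Q ×ˢ Ioc 0 D) = ∑' k : ℕ, (∫⁻ x in Q, ‖F k x‖ₑ ^ 2) *
      (Ioc 0 D).indicator 1 ((2 : ℝ) ^ (-(k : ℤ))) := by
  rw [squareMeasure, Measure.sum_apply _ (hQ.prod measurableSet_Ioc)]
  refine tsum_congr fun k => ?_
  rw [Measure.prod_prod, withDensity_apply _ hQ, Measure.dirac_apply' _ measurableSet_Ioc]

end

/-! ### From local `L²` bounds to the Carleson norm -/

section

variable {n : ℕ}

lemma diam_pow_mul_volume_ball_le (c : Rn n) {h : ℝ} (hh : 0 < h) :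
    Metric.diam (cube c h) ^ n * volume.real (Metric.ball (0 : Rn n) 1) ≤
      (2 * n) ^ n * volume.real (cube c h) := by
  have h1 : h ^ n * volume.real (Metric.ball (0 : Rn n) 1) ≤ volume.real (cube c h) := by
    have h2 : volume.real (Metric.ball c h) = h ^ n * volume.real (Metric.ball (0 : Rn n) 1) := by
      rw [measureReal_def, volume_ball_Rn c hh, ENNReal.toReal_mul, ENNReal.toReal_ofReal (by positivity),
        measureReal_def]
    rw [← h2]
    exact measureReal_mono (ball_subset_cube c h) (isBounded_cube c hh).measure_lt_top.ne
  have h3 : (0 : ℝ) ≤ volume.real (Metric.ball (0 : Rn n) 1) := measureReal_nonneg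
  calc _ ≤ (2 * n * h) ^ n * volume.real (Metric.ball (0 : Rn n) 1) := by
        gcongr
        exact diam_cube_le c hh
    _ = (2 * n) ^ n * (h ^ n * volume.real (Metric.ball (0 : Rn n) 1)) := by
        rw [mul_pow]; ring
    _ ≤ _ := by gcongr

/-- Local `L²` bounds on small balls imply bounds on all cubes whose diameter is not too small. -/
lemma setLIntegral_cube_le (hn : 2 ≤ n) {F : Rn n → ℂ} (hF : Continuous F) {lam A : ℝ}
    (hlam : 4 ≤ lam) (hA : 0 ≤ A)
    (h : ∀ (l : ℝ) (x : Rn n), lam⁻¹ ≤ l → l ≤ 1 / 4 →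
      ∫ y in Metric.ball x (l / 2), ‖F y‖ ^ 2 ≤ (lam ^ (n - 1))⁻¹ * (A * l))
    (c : Rn n) {r : ℝ} (hr : 0 < r) (hD : lam⁻¹ ≤ Metric.diam (cube c r)) :
    ∫⁻ x in cube c r, ‖F x‖ₑ ^ 2 ≤
      ENNReal.ofReal ((32 * n) ^ n * (volume.real (Metric.ball (0 : Rn n) 1))⁻¹ *
        (A * lam⁻¹ * (min (Metric.diam (cube c r)) 1)⁻¹)) * volume (cube c r) := by
  have hn0 : 0 < n := by omega
  have hlam0 : 0 < lam := by linarith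
  have hD0 := diam_cube_pos hn0 c hr
  have hvol := diam_pow_mul_volume_ball_le c hr
  set D := Metric.diam (cube c r)
  set v := volume.real (Metric.ball (0 : Rn n) 1)
  set V := volume.real (cube c r)
  have hv : 0 < v := ENNReal.toReal_pos (Metric.measure_ball_pos _ _ one_pos).ne'
    measure_ball_lt_top.ne
  have hV : volume (cube c r) = ENNReal.ofReal V :=
    (ENNReal.ofReal_toReal (isBounded_cube c hr).measure_lt_top.ne).symm
  have hV0 : 0 ≤ V := measureReal_nonneg
  have hDn : D ^ n ≤ (2 * n) ^ n * v⁻¹ * V := by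
    rw [mul_right_comm, ← div_eq_mul_inv, le_div_iff₀ hv]
    exact hvol
  have hm0 : 0 < min D 1 := lt_min hD0 one_pos
  rw [hV, ← ENNReal.ofReal_mul (by positivity)]
  -- Here `n ≥ 2` enters: the decay of the amplitude gives at least one full power of `lam⁻¹`.
  have hpow : (lam ^ (n - 1))⁻¹ ≤ lam⁻¹ := by
    refine inv_anti₀ hlam0 ?_
    calc lam = lam ^ 1 := (pow_one _).symm
      _ ≤ _ := pow_le_pow_right₀ (by linarith) (by omega)
  -- A cube with `D ≤ 1/8` fits in one ball with `l = 2D ≤ 1/4`. A larger one is handled by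
  -- averaging over balls of radius `1/8`, the largest allowed.
  rcases le_or_gt D (1 / 8) with hD8 | hD8
  · have hsub : cube c r ⊆ Metric.ball c (2 * D / 2) := fun x hx => by
      have := two_mul_dist_center_le hr hx
      rw [Metric.mem_ball]
      change 2 * dist x c ≤ D at this
      linarith
    refine (lintegral_mono_set hsub).trans ?_
    rw [setLIntegral_enorm_sq_eq hF]
    refine ENNReal.ofReal_le_ofReal ((h (2 * D) c (by linarith) (by linarith)).trans ?_)
    rw [min_eq_left (by linarith : D ≤ 1)]
    -- One factor `lam⁻¹` is kept for the sum over frequencies; the other `n - 2` are traded for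
    -- `D`, which rebuilds the volume `D ^ n` up to `D⁻¹`.
    have h1 : (lam ^ (n - 1))⁻¹ ≤ lam⁻¹ * D ^ (n - 2) := by
      have e : n - 1 = (n - 2) + 1 := by omega
      rw [e, pow_succ, mul_inv, mul_comm, ← inv_pow]
      gcongr
    have h2 : D ^ (n - 2) * D = D⁻¹ * D ^ n := by
      have e : n = (n - 2) + 1 + 1 := by omega
      conv_rhs => rw [e]
      rw [pow_succ, pow_succ]
      field_simp
    -- The constant is dictated by the large cubes: `16 ^ n` from the ratio of the radii `2D` and
    -- `1/8`, and `(2n) ^ n` from comparing diameter with volume.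
    have h32 : (2 * (2 * n) ^ n : ℝ) ≤ (32 * n) ^ n := by
      rw [mul_pow, mul_pow, ← mul_assoc]
      gcongr
      calc (2 : ℝ) * 2 ^ n = 2 ^ (n + 1) := by ring
        _ ≤ 2 ^ (5 * n) := pow_le_pow_right₀ (by norm_num) (by omega)
        _ = 32 ^ n := by rw [pow_mul]; norm_num
    calc (lam ^ (n - 1))⁻¹ * (A * (2 * D)) ≤ (lam⁻¹ * D ^ (n - 2)) * (A * (2 * D)) := by gcongr
      _ = 2 * A * lam⁻¹ * (D ^ (n - 2) * D) := by ring
      _ = 2 * A * lam⁻¹ * D⁻¹ * D ^ n := by rw [h2]; ring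
      _ ≤ 2 * A * lam⁻¹ * D⁻¹ * ((2 * n) ^ n * v⁻¹ * V) := by gcongr
      _ = (2 * (2 * n) ^ n) * v⁻¹ * (A * lam⁻¹ * D⁻¹) * V := by ring
      _ ≤ _ := by gcongr
  · have hB : ∀ x, ∫⁻ y in Metric.ball x (1 / 8), ‖F y‖ₑ ^ 2 ≤ ENNReal.ofReal (A * lam⁻¹) := by
      intro x
      rw [setLIntegral_enorm_sq_eq hF]
      refine ENNReal.ofReal_le_ofReal ?_
      have h1 := h (1 / 4) x (by rw [inv_le_comm₀ hlam0 (by norm_num)]; linarith) le_rfl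
      rw [show (1 / 4 / 2 : ℝ) = 1 / 8 by norm_num] at h1
      refine h1.trans ?_
      calc (lam ^ (n - 1))⁻¹ * (A * (1 / 4)) ≤ lam⁻¹ * (A * 1) := by gcongr; norm_num
        _ = _ := by ring
    have h3 := volume_ball_mul_setLIntegral_le (g := fun y => ‖F y‖ₑ ^ 2)
      (hF.enorm.measurable.pow_const 2) (isClosed_cube c r).measurableSet
      (measurableSet_ball (x := c) (ε := 2 * D)) hB (fun x hx y hy => by
        have h4 := two_mul_dist_center_le hr hx
        change 2 * dist x c ≤ D at h4
        rw [Metric.mem_ball] at hy ⊢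
        linarith [dist_triangle y x c])
    have hvb : volume (Metric.ball (0 : Rn n) 1) = ENNReal.ofReal v :=
      (ENNReal.ofReal_toReal measure_ball_lt_top.ne).symm
    rw [volume_ball_Rn (0 : Rn n) (by norm_num : (0 : ℝ) < 1 / 8),
      volume_ball_Rn c (by positivity : 0 < 2 * D), hvb,
      ← ENNReal.ofReal_mul (by positivity), ← ENNReal.ofReal_mul (by positivity),
      ← ENNReal.ofReal_mul (by positivity)] at h3
    have hw : 0 < (1 / 8 : ℝ) ^ n * v := by positivity
    have h5 : ∫⁻ x in cube c r, ‖F x‖ₑ ^ 2 ≤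
        ENNReal.ofReal (A * lam⁻¹ * ((2 * D) ^ n * v)) / ENNReal.ofReal ((1 / 8 : ℝ) ^ n * v) := by
      rw [ENNReal.le_div_iff_mul_le (Or.inl (by simpa using hw)) (Or.inl ENNReal.ofReal_ne_top),
        mul_comm]
      exact h3
    refine h5.trans ?_
    rw [← ENNReal.ofReal_div_of_pos hw]
    refine ENNReal.ofReal_le_ofReal ?_
    have h6 : 1 ≤ (min D 1)⁻¹ := (one_le_inv₀ hm0).2 (min_le_right _ _)
    calc A * lam⁻¹ * ((2 * D) ^ n * v) / ((1 / 8) ^ n * v) = A * lam⁻¹ * (16 ^ n * D ^ n) := by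
          rw [mul_pow, div_eq_iff hw.ne', show (16 : ℝ) = 2 * 8 by norm_num, mul_pow, one_div, inv_pow]
          field_simp
      _ ≤ A * lam⁻¹ * (16 ^ n * ((2 * n) ^ n * v⁻¹ * V)) := by gcongr
      _ = (32 * n) ^ n * v⁻¹ * (A * lam⁻¹ * 1) * V := by
          rw [show (32 * n : ℝ) = 16 * (2 * n) by ring, mul_pow 16]
          ring
      _ ≤ _ := by gcongr

/-- The Carleson bound for a sequence of functions with local `L²` bounds. -/
lemma carlesonNorm_squareMeasure_le (hn : 2 ≤ n) {F : ℕ → Rn n → ℂ} (hF : ∀ i, Continuous (F i))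
    (k : ℕ) {A : ℝ} (hA : 0 ≤ A)
    (h : ∀ (i : ℕ) (l : ℝ) (x : Rn n), (4 * 2 ^ (k + i) : ℝ)⁻¹ ≤ l → l ≤ 1 / 4 →
      ∫ y in Metric.ball x (l / 2), ‖F i y‖ ^ 2 ≤ ((4 * 2 ^ (k + i)) ^ (n - 1))⁻¹ * (A * l)) :
    carlesonNorm (squareMeasure F) ≤
      ENNReal.ofReal ((32 * n) ^ n * (volume.real (Metric.ball (0 : Rn n) 1))⁻¹ *
        A * (2 ^ k)⁻¹) := by
  have hn0 : 0 < n := by omega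
  refine iSup_le fun c => iSup_le fun r => iSup_le fun hr => ?_
  refine ENNReal.div_le_of_le_mul ?_
  rw [squareMeasure_prod_Ioc F (isClosed_cube c r).measurableSet]
  have hD0 := diam_cube_pos hn0 c hr
  have hcube := fun i => setLIntegral_cube_le hn (hF i) (lam := 4 * 2 ^ (k + i))
    (by have : (1 : ℝ) ≤ 2 ^ (k + i) := one_le_pow₀ (by norm_num)
        linarith) hA (h i) c hr
  set D := Metric.diam (cube c r)
  set M : ℝ := (32 * n) ^ n * (volume.real (Metric.ball (0 : Rn n) 1))⁻¹
  have hM : 0 ≤ M := by positivity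
  have hm0 : 0 < min D 1 := lt_min hD0 one_pos
  -- All heights satisfy `2^(-i) ≤ 1`, so the box sees exactly those with `2^(-i) ≤ min D 1`. For
  -- these `lam⁻¹ ≤ 2^(-i) ≤ D`, so the cube bound is available, and it is proportional to `2^(-k)
  -- 2^(-i) (min D 1)⁻¹`.
  refine (tsum_dyadic_le hm0 _ (ENNReal.ofReal (M * (A * (4 * 2 ^ k)⁻¹ * (min D 1)⁻¹)) *
    volume (cube c r)) (fun i hi => ?_) fun i hi => ?_).trans ?_
  · have h2 : (2 : ℝ) ^ (-(i : ℤ)) ≤ 1 := by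
      rw [zpow_neg, zpow_natCast]
      exact inv_le_one_of_one_le₀ (one_le_pow₀ (by norm_num))
    rw [indicator_of_notMem, mul_zero]
    intro h3
    rw [min_lt_iff] at hi
    rcases hi with hi | hi
    · exact absurd h3.2 (not_le.2 hi)
    · linarith
  · have h2 : (2 : ℝ) ^ (-(i : ℤ)) ≤ D := hi.trans (min_le_left _ _)
    rw [indicator_of_mem (show (2 : ℝ) ^ (-(i : ℤ)) ∈ Ioc 0 D from ⟨by positivity, h2⟩), Pi.one_apply, mul_one]
    refine (hcube i ?_).trans (le_of_eq ?_)
    · refine le_trans ?_ h2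
      rw [zpow_neg, zpow_natCast]
      refine inv_anti₀ (by positivity) ?_
      rw [pow_add]
      have h4 : (1 : ℝ) ≤ 2 ^ k := one_le_pow₀ (by norm_num)
      have h5 : (0 : ℝ) < 2 ^ i := by positivity
      nlinarith
    · rw [mul_right_comm (ENNReal.ofReal _) (volume (cube c r)), ← ENNReal.ofReal_mul (by positivity)]
      congr 2
      rw [pow_add, zpow_neg, zpow_natCast]
      field_simp
  · rw [mul_right_comm, ← ENNReal.ofReal_mul (by positivity)]
    refine mul_le_mul' (ENNReal.ofReal_le_ofReal ?_) le_rfl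
    have h4 : 0 ≤ M * A * (2 ^ k)⁻¹ := by positivity
    calc M * (A * (4 * 2 ^ k)⁻¹ * (min D 1)⁻¹) * (2 * min D 1) = M * A * (2 ^ k)⁻¹ * (1 / 2) := by
          field_simp
          norm_num
      _ ≤ _ := by linarith

end

end

/-! ### The Carleson estimate -/

theorem mainTheorem6 (n : ℕ) (hn : 2 ≤ n)
    (ψ₀ : Rn n → ℂ) (hψ₀ : IsLowFrequencyCutoff ψ₀)
    (ϑ : Rn n → ℝ) (hϑ : IsRadialCutoff ϑ)
    (k₀ : ℤ) (χ₀ : Rn n → ℝ) (hχ₀ : IsHighFrequencyCutoff k₀ χ₀)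
    (k₁ : ℕ) (s : ℝ)
    (φ : Rn n → ℝ) (hφ : IsPhase φ)
    (j : ℕ) (hj : j = 1 ∨ j = 2) :
    ∃ C : ℝ, 0 < C ∧
      ∀ (u : Rn n) (k : ℕ) (f : Rn n → ℂ), MemBmo ψ₀ f →
        ∃ U : 𝓢'(Rn n, ℂ), Represents U f ∧
          ∃ F : ℕ → Rn n → ℂ,
            (∀ k' : ℕ, Continuous (F k') ∧
              Represents
                ((opQ ϑ s k₁ j u ((k : ℤ) + (k' : ℤ)) ∘L
                  fio φ (amplitude χ₀ (-((n : ℝ) - 1) / 2))) U)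
                (F k')) ∧
            IsCarlesonMeasure (squareMeasure F) ∧
            carlesonNorm (squareMeasure F) ≤
              ENNReal.ofReal (C * (2 : ℝ) ^ (-(k : ℝ) / 2)) * bmoNorm ψ₀ f ^ 2 := by
  obtain ⟨C, hC, h⟩ := exists_block_bound (by omega : 0 < n) hϑ hφ hχ₀ s k₁ j (-((n : ℝ) - 1) / 2)
  set M : ℝ := (32 * n) ^ n * (volume.real (Metric.ball (0 : Rn n) 1))⁻¹
  have hM : 0 ≤ M := by positivity
  refine ⟨M * C ^ 2 + 1, by positivity, fun u k f hf => ?_⟩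
  -- The `BMO` seminorm alone controls the blocks, because their symbols vanish near the origin.
  have hle : bmoSeminorm f ≤ bmoNorm ψ₀ f := le_self_add
  have hb : bmoSeminorm f ≠ ⊤ := (hle.trans_lt hf.2).ne
  obtain ⟨U, hU⟩ := (hasModerateGrowth_of_bmoSeminorm_ne_top hf.1 hb).exists_tempered_represents
  choose F hFc hFr hFb using fun k' : ℕ => h u (k + k') f U hf.1 hb hU
  have hnorm : carlesonNorm (squareMeasure F) ≤
      ENNReal.ofReal ((M * C ^ 2 + 1) * (2 : ℝ) ^ (-(k : ℝ) / 2)) * bmoNorm ψ₀ f ^ 2 := by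
    have h1 := carlesonNorm_squareMeasure_le hn hFc k (A := (C * (bmoSeminorm f).toReal) ^ 2)
      (by positivity) (fun i l x hl hl4 => by
        refine (hFb i l x hl hl4).trans_eq ?_
        congr 1
        have hlam : (0 : ℝ) ≤ 4 * 2 ^ (k + i) := by positivity
        -- The order `-(n-1)/2` of the amplitude, squared, is the power `lam^(-(n-1))` required by
        -- the Carleson lemma.
        rw [← Real.rpow_natCast (_ ^ _) 2, ← Real.rpow_mul hlam, ← Real.rpow_natCast _ (n - 1),
          ← Real.rpow_neg hlam]
        congr 1
        rw [Nat.cast_sub (by omega)]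
        push_cast
        ring)
    refine h1.trans ?_
    have h2 : ENNReal.ofReal (bmoSeminorm f).toReal ^ 2 ≤ bmoNorm ψ₀ f ^ 2 := by
      rw [ENNReal.ofReal_toReal hb]
      gcongr
    -- The argument yields the decay `2^(-k)`, of which only `2^(-k/2)` is claimed.
    have h3 : ((2 : ℝ) ^ k)⁻¹ ≤ (2 : ℝ) ^ (-(k : ℝ) / 2) := by
      rw [← Real.rpow_natCast, ← Real.rpow_neg (by norm_num)]
      refine Real.rpow_le_rpow_of_exponent_le (by norm_num) ?_
      have : (0 : ℝ) ≤ k := by positivity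
      linarith
    calc ENNReal.ofReal (M * (C * (bmoSeminorm f).toReal) ^ 2 * (2 ^ k)⁻¹)
        = ENNReal.ofReal (M * C ^ 2 * (2 ^ k)⁻¹) * ENNReal.ofReal (bmoSeminorm f).toReal ^ 2 := by
          rw [← ENNReal.ofReal_pow ENNReal.toReal_nonneg, ← ENNReal.ofReal_mul (by positivity)]
          congr 1
          ring
      _ ≤ _ := by
          gcongr
          linarith
  refine ⟨U, hU, F, fun k' => ⟨hFc k', ?_⟩, hnorm.trans_lt ?_, hnorm⟩
  · have := hFr k'
    rwa [Nat.cast_add] at this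
  · exact ENNReal.mul_lt_top ENNReal.ofReal_lt_top (ENNReal.pow_lt_top hf.2)
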